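/- Consider a random access machine whose programs work on finitely many integer registers and arrays, in which every operation (addition, truncated subtraction, multiplication, integer division, remainder, comparison, memory access, assignment, test) has unit cost. A tree decomposition of a graph $G=(V,E)$ is a tree $T$ with a bag $X_i\subseteq V$ for each node $i$, such that every vertex lies in some bag, both ends of every edge lie in a common bag, and whenever $v\in X_i\cap X_j$ then $v\in X_k$ for all nodes $k$ on the path from $i$ to $j$ in $T$; its width is $\max_i|X_i|-1$. A dominating set of $G$ is a set $D\subseteq V$ such that every vertex is in $D$ or has a neighbour in $D$. There is a single program that, given an $n$-vertex graph $G$ (by adjacency lists) and a tree decomposition $T$ of $G$ of width $t$ with $\mathcal{O}(n)$ nodes (the tree by adjacency lists, the bags by lists of vertices), computes the minimum size of a dominating set of $G$ in $\mathcal{O}(3^t\,t^2\,n)$ operations on $\mathcal{O}(t+\log n)$-bit numbers. For $t=0$, the factor $t^2$ and the term $t$ are read as $1$. The constants in the bounds depend only on the constant $a$ for which $T$ has at most $a\,n$ nodes. -/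

import Mathlib

/-! ### Tree decompositions and dominating sets -/

/-- A tree decomposition of `G` whose tree has node set `I`. -/
structure TreeDecomposition {V : Type*} (G : SimpleGraph V) (I : Type*) where
  /-- the tree -/
  tree : SimpleGraph I
  isTree : tree.IsTree
  /-- the bag of each node of the tree -/
  bag : I → Finset V
  vertex_mem : ∀ v : V, ∃ i : I, v ∈ bag i
  edge_mem : ∀ u v : V, G.Adj u v → ∃ i : I, u ∈ bag i ∧ v ∈ bag i
  path_mem : ∀ (v : V) (i j : I) (p : tree.Walk i j), p.IsPath →
    v ∈ bag i → v ∈ bag j → ∀ k ∈ p.support, v ∈ bag k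

/-- The width: the size of a largest bag, minus one. (If `V` is non-empty then some bag is
non-empty, so that the subtraction does not truncate.) -/
def TreeDecomposition.width {V I : Type*} [Fintype I] {G : SimpleGraph V}
    (T : TreeDecomposition G I) : ℕ :=
  (Finset.univ.sup fun i : I => (T.bag i).card) - 1

/-- `D` is a dominating set of `G`: each vertex lies in the closed neighbourhood of a member
of `D`. -/
def IsDominatingSet {V : Type*} (G : SimpleGraph V) (D : Finset V) : Prop :=
  ∀ v : V, ∃ d ∈ D, v = d ∨ G.Adj d v

/-- `m` is the minimum size of a dominating set of `G`. -/
def IsMinDominatingSetSize {V : Type*} (G : SimpleGraph V) (m : ℕ) : Prop :=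
  IsLeast {k : ℕ | ∃ D : Finset V, IsDominatingSet G D ∧ D.card = k} m

/-! ### The machine model

A random access machine with finitely many registers and finitely many arrays (those that its
program mentions), programmed in a structured language. All data are natural numbers. -/

namespace RAM

/-- The contents of the registers and of the arrays. -/
structure State where
  reg : ℕ → ℕ
  arr : ℕ → ℕ → ℕ

/-- The primitive operations. -/
inductive Op
  | add | sub | mul | div | mod | lt | eq

/-- Natural-number arithmetic (subtraction is truncated at `0`, and division is integer
division); comparisons return `1` for true and `0` for false. -/
def Op.eval : Op → ℕ → ℕ → ℕ
  | .add, x, y => x + y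
  | .sub, x, y => x - y
  | .mul, x, y => x * y
  | .div, x, y => x / y
  | .mod, x, y => x % y
  | .lt, x, y => if x < y then 1 else 0
  | .eq, x, y => if x = y then 1 else 0

inductive Expr
  /-- a numeral -/
  | const (k : ℕ)
  /-- the content of a register -/
  | reg (x : ℕ)
  /-- the content of the cell of array `a` whose index is the value of `e` -/
  | get (a : ℕ) (e : Expr)
  /-- a primitive operation applied to two values -/
  | op (o : Op) (e₁ e₂ : Expr)

/-- The value of an expression. -/
def Expr.val (s : State) : Expr → ℕ
  | .const k => k
  | .reg x => s.reg x
  | .get a e => s.arr a (e.val s)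
  | .op o e₁ e₂ => o.eval (e₁.val s) (e₂.val s)

/-- The number of operations performed when an expression is evaluated. Every arithmetic
operation, every comparison, every memory access and every use of a numeral counts as one. -/
def Expr.cost : Expr → ℕ
  | .const _ => 1
  | .reg _ => 1
  | .get _ e => e.cost + 1
  | .op _ e₁ e₂ => e₁.cost + e₂.cost + 1

/-- All numbers that occur while the expression is evaluated (operands, results, array indices)
have at most `b` bits. -/
def Expr.Fits (b : ℕ) (s : State) : Expr → Prop
  | .const k => k < 2 ^ b
  | .reg x => s.reg x < 2 ^ b
  | .get a e => e.Fits b s ∧ s.arr a (e.val s) < 2 ^ b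
  | .op o e₁ e₂ => e₁.Fits b s ∧ e₂.Fits b s ∧ o.eval (e₁.val s) (e₂.val s) < 2 ^ b

inductive Prog
  | skip
  /-- assign the value of `e` to register `x` -/
  | setReg (x : ℕ) (e : Expr)
  /-- assign the value of `e` to the cell of array `a` whose index is the value of `i` -/
  | setArr (a : ℕ) (i e : Expr)
  /-- sequential composition -/
  | seq (p q : Prog)
  /-- run `p` if the value of `e` is not `0`, and `q` otherwise -/
  | ite (e : Expr) (p q : Prog)
  /-- repeat `p` as long as the value of `e` is not `0` -/
  | loop (e : Expr) (p : Prog)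

/-- `Exec b p s c s'`: started in state `s`, program `p` halts in state `s'` after performing
exactly `c` operations, and all numbers that occur have at most `b` bits. Besides the operations
inside expressions, every assignment and every test of a condition counts as one operation. -/
inductive Exec (b : ℕ) : Prog → State → ℕ → State → Prop
  | skip (s : State) : Exec b .skip s 0 s
  | setReg (s : State) (x : ℕ) (e : Expr) (he : e.Fits b s) :
      Exec b (.setReg x e) s (e.cost + 1)
        ⟨Function.update s.reg x (e.val s), s.arr⟩
  | setArr (s : State) (a : ℕ) (i e : Expr) (hi : i.Fits b s) (he : e.Fits b s) :
      Exec b (.setArr a i e) s (i.cost + e.cost + 1)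
        ⟨s.reg, Function.update s.arr a (Function.update (s.arr a) (i.val s) (e.val s))⟩
  | seq {p q : Prog} {s s₁ s₂ : State} {c₁ c₂ : ℕ}
      (hp : Exec b p s c₁ s₁) (hq : Exec b q s₁ c₂ s₂) :
      Exec b (.seq p q) s (c₁ + c₂) s₂
  | ite_true {e : Expr} {p q : Prog} {s s' : State} {c : ℕ} (he : e.Fits b s)
      (hv : e.val s ≠ 0) (hp : Exec b p s c s') :
      Exec b (.ite e p q) s (e.cost + 1 + c) s'
  | ite_false {e : Expr} {p q : Prog} {s s' : State} {c : ℕ} (he : e.Fits b s)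
      (hv : e.val s = 0) (hq : Exec b q s c s') :
      Exec b (.ite e p q) s (e.cost + 1 + c) s'
  | loop_done {e : Expr} {p : Prog} {s : State} (he : e.Fits b s) (hv : e.val s = 0) :
      Exec b (.loop e p) s (e.cost + 1) s
  | loop_step {e : Expr} {p : Prog} {s s₁ s₂ : State} {c₁ c₂ : ℕ} (he : e.Fits b s)
      (hv : e.val s ≠ 0) (hp : Exec b p s c₁ s₁) (hl : Exec b (.loop e p) s₁ c₂ s₂) :
      Exec b (.loop e p) s (e.cost + 1 + c₁ + c₂) s₂

end RAM

/-! ### The input of the machine -/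

/-- `L` lists, for each vertex of the graph, its neighbours, each of them once, in any order. -/
def IsAdjLists {n : ℕ} (G : SimpleGraph (Fin n)) (L : Fin n → List (Fin n)) : Prop :=
  ∀ v, (L v).Nodup ∧ ∀ u, u ∈ L v ↔ G.Adj v u

/-- `L` lists, for each index, the members of the set with this index, each of them once,
in any order. -/
def IsListing {N n : ℕ} (S : Fin N → Finset (Fin n)) (L : Fin N → List (Fin n)) : Prop :=
  ∀ i, (L i).Nodup ∧ ∀ v, v ∈ L i ↔ v ∈ S i

/-- A family of lists is stored as two arrays. This is the first: cell `i ≤ N` holds the total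
length of the lists with index less than `i`, which is the position where list `i` starts. -/
def offsets {N n : ℕ} (L : Fin N → List (Fin n)) (i : ℕ) : ℕ :=
  if i ≤ N then (((List.ofFn L).take i).map List.length).sum else 0

/-- The second array: the lists of the family, written one after the other. -/
def entries {N n : ℕ} (L : Fin N → List (Fin n)) (j : ℕ) : ℕ :=
  (((List.ofFn L).flatten).map Fin.val).getD j 0

/-- The initial state of the machine, on a graph with vertex set `{0, …, n - 1}` and adjacency
lists `adj`, and a tree with node set `{0, …, N - 1}`, adjacency lists `tadj` and bags `bags`.
Everything else is `0` initially. -/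
def inputState {n N : ℕ} (adj : Fin n → List (Fin n)) (tadj : Fin N → List (Fin N))
    (bags : Fin N → List (Fin n)) : RAM.State where
  reg
    | 0 => n
    | 1 => N
    | _ => 0
  arr
    | 0 => offsets adj
    | 1 => entries adj
    | 2 => offsets tadj
    | 3 => entries tadj
    | 4 => offsets bags
    | 5 => entries bags
    | _ => fun _ => 0

/-! ### Reasoning about programs -/

namespace RAM

/-! The algorithm is dynamic programming over the tree, rooted by a search and extended by a virtual
root `N` with an empty bag. Nodes are processed in reverse search order. A table for a bag of size
`k` is indexed by the numbers below `3 ^ k`; the digit of a bag vertex is 2 if it is in the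
solution, 1 if it is required to be dominated from below, 0 otherwise. Only forgotten vertices of
the solution are counted, so that no vertex is counted twice. A processed node passes its table to
its parent by forgetting and introducing vertices (`IsTable.message`), and the result is joined with
the table of the parent (`IsTable.join`).

The join is the bottleneck: digitwise, the pairs (0,1), (1,0), (1,1) all join to 1, so enumerating
compatible pairs takes `5 ^ k` steps. If digit 1 is reinterpreted as "0 or 1", the join becomes
equality of the two colourings. Summation along each coordinate performs this reinterpretation, and
taking differences undoes it (`transform_add_indicatorTable`, `transform_sub_pairCount`). Since
minima cannot be subtracted, pairs of entries are counted instead, separately for each value, and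
values are added by a convolution (`convolve_sumCount`). The join entry is the smallest value with a
non-zero count.

Few values matter. If a partial solution is finite but the part of an optimal solution `S` below the
bag is larger by more than `k`, exchanging the two parts and adding the whole bag gives a smaller
dominating set (`IsTable.card_inter_le`). So the entries that belong to `S` lie within `k` of the
minima of their tables, and `2 * k + 1` values suffice for sums. Transforms and convolution then
take `O(k ^ 2 * 3 ^ k)` operations, and the counts are at most `9 ^ k`, which has `O(k)` bits.

Correctness is stated relative to one fixed minimum solution `S` (`IsTable`): every finite entry is
witnessed by a partial solution, and the entry at the states of `S` is no larger than what `S` uses.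
Other entries may be too large, even infinite, which is what permits values far from the minimum to
be dropped. At the virtual root this pins the table to the size of `S` (`IsTable.eq_card`).

The remaining work is cheaper: a search of the tree, an adjacency matrix, positions of vertices in
bags, and initial tables. The graph has at most `n` times the largest bag size many edges, since
each edge can be charged to an end whose topmost bag contains the other end
(`RootedDecomposition.sum_card_adj_le`). Programs are verified with a cost-bounding logic `Runs`
that bounds stored numbers by `W`; bit lengths follow because expressions in a fixed program raise
numbers to a fixed power only (`BExec.exec`). -/

/-- The state after an assignment to a register. -/
def State.setReg (s : State) (x v : ℕ) : State := ⟨Function.update s.reg x v, s.arr⟩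

/-- The state after an assignment to a cell of an array. -/
def State.setArr (s : State) (a i v : ℕ) : State :=
  ⟨s.reg, Function.update s.arr a (Function.update (s.arr a) i v)⟩

@[simp] theorem State.setReg_arr (s : State) (x v : ℕ) : (s.setReg x v).arr = s.arr := rfl

@[simp] theorem State.setArr_reg (s : State) (a i v : ℕ) : (s.setArr a i v).reg = s.reg := rfl

theorem State.setReg_reg (s : State) (x v y : ℕ) :
    (s.setReg x v).reg y = if y = x then v else s.reg y := Function.update_apply ..

theorem State.setArr_arr (s : State) (a i v a' : ℕ) :
    (s.setArr a i v).arr a' = if a' = a then Function.update (s.arr a) i v else s.arr a' :=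
  Function.update_apply ..

/-- Every number stored in the memory is less than `W`. -/
def State.Below (W : ℕ) (s : State) : Prop := (∀ x, s.reg x < W) ∧ ∀ a i, s.arr a i < W

/-- An exponent such that the values of `e` and of its subexpressions are less than `W ^ e.size`
when all stored numbers are less than `W`. -/
def Expr.size : Expr → ℕ
  | .const k => k + 1
  | .reg _ => 1
  | .get _ e => e.size + 1
  | .op _ e₁ e₂ => e₁.size + e₂.size + 1

/-- The maximum of the sizes of the expressions in a program. -/
def Prog.size : Prog → ℕ
  | .skip => 1
  | .setReg _ e => e.size
  | .setArr _ i e => max i.size e.size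
  | .seq p q => max p.size q.size
  | .ite e p q => max e.size (max p.size q.size)
  | .loop e p => max e.size p.size

/-- For `W ≥ 2`, each operation on numbers below two powers of `W` stays below the product of these
powers times `W`. In a fixed program the exponent is a constant, so intermediate results cost only a
constant factor in bit length. -/
theorem Expr.val_lt {W : ℕ} (hW : 2 ≤ W) {s : State} (hs : s.Below W) (e : Expr) :
    e.val s < W ^ e.size := by
  have hmono {a b : ℕ} (h : a ≤ b) : W ^ a ≤ W ^ b := Nat.pow_le_pow_right (by omega) h
  have hpos (a : ℕ) : 1 ≤ W ^ a := Nat.one_le_pow _ _ (by omega)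
  induction e with
  | const k =>
    calc k < 2 ^ (k + 1) := lt_trans k.lt_two_pow_self (Nat.pow_lt_pow_succ (by norm_num))
      _ ≤ W ^ (k + 1) := Nat.pow_le_pow_left hW _
  | reg x => simpa [Expr.val, Expr.size] using hs.1 x
  | get a e ih => exact lt_of_lt_of_le (hs.2 _ _) (by
      simpa [Expr.size] using hmono (show 1 ≤ e.size + 1 by omega))
  | op o e₁ e₂ h₁ h₂ =>
    simp only [Expr.val, Expr.size]
    have hm : W ^ e₁.size * W ^ e₂.size ≤ W ^ (e₁.size + e₂.size + 1) := by
      rw [← pow_add]; exact hmono (by omega)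
    have ha : W ^ e₁.size + W ^ e₂.size ≤ W ^ (e₁.size + e₂.size + 1) := by
      rw [pow_succ, pow_add]
      nlinarith [hpos e₁.size, hpos e₂.size, Nat.mul_le_mul (hpos e₁.size) (hpos e₂.size)]
    have hmul := Nat.mul_lt_mul'' h₁ h₂
    have h1 := hpos (e₁.size + e₂.size)
    have hp : 1 < W ^ (e₁.size + e₂.size + 1) := by
      rw [pow_succ]; nlinarith
    cases o <;> simp only [Op.eval]
    · omega
    · omega
    · omega
    · have := Nat.div_le_self (e₁.val s) (e₂.val s); omega
    · have := Nat.mod_le (e₁.val s) (e₂.val s); omega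
    · split <;> omega
    · split <;> omega

theorem Expr.fits {W b : ℕ} (hW : 2 ≤ W) {s : State} (hs : s.Below W) (e : Expr)
    (hb : W ^ e.size ≤ 2 ^ b) : e.Fits b s := by
  have hmono {a b : ℕ} (h : a ≤ b) : W ^ a ≤ W ^ b := Nat.pow_le_pow_right (by omega) h
  induction e with
  | const k => exact lt_of_lt_of_le ((Expr.const k).val_lt hW hs) hb
  | reg x => exact lt_of_lt_of_le ((Expr.reg x).val_lt hW hs) hb
  | get a e ih =>
    exact ⟨ih (le_trans (hmono (by simp [Expr.size])) hb),
      lt_of_lt_of_le ((Expr.get a e).val_lt hW hs) hb⟩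
  | op o e₁ e₂ h₁ h₂ =>
    exact ⟨h₁ (le_trans (hmono (by simp only [Expr.size]; omega)) hb),
      h₂ (le_trans (hmono (by simp only [Expr.size]; omega)) hb),
      lt_of_lt_of_le ((Expr.op o e₁ e₂).val_lt hW hs) hb⟩

/-- Like `Exec`, but bounds are imposed only on the numbers that are stored. -/
inductive BExec (W : ℕ) : Prog → State → ℕ → State → Prop
  | skip (s : State) : BExec W .skip s 0 s
  | setReg (s : State) (x : ℕ) (e : Expr) (he : e.val s < W) :
      BExec W (.setReg x e) s (e.cost + 1) (s.setReg x (e.val s))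
  | setArr (s : State) (a : ℕ) (i e : Expr) (he : e.val s < W) :
      BExec W (.setArr a i e) s (i.cost + e.cost + 1) (s.setArr a (i.val s) (e.val s))
  | seq {p q : Prog} {s s₁ s₂ : State} {c₁ c₂ : ℕ}
      (hp : BExec W p s c₁ s₁) (hq : BExec W q s₁ c₂ s₂) : BExec W (.seq p q) s (c₁ + c₂) s₂
  | ite_true {e : Expr} {p q : Prog} {s s' : State} {c : ℕ}
      (hv : e.val s ≠ 0) (hp : BExec W p s c s') : BExec W (.ite e p q) s (e.cost + 1 + c) s'
  | ite_false {e : Expr} {p q : Prog} {s s' : State} {c : ℕ}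
      (hv : e.val s = 0) (hq : BExec W q s c s') : BExec W (.ite e p q) s (e.cost + 1 + c) s'
  | loop_done {e : Expr} {p : Prog} {s : State} (hv : e.val s = 0) :
      BExec W (.loop e p) s (e.cost + 1) s
  | loop_step {e : Expr} {p : Prog} {s s₁ s₂ : State} {c₁ c₂ : ℕ} (hv : e.val s ≠ 0)
      (hp : BExec W p s c₁ s₁) (hl : BExec W (.loop e p) s₁ c₂ s₂) :
      BExec W (.loop e p) s (e.cost + 1 + c₁ + c₂) s₂

theorem State.Below.setReg {W : ℕ} {s : State} (h : s.Below W) {x v : ℕ} (hv : v < W) :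
    (s.setReg x v).Below W := by
  refine ⟨fun y => ?_, h.2⟩
  rw [State.setReg_reg]; split
  exacts [hv, h.1 y]

theorem State.Below.setArr {W : ℕ} {s : State} (h : s.Below W) {a i v : ℕ} (hv : v < W) :
    (s.setArr a i v).Below W := by
  refine ⟨h.1, fun a' i' => ?_⟩
  rw [State.setArr_arr]; split
  · rw [Function.update_apply]; split
    exacts [hv, h.2 _ _]
  · exact h.2 _ _

/-- Reduces all bit bounds to the numbers that are stored: subexpressions are controlled by
`Expr.fits`, and `State.Below` is preserved by every assignment. -/
theorem BExec.exec {W b : ℕ} (hW : 2 ≤ W) {p : Prog} {s s' : State} {c : ℕ}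
    (h : BExec W p s c s') (hs : s.Below W) (hb : W ^ p.size ≤ 2 ^ b) :
    Exec b p s c s' ∧ s'.Below W := by
  have hmono {a c : ℕ} (h : a ≤ c) (hb : W ^ c ≤ 2 ^ b) : W ^ a ≤ 2 ^ b :=
    le_trans (Nat.pow_le_pow_right (by omega) h) hb
  induction h with
  | skip s => exact ⟨.skip s, hs⟩
  | setReg s x e he => exact ⟨.setReg s x e (e.fits hW hs hb), hs.setReg he⟩
  | setArr s a i e he =>
    exact ⟨.setArr s a i e (i.fits hW hs (hmono (le_max_left _ _) hb))
      (e.fits hW hs (hmono (le_max_right _ _) hb)), hs.setArr he⟩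
  | seq _ _ ihp ihq =>
    obtain ⟨h₁, hs₁⟩ := ihp hs (hmono (le_max_left _ _) hb)
    obtain ⟨h₂, hs₂⟩ := ihq hs₁ (hmono (le_max_right _ _) hb)
    exact ⟨.seq h₁ h₂, hs₂⟩
  | ite_true hv _ ih =>
    obtain ⟨h₁, hs₁⟩ := ih hs (hmono (le_trans (le_max_left _ _) (le_max_right _ _)) hb)
    exact ⟨.ite_true (Expr.fits hW hs _ (hmono (le_max_left _ _) hb)) hv h₁, hs₁⟩
  | ite_false hv _ ih =>
    obtain ⟨h₁, hs₁⟩ := ih hs (hmono (le_trans (le_max_right _ _) (le_max_right _ _)) hb)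
    exact ⟨.ite_false (Expr.fits hW hs _ (hmono (le_max_left _ _) hb)) hv h₁, hs₁⟩
  | loop_done hv => exact ⟨.loop_done (Expr.fits hW hs _ (hmono (le_max_left _ _) hb)) hv, hs⟩
  | loop_step hv _ _ ihp ihl =>
    obtain ⟨h₁, hs₁⟩ := ihp hs (hmono (le_max_right _ _) hb)
    obtain ⟨h₂, hs₂⟩ := ihl hs₁ hb
    exact ⟨.loop_step (Expr.fits hW hs _ (hmono (le_max_left _ _) hb)) hv h₁ h₂, hs₂⟩

/-- Frame conditions test indices with `Nat.beq`, so that for concrete programs they hold by `rfl`.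
This covers the programs in which a register number is a variable. -/
theorem nat_beq_eq_false {x y : ℕ} (h : x ≠ y) : Nat.beq x y = false := by
  rcases e : Nat.beq x y with _ | _
  · rfl
  · exact (h (Nat.eq_of_beq_eq_true e)).elim

/-- `p` contains no assignment to register `x`. -/
def Prog.keepsReg : Prog → ℕ → Bool
  | .skip, _ => true
  | .setReg y _, x => !Nat.beq x y
  | .setArr _ _ _, _ => true
  | .seq p q, x => p.keepsReg x && q.keepsReg x
  | .ite _ p q, x => p.keepsReg x && q.keepsReg x
  | .loop _ p, x => p.keepsReg x

/-- `p` contains no assignment to a cell of array `a`. -/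
def Prog.keepsArr : Prog → ℕ → Bool
  | .skip, _ => true
  | .setReg _ _, _ => true
  | .setArr a' _ _, a => !Nat.beq a a'
  | .seq p q, a => p.keepsArr a && q.keepsArr a
  | .ite _ p q, a => p.keepsArr a && q.keepsArr a
  | .loop _ p, a => p.keepsArr a

/-- `s` and `s'` agree on everything that `p` does not assign to. -/
structure Agree (p : Prog) (s s' : State) : Prop where
  reg : ∀ x, p.keepsReg x = true → s'.reg x = s.reg x
  arr : ∀ a, p.keepsArr a = true → s'.arr a = s.arr a

theorem Agree.refl (p : Prog) (s : State) : Agree p s s := ⟨fun _ _ => rfl, fun _ _ => rfl⟩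

theorem Agree.trans {p : Prog} {s₁ s₂ s₃ : State} (h : Agree p s₁ s₂) (h' : Agree p s₂ s₃) :
    Agree p s₁ s₃ :=
  ⟨fun x hx => (h'.reg x hx).trans (h.reg x hx), fun a ha => (h'.arr a ha).trans (h.arr a ha)⟩

theorem Agree.mono {p q : Prog} {s s' : State} (h : Agree p s s')
    (hr : ∀ x, q.keepsReg x = true → p.keepsReg x = true)
    (ha : ∀ a, q.keepsArr a = true → p.keepsArr a = true) : Agree q s s' :=
  ⟨fun x hx => h.reg x (hr x hx), fun a hx => h.arr a (ha a hx)⟩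

theorem Agree.seq_left {p q : Prog} {s s' : State} (h : Agree p s s') : Agree (.seq p q) s s' :=
  h.mono (by simp +contextual [Prog.keepsReg]) (by simp +contextual [Prog.keepsArr])

theorem Agree.seq_right {p q : Prog} {s s' : State} (h : Agree q s s') : Agree (.seq p q) s s' :=
  h.mono (by simp +contextual [Prog.keepsReg]) (by simp +contextual [Prog.keepsArr])

/-- The frame rule. It carries every fact about untouched registers and arrays across a program,
loops included. -/
theorem BExec.agree {W : ℕ} {p : Prog} {s s' : State} {c : ℕ} (h : BExec W p s c s') :
    Agree p s s' := by
  induction h with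
  | skip s => exact .refl ..
  | setReg s x e he =>
    refine ⟨fun y hy => ?_, fun _ _ => rfl⟩
    rw [State.setReg_reg, if_neg]
    rintro rfl
    simp [Prog.keepsReg] at hy
  | setArr s a i e he =>
    refine ⟨fun _ _ => rfl, fun y hy => ?_⟩
    rw [State.setArr_arr, if_neg]
    rintro rfl
    simp [Prog.keepsArr] at hy
  | seq _ _ ihp ihq => exact ihp.seq_left.trans ihq.seq_right
  | ite_true _ _ ih =>
    exact ih.mono (by simp +contextual [Prog.keepsReg]) (by simp +contextual [Prog.keepsArr])
  | ite_false _ _ ih =>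
    exact ih.mono (by simp +contextual [Prog.keepsReg]) (by simp +contextual [Prog.keepsArr])
  | loop_done => exact .refl ..
  | loop_step _ _ _ ihp ihl =>
    exact (ihp.mono (by simp [Prog.keepsReg]) (by simp [Prog.keepsArr])).trans ihl

/-- Started in state `s`, program `p` stores only numbers less than `W`, and halts after at most
`K` operations in a state that satisfies `Q`. -/
def Runs (W : ℕ) (p : Prog) (s : State) (K : ℕ) (Q : State → Prop) : Prop :=
  ∃ c s', BExec W p s c s' ∧ c ≤ K ∧ Q s'

theorem Runs.mono {W : ℕ} {p : Prog} {s : State} {K K' : ℕ} {Q Q' : State → Prop}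
    (h : Runs W p s K Q) (hK : K ≤ K') (hQ : ∀ s', Agree p s s' → Q s' → Q' s') :
    Runs W p s K' Q' := by
  obtain ⟨c, s', he, hc, hq⟩ := h
  exact ⟨c, s', he, hc.trans hK, hQ s' he.agree hq⟩

theorem Runs.seq {W : ℕ} {p q : Prog} {s : State} {K : ℕ} {Q : State → Prop}
    (Q₁ : State → Prop) (K₁ K₂ : ℕ) (hK : K₁ + K₂ ≤ K) (h : Runs W p s K₁ Q₁)
    (h' : ∀ s', Agree p s s' → Q₁ s' → Runs W q s' K₂ Q) : Runs W (.seq p q) s K Q := by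
  obtain ⟨c, s', he, hc, hq⟩ := h
  obtain ⟨c', s'', he', hc', hq'⟩ := h' s' he.agree hq
  exact ⟨c + c', s'', .seq he he', by omega, hq'⟩

/-- The weakest precondition of a program without loops. -/
def Prog.wp (W : ℕ) : Prog → (State → Prop) → State → Prop
  | .skip, Q, s => Q s
  | .setReg x e, Q, s => e.val s < W ∧ Q (s.setReg x (e.val s))
  | .setArr a i e, Q, s => e.val s < W ∧ Q (s.setArr a (i.val s) (e.val s))
  | .seq p q, Q, s => p.wp W (q.wp W Q) s
  | .ite e p q, Q, s => (e.val s ≠ 0 → p.wp W Q s) ∧ (e.val s = 0 → q.wp W Q s)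
  | .loop _ _, _, _ => False

/-- A bound on the number of operations of a program without loops. -/
def Prog.cost : Prog → ℕ
  | .skip => 0
  | .setReg _ e => e.cost + 1
  | .setArr _ i e => i.cost + e.cost + 1
  | .seq p q => p.cost + q.cost
  | .ite e p q => e.cost + 1 + max p.cost q.cost
  | .loop _ _ => 0

/-- The value `0` of `Prog.cost` at a loop is harmless, because the weakest precondition of a loop
is `False`. -/
theorem Runs.of_wp {W : ℕ} {p : Prog} {s : State} {Q : State → Prop} (h : p.wp W Q s) :
    Runs W p s p.cost Q := by
  induction p generalizing s Q with
  | skip => exact ⟨0, s, .skip s, le_rfl, h⟩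
  | setReg x e => exact ⟨_, _, .setReg s x e h.1, le_rfl, h.2⟩
  | setArr a i e => exact ⟨_, _, .setArr s a i e h.1, le_rfl, h.2⟩
  | seq p q ihp ihq => exact .seq _ _ _ le_rfl (ihp h) fun s' _ hs' => ihq hs'
  | ite e p q ihp ihq =>
    by_cases hv : e.val s = 0
    · obtain ⟨c, s', he, hc, hq⟩ := ihq (h.2 hv)
      exact ⟨_, s', .ite_false hv he, by simp only [Prog.cost]; omega, hq⟩
    · obtain ⟨c, s', he, hc, hq⟩ := ihp (h.1 hv)
      exact ⟨_, s', .ite_true hv he, by simp only [Prog.cost]; omega, hq⟩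
  | loop e p => exact h.elim

theorem Runs.of_wp_le {W : ℕ} {p : Prog} {s : State} {K : ℕ} {Q : State → Prop}
    (hK : Nat.ble p.cost K = true) (h : p.wp W Q s) : Runs W p s K Q :=
  (Runs.of_wp h).mono (Nat.le_of_ble_eq_true hK) fun _ _ h => h

theorem Runs.wp_seq {W : ℕ} {p q : Prog} {s : State} {K : ℕ} {Q : State → Prop} (n K₂ : ℕ)
    (hn : Nat.ble p.cost n = true) (hK : n + K₂ ≤ K) (h : p.wp W (fun s' => Runs W q s' K₂ Q) s) :
    Runs W (.seq p q) s K Q :=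
  .seq _ _ _ (by have := Nat.le_of_ble_eq_true hn; omega) (Runs.of_wp h) fun _ _ h => h

/-- Run `p` with register `i` counting from `0` up to (but not including) the content of
register `x`. -/
def Prog.forTo (i x : ℕ) (p : Prog) : Prog :=
  .seq (.setReg i (.const 0))
    (.loop (.op .lt (.reg i) (.reg x)) (.seq p (.setReg i (.op .add (.reg i) (.const 1)))))

/-- The rule for counting loops. The invariant may refer to the cost so far. -/
theorem Runs.forTo_acc {W : ℕ} {i x : ℕ} {p : Prog} {s : State} {m K : ℕ} {Q : State → Prop}
    (I : ℕ → ℕ → State → Prop) (hm : s.reg x = m) (hmW : m < W)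
    (hk : (p.keepsReg i && p.keepsReg x) = true)
    (hxi : Nat.beq x i = false) (h0 : I 0 0 (s.setReg i 0))
    (hstep : ∀ j < m, ∀ c s₁, Agree (p.forTo i x) s s₁ → s₁.reg i = j → I j c s₁ →
      ∃ B, Runs W p s₁ B fun s₂ => I (j + 1) (c + (B + 8)) (s₂.setReg i (j + 1)))
    (hQ : ∀ c s', Agree (p.forTo i x) s s' → I m c s' → c + 6 ≤ K ∧ Q s') :
    Runs W (p.forTo i x) s K Q := by
  -- The 6 consists of 2 for setting the counter to zero and 4 for the last test, which fails. Each
  -- iteration adds 8 to its body: 4 for the test and 4 for the increment.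
  suffices h : ∃ c₀, Runs W (p.forTo i x) s (c₀ + 6) (I m c₀) by
    obtain ⟨c₀, c, s', he, hc, hI⟩ := h
    obtain ⟨h1, h2⟩ := hQ c₀ s' he.agree hI
    exact ⟨c, s', he, hc.trans h1, h2⟩
  simp only [Bool.and_eq_true] at hk
  -- Induction on the number `r` of iterations that remain; `c` is the cost of the earlier ones.
  have key : ∀ r j c s₁, j + r = m → Agree (p.forTo i x) s s₁ → s₁.reg i = j → I j c s₁ →
      ∃ c₀, Runs W (.loop (.op .lt (.reg i) (.reg x))
        (.seq p (.setReg i (.op .add (.reg i) (.const 1))))) s₁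
        (c₀ + 4) (I m (c + c₀)) := by
    intro r
    induction r with
    | zero =>
      intro j c s₁ hj ha hi hI
      have hx : s₁.reg x = m := by
        rw [← hm]; exact ha.reg x (by simp [Prog.forTo, Prog.keepsReg, hk.2, hxi])
      refine ⟨0, _, s₁, .loop_done (by simp [Expr.val, Op.eval, hi, hx]; omega), ?_, ?_⟩
      · simp [Expr.cost]
      · rwa [show m = j by omega]
    | succ r ih =>
      intro j c s₁ hj ha hi hI
      have hx : s₁.reg x = m := by
        rw [← hm]; exact ha.reg x (by simp [Prog.forTo, Prog.keepsReg, hk.2, hxi])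
      obtain ⟨B, c₁, s₂, he, hc, hI₂⟩ := hstep j (by omega) c s₁ ha hi hI
      have ha₂ : Agree (p.forTo i x) s₁ s₂ :=
        he.agree.mono (by simp +contextual [Prog.forTo, Prog.keepsReg])
          (by simp +contextual [Prog.forTo, Prog.keepsArr])
      have hi₂ : s₂.reg i = j := by rw [← hi]; exact he.agree.reg i hk.1
      have hinc := BExec.setReg (W := W) s₂ i (.op .add (.reg i) (.const 1))
        (by simp only [Expr.val, Op.eval, hi₂]; omega)
      have hv : Expr.val s₂ (.op .add (.reg i) (.const 1)) = j + 1 := by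
        simp [Expr.val, Op.eval, hi₂]
      rw [hv] at hinc
      obtain ⟨c₀, c', s₃, he', hc', hI₃⟩ := ih (j + 1) _ (s₂.setReg i (j + 1)) (by omega)
        ((ha.trans ha₂).trans (hinc.agree.mono
          (by simp +contextual [Prog.forTo, Prog.keepsReg])
          (by simp +contextual [Prog.forTo, Prog.keepsArr]))) (by simp [State.setReg]) hI₂
      refine ⟨B + 8 + c₀, _, s₃, .loop_step (by simp [Expr.val, Op.eval, hi, hx]; omega)
        (.seq he hinc) he', ?_, by rwa [← add_assoc]⟩
      simp only [Expr.cost]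
      omega
  have hinit := BExec.setReg (W := W) s i (.const 0) (by simp only [Expr.val]; omega)
  obtain ⟨c₀, c, s', he, hc, hI⟩ := key m 0 0 (s.setReg i 0) (by omega)
    (hinit.agree.seq_left) (by simp [State.setReg]) h0
  refine ⟨c₀, _, s', .seq hinit he, ?_, by rwa [zero_add] at hI⟩
  simp only [Expr.cost]
  omega

/-- For loops in which the cost of an iteration depends on the counter, such as the loop over
adjacency lists of different lengths. -/
theorem Runs.forTo_sum {W : ℕ} {i x : ℕ} {p : Prog} {s : State} {m K : ℕ} {Q : State → Prop}
    (I : ℕ → State → Prop)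
    (B : ℕ → ℕ) (hm : s.reg x = m) (hmW : m < W) (hk : (p.keepsReg i && p.keepsReg x) = true)
    (hxi : Nat.beq x i = false) (h0 : I 0 (s.setReg i 0))
    (hstep : ∀ j < m, ∀ s₁, Agree (p.forTo i x) s s₁ → s₁.reg i = j → I j s₁ →
      Runs W p s₁ (B j) fun s₂ => I (j + 1) (s₂.setReg i (j + 1)))
    (hK : ∑ j ∈ Finset.range m, (B j + 8) + 6 ≤ K)
    (hQ : ∀ s', Agree (p.forTo i x) s s' → I m s' → Q s') : Runs W (p.forTo i x) s K Q := by
  refine .forTo_acc (fun j c s' => I j s' ∧ c = ∑ l ∈ Finset.range j, (B l + 8)) hm hmW hk hxi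
    ⟨h0, rfl⟩ (fun j hj c s₁ hA hi ⟨hI, hc⟩ => ⟨B j, ?_⟩) fun c s' hA ⟨hI, hc⟩ =>
      ⟨hc ▸ hK, hQ s' hA hI⟩
  exact (hstep j hj s₁ hA hi hI).mono le_rfl fun s₂ _ h =>
    ⟨h, by rw [Finset.sum_range_succ, hc]⟩

theorem Runs.forTo {W : ℕ} {i x : ℕ} {p : Prog} {s : State} {m K : ℕ} {Q : State → Prop}
    (I : ℕ → State → Prop) (B : ℕ) (hm : s.reg x = m) (hmW : m < W)
    (hk : (p.keepsReg i && p.keepsReg x) = true) (hxi : Nat.beq x i = false)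
    (h0 : I 0 (s.setReg i 0))
    (hstep : ∀ j < m, ∀ s₁, Agree (p.forTo i x) s s₁ → s₁.reg i = j → I j s₁ →
      Runs W p s₁ B fun s₂ => I (j + 1) (s₂.setReg i (j + 1)))
    (hK : m * (B + 8) + 6 ≤ K)
    (hQ : ∀ s', Agree (p.forTo i x) s s' → I m s' → Q s') : Runs W (p.forTo i x) s K Q :=
  .forTo_sum I (fun _ => B) hm hmW hk hxi h0 hstep (by simpa using hK) hQ

end RAM

/-! ### Notation for expressions and programs -/

namespace RAM

instance : Add Expr := ⟨.op .add⟩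
instance : Sub Expr := ⟨.op .sub⟩
instance : Mul Expr := ⟨.op .mul⟩
instance : Div Expr := ⟨.op .div⟩
instance : Mod Expr := ⟨.op .mod⟩
instance (k : ℕ) : OfNat Expr k := ⟨.const k⟩

@[simp] theorem Op.eval_lt (x y : ℕ) : Op.lt.eval x y = if x < y then 1 else 0 := rfl
@[simp] theorem Op.eval_eq (x y : ℕ) : Op.eq.eval x y = if x = y then 1 else 0 := rfl

attribute [simp] Prog.wp State.setReg_reg State.setArr_arr

infixr:30 " ;; " => Prog.seq
infix:40 " ≔ " => Prog.setReg
infix:50 " ≺ " => Expr.op Op.lt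
infix:50 " ≐ " => Expr.op Op.eq
notation:max a "⟦" e "⟧" => Expr.get a e

open RAM.Expr (reg)

@[simp] theorem Expr.val_reg (s : State) (x : ℕ) : (reg x).val s = s.reg x := rfl
@[simp] theorem Expr.val_ofNat (s : State) (k : ℕ) : (no_index (OfNat.ofNat k) : Expr).val s = k := rfl
@[simp] theorem Expr.val_get (s : State) (a : ℕ) (e : Expr) : (a⟦e⟧).val s = s.arr a (e.val s) := rfl
@[simp] theorem Expr.val_add (s : State) (e e' : Expr) : (e + e').val s = e.val s + e'.val s := rfl
@[simp] theorem Expr.val_sub (s : State) (e e' : Expr) : (e - e').val s = e.val s - e'.val s := rfl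
@[simp] theorem Expr.val_mul (s : State) (e e' : Expr) : (e * e').val s = e.val s * e'.val s := rfl
@[simp] theorem Expr.val_div (s : State) (e e' : Expr) : (e / e').val s = e.val s / e'.val s := rfl
@[simp] theorem Expr.val_mod (s : State) (e e' : Expr) : (e % e').val s = e.val s % e'.val s := rfl
@[simp] theorem Expr.val_op (s : State) (o : Op) (e e' : Expr) :
    (Expr.op o e e').val s = o.eval (e.val s) (e'.val s) := rfl

end RAM

/-! ### The registers and the arrays of the program -/

notation "rn" => (0 : ℕ)
notation "rN" => (1 : ℕ)
notation "rK" => (2 : ℕ)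
notation "rS" => (3 : ℕ)
notation "rInf" => (4 : ℕ)
notation "rNp" => (5 : ℕ)
notation "rTail" => (6 : ℕ)
notation "rH" => (7 : ℕ)
notation "rI" => (8 : ℕ)
notation "rP" => (9 : ℕ)
notation "rKi" => (10 : ℕ)
notation "rKp" => (11 : ℕ)
notation "rBi" => (12 : ℕ)
notation "rBp" => (13 : ℕ)
notation "rLi" => (14 : ℕ)
notation "rLp" => (15 : ℕ)
notation "rQ" => (16 : ℕ)
notation "rT" => (17 : ℕ)
notation "rE" => (18 : ℕ)
notation "rC" => (19 : ℕ)
notation "rV" => (20 : ℕ)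
notation "rU" => (21 : ℕ)
notation "rD" => (22 : ℕ)
notation "rBad" => (23 : ℕ)
notation "rRes" => (24 : ℕ)
notation "rVal" => (25 : ℕ)
notation "rXi1" => (26 : ℕ)
notation "rXi2" => (27 : ℕ)
notation "rJ" => (28 : ℕ)
notation "rKap" => (29 : ℕ)
notation "rL2" => (30 : ℕ)
notation "rX" => (31 : ℕ)
notation "rF" => (32 : ℕ)

notation "aPow" => (6 : ℕ)
notation "aQueue" => (7 : ℕ)
notation "aPar" => (8 : ℕ)
notation "aVis" => (9 : ℕ)
notation "aTab" => (10 : ℕ)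
notation "aPos" => (11 : ℕ)
notation "aAdj" => (12 : ℕ)
notation "aDig" => (13 : ℕ)
notation "aPre" => (14 : ℕ)
notation "aMsg" => (15 : ℕ)
notation "aAcc" => (16 : ℕ)
notation "aF" => (17 : ℕ)
notation "aG" => (18 : ℕ)
notation "aH" => (19 : ℕ)

/-! ### In-place transforms along ternary digits -/

/-- The digit of `c` in base `3` at position `q`. -/
def digit (c q : ℕ) : ℕ := c / 3 ^ q % 3

theorem digit_lt (c q : ℕ) : digit c q < 3 := Nat.mod_lt _ (by norm_num)

/-- One coordinate of an in-place transform: at the arguments with digit `1` at position `j`,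
the value is combined with the value at the argument with digit `0` instead. -/
def transformStep (o : RAM.Op) (j : ℕ) (f : ℕ → ℕ) (x : ℕ) : ℕ :=
  if digit x j = 1 then o.eval (f x) (f (x - 3 ^ j)) else f x

/-- The in-place transform along the first `j` coordinates. -/
def transform (o : RAM.Op) (f : ℕ → ℕ) : ℕ → ℕ → ℕ
  | 0 => f
  | j + 1 => transformStep o j (transform o f j)

theorem le_of_digit_ne_zero {x j : ℕ} (h : digit x j ≠ 0) : 3 ^ j ≤ x := by
  by_contra hlt
  exact h (by simp [digit, Nat.div_eq_of_lt (not_le.mp hlt)])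

theorem digit_sub_self {x j : ℕ} (h : digit x j = 1) : digit (x - 3 ^ j) j = 0 := by
  have hle := le_of_digit_ne_zero (x := x) (j := j) (by omega)
  obtain ⟨y, rfl⟩ := Nat.exists_eq_add_of_le hle
  have : digit (3 ^ j + y) j = (1 + y / 3 ^ j) % 3 := by
    rw [digit, Nat.add_div_of_dvd_right (dvd_refl _), Nat.div_self (by positivity)]
  rw [this] at h
  simp only [digit, Nat.add_sub_cancel_left]
  omega

namespace RAM
open RAM.Expr (reg)

/-- Transform array `a` in place. -/
def transformProg (a : ℕ) (o : Op) : Prog :=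
  .forTo rJ rKp (rT ≔ aPow⟦reg rJ⟧ ;;
    .forTo rX rL2 (.ite ((reg rX / reg rT) % 3 ≐ 1)
      (.setArr a (reg rX) (.op o a⟦reg rX⟧ a⟦reg rX - reg rT⟧)) .skip))

/-- Working in place is sound when arguments are visited in increasing order: the argument `x - 3 ^
j` has been visited before `x`, but its digit at `j` is 0, so this pass has left its value
unchanged. -/
theorem runs_transformProg {W : ℕ} {s : State} {a : ℕ} {o : Op} {k L : ℕ} {f : ℕ → ℕ}
    (ha : Nat.beq aPow a = false)
    (hk : s.reg rKp = k) (hL : s.reg rL2 = L) (hkW : k < W) (hLW : L < W)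
    (hpow : ∀ j < k, s.arr aPow j = 3 ^ j) (hpowW : 3 ^ k < W) (hf : ∀ x < L, s.arr a x = f x)
    (hfW : ∀ j ≤ k, ∀ x < L, transform o f j x < W) :
    Runs W (transformProg a o) s (k * (L * 30 + 20) + 6)
      fun s' => ∀ x < L, s'.arr a x = transform o f k x := by
  refine .forTo (fun j s' => ∀ x < L, s'.arr a x = transform o f j x) (L * 28 + 9) hk hkW
    rfl rfl hf ?_ (Nat.add_le_add_right (Nat.mul_le_mul_left _ (by omega)) _) fun _ _ h => h
  intro j hj s₁ hA hi hI
  have h1 : s₁.arr aPow j = 3 ^ j := by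
    rw [hA.arr _ (by simpa [Prog.keepsArr, Prog.forTo] using ha), hpow j hj]
  have h2 : s₁.reg rL2 = L := by rw [hA.reg _ rfl, hL]
  refine .wp_seq 3 (L * 28 + 6) rfl (by omega) ?_
  simp only [Prog.wp, Expr.val_get, Expr.val_reg, hi, h1]
  refine ⟨lt_of_le_of_lt (Nat.pow_le_pow_right (by norm_num) hj.le) hpowW, ?_⟩
  refine .forTo (m := L) (fun x₀ s' => (∀ x < x₀, s'.arr a x = transform o f (j + 1) x) ∧
    ∀ x < L, x₀ ≤ x → s'.arr a x = transform o f j x) 20 (by simp [h2]) hLW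
    rfl rfl ⟨by simp, fun x hx _ => hI x hx⟩ ?_ le_rfl fun _ _ h => h.1
  intro x hx s₂ hA₂ hi₂ hI₂
  have h3 : s₂.reg rT = 3 ^ j := by rw [hA₂.reg _ rfl]; simp
  refine .of_wp_le rfl ?_
  have e1 : s₂.arr a x = transform o f j x := hI₂.2 x hx le_rfl
  have hstep : transform o f (j + 1) x = transformStep o j (transform o f j) x := rfl
  have hlt := hfW (j + 1) (by omega) x hx
  have hold : digit x j = 1 → s₂.arr a (x - 3 ^ j) = transform o f j (x - 3 ^ j) := by
    intro h
    have := le_of_digit_ne_zero (x := x) (j := j) (by omega)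
    have hp : 0 < 3 ^ j := by positivity
    rw [hI₂.1 _ (by omega), transform, transformStep, if_neg (by simp [digit_sub_self h])]
  have hx3 : x / 3 ^ j % 3 = digit x j := rfl
  have hnext (v : ℕ) (hv : v = transform o f (j + 1) x) :
      (∀ y < x + 1, Function.update (s₂.arr a) x v y = transform o f (j + 1) y) ∧
        ∀ y < L, x + 1 ≤ y → Function.update (s₂.arr a) x v y = transform o f j y := by
    refine ⟨fun y hy => ?_, fun y hy hy' => ?_⟩
    · rcases Nat.lt_succ_iff_lt_or_eq.mp hy with h | rfl
      · rw [Function.update_of_ne h.ne, hI₂.1 y h]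
      · simp [hv]
    · rw [Function.update_of_ne (by omega), hI₂.2 y hy (by omega)]
  simp only [Prog.wp, Op.eval_eq, Expr.val_mod, Expr.val_div, Expr.val_reg, Expr.val_ofNat,
    hi₂, h3, hx3, Expr.val_op, Expr.val_get, Expr.val_sub, ne_eq, ite_eq_right_iff, one_ne_zero,
    imp_false, not_not]
  refine ⟨fun h => ?_, fun h => ?_⟩
  · have hv : o.eval (s₂.arr a x) (s₂.arr a (x - 3 ^ j)) = transform o f (j + 1) x := by
      rw [hstep, transformStep, if_pos h, e1, hold h]
    exact ⟨hv ▸ hlt, by simpa using hnext _ hv⟩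
  · have := hnext _ (show s₂.arr a x = _ by rw [hstep, transformStep, if_neg h, e1])
    simpa using this

end RAM

/-! ### Ternary digits -/

theorem digit_eq_mod_div (x q : ℕ) : digit x q = x % 3 ^ (q + 1) / 3 ^ q := by
  rw [digit, pow_succ, Nat.mod_mul_right_div_self]

theorem digit_congr {x y q : ℕ} (h : x ≡ y [MOD 3 ^ (q + 1)]) : digit x q = digit y q := by
  rw [digit_eq_mod_div, digit_eq_mod_div, h]

theorem digit_mul_add {k q : ℕ} (hq : q < k) (a d : ℕ) : digit (a * 3 ^ k + d) q = digit d q := by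
  refine digit_congr ?_
  have : 3 ^ (q + 1) ∣ a * 3 ^ k := Dvd.dvd.mul_left (pow_dvd_pow 3 hq) a
  simpa using (Nat.modEq_zero_iff_dvd.mpr this).add_right d

theorem digit_mod {k q : ℕ} (hq : q < k) (x : ℕ) : digit (x % 3 ^ k) q = digit x q := by
  conv_rhs => rw [← Nat.div_add_mod' x (3 ^ k), digit_mul_add hq]

/-- Subtracting `3 ^ j` from a number whose digit at `j` is 1 causes no borrow. -/
theorem sub_div_of_digit {x j m : ℕ} (h : digit x j = 1) (hm : j < m) :
    (x - 3 ^ j) / 3 ^ m = x / 3 ^ m := by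
  have key : (x - 3 ^ j) / 3 ^ (j + 1) = x / 3 ^ (j + 1) := by
    rw [pow_succ, ← Nat.div_div_eq_div_mul, ← Nat.div_div_eq_div_mul]
    have hle := le_of_digit_ne_zero (x := x) (j := j) (by omega)
    obtain ⟨y, rfl⟩ := Nat.exists_eq_add_of_le hle
    have : (3 ^ j + y) / 3 ^ j = 1 + y / 3 ^ j := by
      rw [Nat.add_div_of_dvd_right (dvd_refl _), Nat.div_self (by positivity)]
    rw [digit, this] at h
    rw [this, Nat.add_sub_cancel_left]
    omega
  obtain ⟨r, rfl⟩ := Nat.exists_eq_add_of_le (Nat.succ_le_of_lt hm)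
  rw [Nat.succ_eq_add_one, pow_add, ← Nat.div_div_eq_div_mul, ← Nat.div_div_eq_div_mul, key]

theorem digit_sub_of_ne {x j q : ℕ} (h : digit x j = 1) (hq : q ≠ j) :
    digit (x - 3 ^ j) q = digit x q := by
  rcases Nat.lt_or_gt_of_ne hq with hlt | hgt
  · have hle := le_of_digit_ne_zero (x := x) (j := j) (by omega)
    obtain ⟨y, rfl⟩ := Nat.exists_eq_add_of_le hle
    rw [Nat.add_sub_cancel_left]
    refine digit_congr (Nat.ModEq.symm ?_)
    simpa using (Nat.modEq_zero_iff_dvd.mpr (pow_dvd_pow 3 (Nat.succ_le_of_lt hlt))).add_right y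
  · rw [digit, digit, sub_div_of_digit h hgt]

theorem eq_of_digit_eq {k c d : ℕ} (hc : c < 3 ^ k) (hd : d < 3 ^ k)
    (h : ∀ q < k, digit c q = digit d q) : c = d := by
  induction k generalizing c d with
  | zero => simp at hc hd; omega
  | succ k ih =>
    have h0 : c % 3 = d % 3 := by simpa [digit] using h 0 (by omega)
    have hdiv (x q : ℕ) : digit (x / 3) q = digit x (q + 1) := by
      rw [digit, digit, Nat.div_div_eq_div_mul, pow_succ']
    have := ih (c := c / 3) (d := d / 3) (by rw [pow_succ] at hc; omega)
      (by rw [pow_succ] at hd; omega) fun q hq => by rw [hdiv, hdiv, h _ (by omega)]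
    omega

/-- The number whose digit at position `q < k` is `d q`. -/
def encode (d : ℕ → ℕ) : ℕ → ℕ
  | 0 => 0
  | k + 1 => encode d k + d k * 3 ^ k

theorem encode_lt {d : ℕ → ℕ} {k : ℕ} (hd : ∀ q < k, d q < 3) : encode d k < 3 ^ k := by
  induction k with
  | zero => simp [encode]
  | succ k ih =>
    have := ih fun q hq => hd q (by omega)
    have h2 : d k * 3 ^ k ≤ 2 * 3 ^ k := Nat.mul_le_mul_right _ (by have := hd k (by omega); omega)
    rw [encode, pow_succ]
    omega

theorem digit_encode {d : ℕ → ℕ} {k q : ℕ} (hd : ∀ q < k, d q < 3) (hq : q < k) :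
    digit (encode d k) q = d q := by
  induction k with
  | zero => omega
  | succ k ih =>
    have hd' : ∀ q < k, d q < 3 := fun q hq => hd q (by omega)
    rw [encode, add_comm]
    rcases Nat.lt_succ_iff_lt_or_eq.mp hq with h | rfl
    · rw [digit_mul_add h, ih hd' h]
    · rw [digit, Nat.add_div_of_dvd_right (dvd_mul_left _ _),
        Nat.mul_div_cancel _ (by positivity), Nat.div_eq_of_lt (encode_lt hd'), add_zero,
        Nat.mod_eq_of_lt (hd q hq)]

theorem encode_congr {d d' : ℕ → ℕ} {k : ℕ} (h : ∀ q < k, d q = d' q) :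
    encode d k = encode d' k := by
  induction k with
  | zero => rfl
  | succ k ih => rw [encode, encode, ih fun q hq => h q (by omega), h k (by omega)]

/-! ### Minimum of a table -/

/-- The minimum of `b` and of the first values of `f`. -/
def tableMin (b : ℕ) (f : ℕ → ℕ) : ℕ → ℕ
  | 0 => b
  | L + 1 => min (tableMin b f L) (f L)

theorem tableMin_le (b : ℕ) (f : ℕ → ℕ) (L : ℕ) : tableMin b f L ≤ b := by
  induction L with
  | zero => exact le_rfl
  | succ L ih => exact (min_le_left _ _).trans ih

theorem tableMin_le_apply (b : ℕ) (f : ℕ → ℕ) {L c : ℕ} (hc : c < L) : tableMin b f L ≤ f c := by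
  induction L with
  | zero => omega
  | succ L ih =>
    rcases Nat.lt_succ_iff_lt_or_eq.mp hc with h | rfl
    · exact (min_le_left _ _).trans (ih h)
    · exact min_le_right _ _

theorem tableMin_eq (b : ℕ) (f : ℕ → ℕ) (L : ℕ) :
    tableMin b f L = b ∨ ∃ c < L, tableMin b f L = f c := by
  induction L with
  | zero => exact .inl rfl
  | succ L ih =>
    rcases min_choice (tableMin b f L) (f L) with h | h
    · rw [tableMin, h]
      exact ih.imp_right fun ⟨c, hc, h⟩ => ⟨c, by omega, h⟩
    · exact .inr ⟨L, by omega, h⟩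

/-! ### The join of two tables -/

/-- The value of digit `a` is counted at digit `d` after summation. -/
def SubDigit (a d : ℕ) : Prop := a = d ∨ a = 0 ∧ d = 1

/-- Digit `d` is the join of the digits `a` and `b`. -/
def JoinDigit (a b d : ℕ) : Prop := SubDigit a d ∧ SubDigit b d ∧ (d = 1 → a = 1 ∨ b = 1)

instance (a d : ℕ) : Decidable (SubDigit a d) := inferInstanceAs (Decidable (_ ∨ _))

instance (a b d : ℕ) : Decidable (JoinDigit a b d) := inferInstanceAs (Decidable (_ ∧ _))

/-- The identity behind the inversion. Digits that count towards 1 are 0 and 1; a pair of them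
either contains a 1, and then joins to 1, or is `(0, 0)`, and then it is already counted at digit 0.
-/
theorem subDigit_one_iff (a b : ℕ) : SubDigit a 1 ∧ SubDigit b 1 ↔
    JoinDigit a b 1 ∨ SubDigit a 0 ∧ SubDigit b 0 := by
  simp only [JoinDigit, SubDigit, forall_const, and_true, zero_ne_one, and_false, or_false]
  omega

/-- Digitwise join. -/
def Joins (k c₁ c₂ d : ℕ) : Prop := ∀ q < k, JoinDigit (digit c₁ q) (digit c₂ q) (digit d q)

/-- The indicator function of the graph of a table, with values counted from `xi`. -/
def indicatorTable (k inf xi : ℕ) (A : ℕ → ℕ) (x : ℕ) : ℕ :=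
  if A (x % 3 ^ k) = xi + x / 3 ^ k ∧ A (x % 3 ^ k) < inf then 1 else 0

/-- The convolution in the first coordinate. -/
def convolve (k : ℕ) (f g : ℕ → ℕ) (x : ℕ) : ℕ :=
  ∑ v ∈ Finset.range (x / 3 ^ k + 1),
    f (v * 3 ^ k + x % 3 ^ k) * g ((x / 3 ^ k - v) * 3 ^ k + x % 3 ^ k)

/-- The number of pairs of entries whose join is `x % 3 ^ k` and whose sum is determined by
`x / 3 ^ k`. -/
def joinCount (k inf : ℕ) (A B : ℕ → ℕ) : ℕ → ℕ :=
  transform .sub (convolve k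
    (transform .add (indicatorTable k inf (tableMin inf A (3 ^ k)) A) k)
    (transform .add (indicatorTable k inf (tableMin inf B (3 ^ k)) B) k)) k

/-- The join of two tables. -/
def joinTable (k inf : ℕ) (A B : ℕ → ℕ) (d : ℕ) : ℕ :=
  tableMin inf (fun v => if joinCount k inf A B (v * 3 ^ k + d) = 0 then inf else
    tableMin inf A (3 ^ k) + tableMin inf B (3 ^ k) + v) (2 * k + 1)

/-- Together with `mixed_succ_iff` this isolates coordinate `j`, the only one whose condition
changes when one more coordinate is transformed. -/
theorem mixed_iff {k j : ℕ} (hj : j < k) (P Q : ℕ → Prop) :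
    (∀ q < k, if q < j then P q else Q q) ↔
      Q j ∧ ∀ q < k, q ≠ j → if q < j then P q else Q q := by
  refine ⟨fun h => ⟨by simpa using h j hj, fun q hq _ => h q hq⟩, fun ⟨h, h'⟩ q hq => ?_⟩
  by_cases e : q = j
  · subst e; simpa using h
  · exact h' q hq e

theorem mixed_succ_iff {k j : ℕ} (hj : j < k) (P Q : ℕ → Prop) :
    (∀ q < k, if q < j + 1 then P q else Q q) ↔
      P j ∧ ∀ q < k, q ≠ j → if q < j then P q else Q q := by
  have hiff (q : ℕ) (h : q ≠ j) : q < j + 1 ↔ q < j := by omega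
  refine ⟨fun h => ⟨by simpa using h j hj, fun q hq e => by simpa only [hiff q e] using h q hq⟩,
    fun ⟨h, h'⟩ q hq => ?_⟩
  by_cases e : q = j
  · subst e; simpa using h
  · simpa only [hiff q e] using h' q hq e

theorem and_and_iff_or {a p q r e : Prop} (h : q ↔ p ∨ r) :
    a ∧ q ∧ e ↔ a ∧ p ∧ e ∨ a ∧ r ∧ e := by
  rw [h]; tauto

theorem card_filter_split {α : Type*} (S : Finset α) (p q r : α → Prop) [DecidablePred p]
    [DecidablePred q] [DecidablePred r] (h : ∀ c ∈ S, p c ↔ q c ∨ r c)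
    (hd : ∀ c ∈ S, q c → ¬ r c) :
    (S.filter p).card = (S.filter q).card + (S.filter r).card := by
  classical
  rw [Finset.filter_congr h, Finset.filter_or, Finset.card_union_of_disjoint]
  exact Finset.disjoint_filter.mpr hd

section

variable (k inf xi xi' : ℕ) (A B : ℕ → ℕ)

/-- The value that summation over the first `j` coordinates yields. -/
def sumCount (j x : ℕ) : ℕ :=
  ((Finset.range (3 ^ k)).filter fun c => (A c = xi + x / 3 ^ k ∧ A c < inf) ∧
    ∀ q < k, if q < j then SubDigit (digit c q) (digit x q) else digit c q = digit x q).card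

/-- The number of pairs that are counted after differences have been taken along the first `j`
coordinates. -/
def pairCount (j x : ℕ) : ℕ :=
  ((Finset.range (3 ^ k) ×ˢ Finset.range (3 ^ k)).filter fun c =>
    ((∃ v ≤ x / 3 ^ k, A c.1 = xi + v ∧ B c.2 = xi' + (x / 3 ^ k - v)) ∧
      A c.1 < inf ∧ B c.2 < inf) ∧
    ∀ q < k, if q < j then JoinDigit (digit c.1 q) (digit c.2 q) (digit x q)
      else SubDigit (digit c.1 q) (digit x q) ∧ SubDigit (digit c.2 q) (digit x q)).card

theorem sumCount_le (j x : ℕ) : sumCount k inf xi A j x ≤ 3 ^ k :=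
  (Finset.card_filter_le _ _).trans (by simp)

theorem pairCount_le (j x : ℕ) : pairCount k inf xi xi' A B j x ≤ 9 ^ k :=
  (Finset.card_filter_le _ _).trans (by
    rw [Finset.card_product, Finset.card_range, ← mul_pow]; norm_num)

/-- Induction on the number of transformed coordinates. At an argument with digit 1 at `j`, the
colourings counted afterwards have digit 1 or 0 there; the former were counted at `x`, the latter at
`x - 3 ^ j`. -/
theorem transform_add_indicatorTable {j : ℕ} (hj : j ≤ k) (x : ℕ) :
    transform .add (indicatorTable k inf xi A) j x = sumCount k inf xi A j x := by
  classical
  induction j generalizing x with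
  | zero =>
    have hx : x % 3 ^ k < 3 ^ k := Nat.mod_lt _ (by positivity)
    have hiff : ∀ c ∈ Finset.range (3 ^ k),
        (((A c = xi + x / 3 ^ k ∧ A c < inf) ∧
          ∀ q < k, if q < 0 then SubDigit (digit c q) (digit x q) else digit c q = digit x q) ↔
        c = x % 3 ^ k ∧ (A (x % 3 ^ k) = xi + x / 3 ^ k ∧ A (x % 3 ^ k) < inf)) := by
      intro c hc
      simp only [Nat.not_lt_zero, if_false]
      constructor
      · rintro ⟨h, hq⟩
        have : c = x % 3 ^ k := eq_of_digit_eq (Finset.mem_range.mp hc) hx fun q hq' => by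
          rw [hq q hq', digit_mod hq']
        exact ⟨this, this ▸ h⟩
      · rintro ⟨rfl, h⟩
        exact ⟨h, fun q hq => digit_mod hq x⟩
    rw [transform, indicatorTable, sumCount, Finset.filter_congr hiff]
    split
    next h =>
      rw [show Finset.filter _ _ = {x % 3 ^ k} from ?_, Finset.card_singleton]
      ext c
      simp only [Finset.mem_filter, Finset.mem_range, Finset.mem_singleton]
      exact ⟨fun h => h.2.1, fun e => ⟨e ▸ hx, e, h⟩⟩
    next h => simp [h]
  | succ j ih =>
    have ih := ih (by omega)
    have hj' : j < k := by omega
    rw [transform, transformStep]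
    split
    next h =>
      rw [ih, ih]
      refine (card_filter_split _ _ _ _ ?_ ?_).symm
      · intro c hc
        have hE : (∀ q < k, q ≠ j → if q < j then SubDigit (digit c q) (digit (x - 3 ^ j) q) else
            digit c q = digit (x - 3 ^ j) q) ↔ (∀ q < k, q ≠ j → if q < j then
              SubDigit (digit c q) (digit x q) else digit c q = digit x q) :=
          forall₃_congr fun q _ hqj => by rw [digit_sub_of_ne h hqj]
        rw [sub_div_of_digit h hj', mixed_iff hj' (fun q => SubDigit (digit c q) (digit x q)),
          mixed_iff hj' (fun q => SubDigit (digit c q) (digit (x - 3 ^ j) q)), hE,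
          mixed_succ_iff hj', digit_sub_self h, h, SubDigit]
        tauto
      · intro c hc h₁ h₂
        rw [mixed_iff hj' (fun q => SubDigit (digit c q) _)] at h₁ h₂
        have := h₁.2.1.symm.trans h₂.2.1
        rw [h, digit_sub_self h] at this
        omega
    next h =>
      rw [ih]
      refine congrArg Finset.card (Finset.filter_congr fun c hc => ?_)
      have : SubDigit (digit c j) (digit x j) ↔ digit c j = digit x j := by
        simp [SubDigit, h]
      rw [mixed_iff hj' (fun q => SubDigit (digit c q) (digit x q)), mixed_succ_iff hj', this]

/-- A pair of colourings occurs in exactly one summand, since `v` must be `A c₁ - xi`; this gives a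
bijection with the pairs on the right. -/
theorem convolve_sumCount (x : ℕ) :
    convolve k (sumCount k inf xi A k) (sumCount k inf xi' B k) x =
      pairCount k inf xi xi' A B 0 x := by
  classical
  have hm : x % 3 ^ k < 3 ^ k := Nat.mod_lt _ (by positivity)
  have hdiv (v : ℕ) : (v * 3 ^ k + x % 3 ^ k) / 3 ^ k = v := by
    rw [Nat.add_comm, Nat.add_mul_div_right _ _ (by positivity), Nat.div_eq_of_lt hm, zero_add]
  have hdig (v q : ℕ) (hq : q < k) : digit (v * 3 ^ k + x % 3 ^ k) q = digit x q := by
    rw [digit_mul_add hq, digit_mod hq]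
  simp only [convolve, sumCount, hdiv, ← Finset.card_product]
  rw [← Finset.card_sigma]
  refine Finset.card_bij' (fun c _ => c.2) (fun c _ => ⟨A c.1 - xi, c⟩) ?_ ?_ ?_ ?_
  · rintro ⟨v, c₁, c₂⟩ hc
    simp only [Finset.mem_sigma, Finset.mem_product, Finset.mem_filter, Finset.mem_range] at hc ⊢
    obtain ⟨hv, ⟨h₁, ⟨e₁, i₁⟩, d₁⟩, h₂, ⟨e₂, i₂⟩, d₂⟩ := hc
    refine ⟨⟨h₁, h₂⟩, ⟨⟨v, by omega, e₁, e₂⟩, i₁, i₂⟩, fun q hq => ?_⟩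
    have d₁ := d₁ q hq
    have d₂ := d₂ q hq
    rw [if_pos hq, hdig _ _ hq] at d₁ d₂
    simpa using ⟨d₁, d₂⟩
  · rintro ⟨c₁, c₂⟩ hc
    simp only [Finset.mem_sigma, Finset.mem_product, Finset.mem_filter, Finset.mem_range] at hc ⊢
    obtain ⟨⟨h₁, h₂⟩, ⟨⟨v, hv, e₁, e₂⟩, i₁, i₂⟩, d⟩ := hc
    have hv' : A c₁ - xi = v := by omega
    refine ⟨by omega, ⟨h₁, ⟨by omega, i₁⟩, fun q hq => ?_⟩, h₂, ⟨by omega, i₂⟩, fun q hq => ?_⟩ <;>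
      · have d := d q hq
        simp only [Nat.not_lt_zero, if_false] at d
        rw [if_pos hq, hdig _ _ hq]
        first | exact d.1 | exact d.2
  · rintro ⟨v, c₁, c₂⟩ hc
    simp only [Finset.mem_sigma, Finset.mem_product, Finset.mem_filter, Finset.mem_range] at hc ⊢
    simp [hc.2.1.2.1.1]
  · intros; rfl

/-- By `subDigit_one_iff`, the pairs counted at `x` before the step are those to be kept together
with those counted at `x - 3 ^ j`, and the two kinds are disjoint. Hence the truncated subtraction
is exact. -/
theorem transform_sub_pairCount {j : ℕ} (hj : j ≤ k) (x : ℕ) :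
    transform .sub (pairCount k inf xi xi' A B 0) j x = pairCount k inf xi xi' A B j x := by
  classical
  induction j generalizing x with
  | zero => rfl
  | succ j ih =>
    have ih := ih (by omega)
    have hj' : j < k := by omega
    rw [transform, transformStep]
    split
    next h =>
      rw [ih, ih]
      refine Nat.sub_eq_of_eq_add (card_filter_split _ _ _ _ ?_ ?_)
      · intro c hc
        have hE : (∀ q < k, q ≠ j → if q < j then
            JoinDigit (digit c.1 q) (digit c.2 q) (digit (x - 3 ^ j) q) else
            SubDigit (digit c.1 q) (digit (x - 3 ^ j) q) ∧
              SubDigit (digit c.2 q) (digit (x - 3 ^ j) q)) ↔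
            (∀ q < k, q ≠ j → if q < j then
              JoinDigit (digit c.1 q) (digit c.2 q) (digit x q) else
              SubDigit (digit c.1 q) (digit x q) ∧ SubDigit (digit c.2 q) (digit x q)) :=
          forall₃_congr fun q _ hqj => by rw [digit_sub_of_ne h hqj]
        have e₁ := mixed_iff hj' (fun q => JoinDigit (digit c.1 q) (digit c.2 q) (digit x q))
          fun q => SubDigit (digit c.1 q) (digit x q) ∧ SubDigit (digit c.2 q) (digit x q)
        have e₂ := mixed_iff hj'
          (fun q => JoinDigit (digit c.1 q) (digit c.2 q) (digit (x - 3 ^ j) q))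
          fun q => SubDigit (digit c.1 q) (digit (x - 3 ^ j) q) ∧
            SubDigit (digit c.2 q) (digit (x - 3 ^ j) q)
        have e₃ := mixed_succ_iff hj' (fun q => JoinDigit (digit c.1 q) (digit c.2 q) (digit x q))
          fun q => SubDigit (digit c.1 q) (digit x q) ∧ SubDigit (digit c.2 q) (digit x q)
        rw [sub_div_of_digit h hj', e₁, e₂, e₃, hE]
        refine and_and_iff_or ?_
        rw [digit_sub_self h, h]
        exact subDigit_one_iff _ _
      · intro c hc h₁ h₂
        rw [mixed_succ_iff hj'] at h₁
        rw [mixed_iff hj' (fun q => JoinDigit (digit c.1 q) _ _)] at h₂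
        have h₂' := h₂.2.1
        rw [digit_sub_self h] at h₂'
        simp only [SubDigit, zero_ne_one, and_false, or_false] at h₂'
        have := h₁.2.1.2.2 h
        omega
    next h =>
      rw [ih]
      refine congrArg Finset.card (Finset.filter_congr fun c hc => ?_)
      have : JoinDigit (digit c.1 j) (digit c.2 j) (digit x j) ↔
          SubDigit (digit c.1 j) (digit x j) ∧ SubDigit (digit c.2 j) (digit x j) := by
        simp [JoinDigit, h]
      rw [mixed_iff hj' (fun q => JoinDigit (digit c.1 q) (digit c.2 q) (digit x q)),
        mixed_succ_iff hj', this]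

end

theorem joinCount_eq (k inf : ℕ) (A B : ℕ → ℕ) (x : ℕ) :
    joinCount k inf A B x =
      pairCount k inf (tableMin inf A (3 ^ k)) (tableMin inf B (3 ^ k)) A B k x := by
  rw [joinCount, funext (transform_add_indicatorTable k inf _ A le_rfl),
    funext (transform_add_indicatorTable k inf _ B le_rfl), funext (convolve_sumCount k inf _ _ A B),
    transform_sub_pairCount _ _ _ _ _ _ le_rfl]

theorem joinTable_le (k inf : ℕ) (A B : ℕ → ℕ) (d : ℕ) : joinTable k inf A B d ≤ inf :=
  tableMin_le ..

/-- A finite entry comes from a non-zero count, and a non-empty set of counted pairs supplies the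
witness. -/
theorem exists_of_joinTable_lt {k inf : ℕ} {A B : ℕ → ℕ} {d : ℕ} (hd : d < 3 ^ k)
    (h : joinTable k inf A B d < inf) : ∃ c₁ < 3 ^ k, ∃ c₂ < 3 ^ k, A c₁ < inf ∧ B c₂ < inf ∧
      Joins k c₁ c₂ d ∧ A c₁ + B c₂ = joinTable k inf A B d := by
  rw [joinTable] at h ⊢
  obtain h' | ⟨v, hv, h'⟩ := tableMin_eq inf (fun v => if joinCount k inf A B (v * 3 ^ k + d) = 0
    then inf else tableMin inf A (3 ^ k) + tableMin inf B (3 ^ k) + v) (2 * k + 1)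
  · omega
  rw [h'] at h ⊢
  split at h
  · omega
  next hne =>
    rw [if_neg hne]
    rw [joinCount_eq, pairCount] at hne
    obtain ⟨⟨c₁, c₂⟩, hc⟩ := Finset.card_ne_zero.mp hne
    simp only [Finset.mem_filter, Finset.mem_product, Finset.mem_range] at hc
    obtain ⟨⟨h₁, h₂⟩, ⟨⟨w, hw, hA, hB⟩, hA', hB'⟩, hq⟩ := hc
    have hdiv : (v * 3 ^ k + d) / 3 ^ k = v := by
      rw [Nat.add_comm, Nat.add_mul_div_right _ _ (by positivity), Nat.div_eq_of_lt hd, zero_add]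
    rw [hdiv] at hw hB
    refine ⟨c₁, h₁, c₂, h₂, hA', hB', fun q hq' => ?_, by omega⟩
    have := hq q hq'
    rwa [if_pos hq', digit_mul_add hq'] at this

/-- Both entries lie at most `k` above the minima of their tables, so the sum of their excesses is
at most `2 * k` and within the range that `joinTable` inspects. Entries farther from the minimum
carry no such guarantee. -/
theorem joinTable_le_add {k inf : ℕ} {A B : ℕ → ℕ} {c₁ c₂ d : ℕ} (h₁ : c₁ < 3 ^ k)
    (h₂ : c₂ < 3 ^ k) (hd : d < 3 ^ k) (hA : A c₁ < inf) (hB : B c₂ < inf)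
    (hA' : ∀ c < 3 ^ k, A c < inf → A c₁ ≤ A c + k)
    (hB' : ∀ c < 3 ^ k, B c < inf → B c₂ ≤ B c + k) (hj : Joins k c₁ c₂ d) :
    joinTable k inf A B d ≤ A c₁ + B c₂ := by
  have hmin {f : ℕ → ℕ} {c : ℕ} (hc : c < 3 ^ k) (hf : f c < inf)
      (h : ∀ c' < 3 ^ k, f c' < inf → f c ≤ f c' + k) :
      ∃ v ≤ k, f c = tableMin inf f (3 ^ k) + v := by
    have hle := tableMin_le_apply inf f hc
    refine ⟨f c - tableMin inf f (3 ^ k), ?_, by omega⟩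
    obtain h' | ⟨c', hc', h'⟩ := tableMin_eq inf f (3 ^ k)
    · omega
    · have := h c' hc' (by omega)
      omega
  obtain ⟨v₁, hv₁, e₁⟩ := hmin h₁ hA hA'
  obtain ⟨v₂, hv₂, e₂⟩ := hmin h₂ hB hB'
  refine (tableMin_le_apply inf _ (show v₁ + v₂ < 2 * k + 1 by omega)).trans ?_
  have hdiv : ((v₁ + v₂) * 3 ^ k + d) / 3 ^ k = v₁ + v₂ := by
    rw [Nat.add_comm, Nat.add_mul_div_right _ _ (by positivity), Nat.div_eq_of_lt hd, zero_add]
  rw [if_neg]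
  · omega
  · rw [joinCount_eq, pairCount]
    refine Finset.card_ne_zero.mpr ⟨(c₁, c₂), ?_⟩
    simp only [Finset.mem_filter, Finset.mem_product, Finset.mem_range, hdiv]
    refine ⟨⟨h₁, h₂⟩, ⟨⟨v₁, by omega, e₁, by omega⟩, hA, hB⟩, fun q hq => ?_⟩
    rw [if_pos hq, digit_mul_add hq]
    exact hj q hq

/-- Bounds the length `(2 * k + 1) * 3 ^ k` of the arrays of counts by `9 ^ k`. -/
theorem two_mul_add_one_le_three_pow (k : ℕ) : 2 * k + 1 ≤ 3 ^ k := by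
  induction k with
  | zero => simp
  | succ k ih => rw [pow_succ]; omega

/-! ### The program for the join -/

namespace RAM
open RAM.Expr (reg)

/-- Find the minimum of a table. -/
def minProg (a x : ℕ) : Prog :=
  x ≔ reg rInf ;; .forTo rC rLp (.ite (a⟦reg rC⟧ ≺ reg x) (x ≔ a⟦reg rC⟧) .skip)

/-- The condition `25 < x` keeps the result apart from the registers that the loop reads and counts
with. -/
theorem runs_minProg {W : ℕ} {s : State} {a x L inf : ℕ} {A : ℕ → ℕ} (hx : 25 < x)
    (hL : s.reg rLp = L) (hinf : s.reg rInf = inf) (hLW : L < W) (hinfW : inf < W)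
    (hA : ∀ c < L, s.arr a c = A c) :
    Runs W (minProg a x) s (L * 20 + 10) fun s' => s'.reg x = tableMin inf A L := by
  have hne : ∀ y ≤ 25, Nat.beq y x = false := fun y hy => nat_beq_eq_false (by omega)
  refine .wp_seq 2 (L * 20 + 6) rfl (by omega) ⟨by simpa [hinf] using hinfW, ?_⟩
  refine .forTo (m := L) (fun j s' => s'.reg x = tableMin inf A j) 10
    ?_ hLW ?_ rfl ?_ ?_ (by omega) fun _ _ h => h
  · simpa [Nat.ne_of_lt (show 15 < x by omega)] using hL
  · simp [Prog.keepsReg, hne]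
  · simp [Nat.ne_of_gt (show 19 < x by omega), hinf, tableMin]
  · intro j hj s₁ hA₁ hi hI
    have e : s₁.arr a j = A j := by rw [hA₁.arr _ rfl]; exact hA j hj
    refine .of_wp_le rfl ?_
    have := tableMin_le inf A (j + 1)
    rw [tableMin] at this
    simp [hi, hI, e, Nat.ne_of_gt (show 19 < x by omega), tableMin]
    omega

/-- Store the indicator function of the graph of a table. -/
def indicatorProg (a f x : ℕ) : Prog :=
  .forTo rX rL2 (.setArr f (reg rX)
    ((a⟦reg rX % reg rLp⟧ ≐ reg x + reg rX / reg rLp) * (a⟦reg rX % reg rLp⟧ ≺ reg rInf)))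

theorem runs_indicatorProg {W : ℕ} {s : State} {a f x k L₂ inf xi : ℕ} {A : ℕ → ℕ} (hx : x < 28)
    (haf : Nat.beq a f = false)
    (hL : s.reg rLp = 3 ^ k) (hL₂ : s.reg rL2 = L₂) (hinf : s.reg rInf = inf)
    (hxi : s.reg x = xi) (hLW : L₂ < W) (hA : ∀ c < 3 ^ k, s.arr a c = A c) :
    Runs W (indicatorProg a f x) s (L₂ * 40 + 6)
      fun s' => ∀ y < L₂, s'.arr f y = indicatorTable k inf xi A y := by
  refine .forTo (fun j s' => ∀ y < j, s'.arr f y = indicatorTable k inf xi A y) 25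
    hL₂ hLW rfl rfl (by simp) ?_ (by omega) fun _ _ h => h
  intro j hj s₁ hA₁ hi hI
  have hx' : s₁.reg x = xi := by
    rw [← hxi]; exact hA₁.reg _ (by simp [Prog.forTo, Prog.keepsReg, nat_beq_eq_false (show x ≠ 31 by omega)])
  have ha : s₁.arr a = s.arr a := hA₁.arr _ (by simpa [Prog.forTo, Prog.keepsArr] using haf)
  have e1 : s₁.reg rLp = 3 ^ k := by rw [hA₁.reg _ rfl, hL]
  have e2 : s₁.reg rInf = inf := by rw [hA₁.reg _ rfl, hinf]
  refine .of_wp_le rfl ?_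
  have hval : ((a⟦reg rX % reg rLp⟧ ≐ reg x + reg rX / reg rLp) *
      (a⟦reg rX % reg rLp⟧ ≺ reg rInf)).val s₁ = indicatorTable k inf xi A j := by
    simp [hi, hx', e1, e2, ha, hA _ (Nat.mod_lt j (show 0 < 3 ^ k by positivity)),
      indicatorTable, ite_and]
    split_ifs <;> rfl
  have hle : indicatorTable k inf xi A j ≤ 1 := by
    rw [indicatorTable]; split <;> omega
  simp only [Prog.wp, hval, Expr.val_reg, hi]
  refine ⟨by omega, fun y hy => ?_⟩
  simp only [State.setReg_arr, State.setArr_arr, if_true, Function.update_apply]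
  split
  next h => rw [h]
  next h => exact hI y (by omega)

/-- Store the convolution of two arrays. -/
def convolveProg : Prog :=
  .forTo rX rL2 (rVal ≔ 0 ;; rT ≔ reg rX / reg rLp + 1 ;;
    (.forTo rKap rT (rVal ≔ reg rVal + aF⟦reg rKap * reg rLp + reg rX % reg rLp⟧ *
      aG⟦(reg rX / reg rLp - reg rKap) * reg rLp + reg rX % reg rLp⟧)) ;;
    .setArr aH (reg rX) (reg rVal))

/-- Used with `m = 2 * k + 1`, where each of the `m * 3 ^ k` cells is a sum of at most `m` terms;
this is one source of the factor `k ^ 2`. -/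
theorem runs_convolveProg {W : ℕ} {s : State} {k m : ℕ} {f g : ℕ → ℕ}
    (hL : s.reg rLp = 3 ^ k) (hL₂ : s.reg rL2 = m * 3 ^ k)
    (hLW : m * 3 ^ k < W) (hf : ∀ y < m * 3 ^ k, s.arr aF y = f y)
    (hg : ∀ y < m * 3 ^ k, s.arr aG y = g y) (hW : ∀ y, convolve k f g y < W) :
    Runs W convolveProg s (m * 3 ^ k * (m * 40 + 40) + 6)
      fun s' => ∀ y < m * 3 ^ k, s'.arr aH y = convolve k f g y := by
  have hpos : 0 < 3 ^ k := by positivity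
  refine .forTo (fun j s' => ∀ y < j, s'.arr aH y = convolve k f g y) (m * 40 + 30)
    hL₂ hLW rfl rfl (by simp) ?_ (Nat.add_le_add_right (Nat.mul_le_mul_left _ (by omega)) _) fun _ _ h => h
  intro j hj s₁ hA₁ hi hI
  have hjm : j / 3 ^ k < m := Nat.div_lt_of_lt_mul (by rwa [mul_comm])
  have hmW : m < W := lt_of_le_of_lt (Nat.le_mul_of_pos_right _ hpos) hLW
  have e1 : s₁.reg rLp = 3 ^ k := by rw [hA₁.reg _ rfl, hL]
  have e2 : s₁.arr aF = s.arr aF := hA₁.arr _ rfl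
  have e3 : s₁.arr aG = s.arr aG := hA₁.arr _ rfl
  refine .wp_seq 2 (m * 40 + 28) rfl (by omega) ?_
  refine ⟨Nat.zero_lt_of_lt hLW, ?_⟩
  refine .wp_seq 6 (m * 40 + 20) rfl (by omega) ?_
  refine ⟨by simp [e1, hi]; omega, ?_⟩
  -- Partial sums are stored too; they stay below `W` because the terms are non-negative and the
  -- full sum does.
  have hsum (v : ℕ) (hv : v ≤ j / 3 ^ k + 1) : ∑ v ∈ Finset.range v,
      f (v * 3 ^ k + j % 3 ^ k) * g ((j / 3 ^ k - v) * 3 ^ k + j % 3 ^ k) < W :=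
    lt_of_le_of_lt (Finset.sum_le_sum_of_subset (by simpa using hv)) (hW j)
  have hmod := Nat.mod_lt j hpos
  have hidx (v : ℕ) (hv : v ≤ j / 3 ^ k) : v * 3 ^ k + j % 3 ^ k < m * 3 ^ k := by
    calc v * 3 ^ k + j % 3 ^ k < (v + 1) * 3 ^ k := by rw [Nat.succ_mul]; omega
      _ ≤ m * 3 ^ k := Nat.mul_le_mul_right _ (by omega)
  refine .seq (fun s' => s'.reg rVal = convolve k f g j) (m * 40 + 6) 3 (by omega)
    (.forTo (m := j / 3 ^ k + 1) (fun v s' => s'.reg rVal = ∑ v ∈ Finset.range v,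
      f (v * 3 ^ k + j % 3 ^ k) * g ((j / 3 ^ k - v) * 3 ^ k + j % 3 ^ k)) 30
      (by simp [e1, hi]) (by omega) rfl rfl (by simp) ?_ ?_ fun _ _ h => h) ?_
  · intro v hv s₂ hA₂ hi₂ hI₂
    have e4 : s₂.reg rLp = 3 ^ k := by rw [hA₂.reg _ rfl]; simp [e1]
    have e5 : s₂.arr aF = s.arr aF := by rw [hA₂.arr _ rfl]; exact e2
    have e6 : s₂.arr aG = s.arr aG := by rw [hA₂.arr _ rfl]; exact e3
    have e7 : s₂.reg rX = j := by rw [hA₂.reg _ rfl]; simp [hi]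
    refine .of_wp_le rfl ?_
    have := hsum (v + 1) (by omega)
    simp [hi₂, e4, e5, e6, e7, hI₂, hf _ (hidx v (by omega)),
      hg _ (hidx (j / 3 ^ k - v) (by omega)), ← Finset.sum_range_succ]
    exact this
  · nlinarith
  · intro s₂ hA₂ hI₂
    refine .of_wp_le rfl ?_
    have e7 : s₂.reg rX = j := by rw [hA₂.reg _ rfl]; simp [hi]
    have e8 : s₂.arr aH = s₁.arr aH := hA₂.arr _ rfl
    simp only [Prog.wp, Expr.val_reg, e7, hI₂]
    refine ⟨hW j, fun y hy => ?_⟩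
    simp only [State.setReg_arr, State.setArr_arr, if_true, Function.update_apply]
    split
    next h => rw [h]
    next h => rw [e8]; exact hI y (by omega)

/-- Read the join of two tables off the counts. -/
def extractProg : Prog :=
  rE ≔ 2 * reg rKp + 1 ;;
  .forTo rC rLp (rVal ≔ reg rInf ;;
    .forTo rKap rE (.ite (aH⟦reg rKap * reg rLp + reg rC⟧)
      (.ite (reg rXi1 + reg rXi2 + reg rKap ≺ reg rVal)
        (rVal ≔ reg rXi1 + reg rXi2 + reg rKap) .skip) .skip) ;;
    .setArr aTab (reg rP * reg rS + reg rC) (reg rVal))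

theorem runs_extractProg {W : ℕ} {s : State} {k S p inf xi xi' : ℕ} {h : ℕ → ℕ}
    (hL : s.reg rLp = 3 ^ k) (hk : s.reg rKp = k) (hinf : s.reg rInf = inf)
    (hxi : s.reg rXi1 = xi) (hxi' : s.reg rXi2 = xi') (hp : s.reg rP = p) (hS : s.reg rS = S)
    (hLW : 3 ^ k < W) (hinfW : inf < W)
    (hh : ∀ y < (2 * k + 1) * 3 ^ k, s.arr aH y = h y) :
    Runs W extractProg s (3 ^ k * (k * 100 + 80) + 20)
      fun s' => ∀ y, s'.arr aTab y = if p * S ≤ y ∧ y < p * S + 3 ^ k then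
        tableMin inf (fun v => if h (v * 3 ^ k + (y - p * S)) = 0 then inf else xi + xi' + v)
          (2 * k + 1) else s.arr aTab y := by
  have hkW := two_mul_add_one_le_three_pow k
  refine .wp_seq 10 (3 ^ k * (k * 100 + 80) + 10) rfl (by omega) ?_
  refine ⟨by simp [hk]; omega, ?_⟩
  have hpos : 0 < 3 ^ k := by positivity
  let v (d : ℕ) := tableMin inf
    (fun v => if h (v * 3 ^ k + d) = 0 then inf else xi + xi' + v) (2 * k + 1)
  refine .forTo (m := 3 ^ k) (fun d s' => ∀ y, s'.arr aTab y =
    if p * S ≤ y ∧ y < p * S + d then v (y - p * S) else s.arr aTab y) (k * 100 + 72)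
    (by simp [hL]) hLW rfl rfl ?_ ?_ (Nat.add_le_add (Nat.mul_le_mul_left _ (by omega)) (by omega))
    fun _ _ h => h
  · intro y
    rw [if_neg (by omega)]; rfl
  intro d hd s₁ hA₁ hi hI
  have e1 : s₁.reg rLp = 3 ^ k := by rw [hA₁.reg _ rfl]; simpa using hL
  have e2 : s₁.reg rInf = inf := by rw [hA₁.reg _ rfl]; simpa using hinf
  have e3 : s₁.reg rE = 2 * k + 1 := by rw [hA₁.reg _ rfl]; simp [hk]
  have e4 : s₁.reg rXi1 = xi := by rw [hA₁.reg _ rfl]; simpa using hxi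
  have e5 : s₁.reg rXi2 = xi' := by rw [hA₁.reg _ rfl]; simpa using hxi'
  have e6 : s₁.reg rP = p := by rw [hA₁.reg _ rfl]; simpa using hp
  have e7 : s₁.reg rS = S := by rw [hA₁.reg _ rfl]; simpa using hS
  have e8 : s₁.arr aH = s.arr aH := hA₁.arr _ rfl
  refine .wp_seq 2 (k * 100 + 66) rfl (by omega) ⟨by simpa [e2] using hinfW, ?_⟩
  refine .seq (fun s' => s'.reg rVal = v d) (k * 100 + 56) 8 (by omega)
    (.forTo (m := 2 * k + 1) (fun l s' => s'.reg rVal = tableMin inf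
      (fun v => if h (v * 3 ^ k + d) = 0 then inf else xi + xi' + v) l) 40
      (by simp [e3]) (by omega) rfl rfl (by simp [e2, tableMin]) ?_ (by omega) fun _ _ h => h) ?_
  · intro l hl s₂ hA₂ hi₂ hI₂
    have f1 : s₂.reg rLp = 3 ^ k := by rw [hA₂.reg _ rfl]; simpa using e1
    have f2 : s₂.reg rXi1 = xi := by rw [hA₂.reg _ rfl]; simpa using e4
    have f3 : s₂.reg rXi2 = xi' := by rw [hA₂.reg _ rfl]; simpa using e5
    have f4 : s₂.reg rC = d := by rw [hA₂.reg _ rfl]; simpa using hi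
    have f5 : s₂.arr aH (l * 3 ^ k + d) = h (l * 3 ^ k + d) := by
      rw [hA₂.arr _ rfl]
      refine (congrFun e8 _).trans (hh _ ?_)
      calc l * 3 ^ k + d < (l + 1) * 3 ^ k := by rw [Nat.succ_mul]; omega
        _ ≤ (2 * k + 1) * 3 ^ k := Nat.mul_le_mul_right _ (by omega)
    have hle := tableMin_le inf
      (fun v => if h (v * 3 ^ k + d) = 0 then inf else xi + xi' + v) l
    refine .of_wp_le rfl ?_
    simp [hi₂, f1, f2, f3, f4, f5, hI₂, tableMin]
    split_ifs <;> omega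
  · intro s₂ hA₂ hI₂
    have f1 : s₂.reg rP = p := by rw [hA₂.reg _ rfl]; simpa using e6
    have f2 : s₂.reg rS = S := by rw [hA₂.reg _ rfl]; simpa using e7
    have f4 : s₂.reg rC = d := by rw [hA₂.reg _ rfl]; simpa using hi
    have f5 : s₂.arr aTab = s₁.arr aTab := hA₂.arr _ rfl
    refine .of_wp_le rfl ?_
    simp only [Prog.wp, Expr.val_reg, Expr.val_add, Expr.val_mul, hI₂, f1, f2, f4]
    refine ⟨lt_of_le_of_lt (tableMin_le ..) hinfW, fun y => ?_⟩
    simp only [State.setReg_arr, State.setArr_arr, if_true, Function.update_apply]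
    split
    next h => rw [if_pos (by omega), h, Nat.add_sub_cancel_left]
    next h => rw [f5, hI y]; exact if_congr (by omega) rfl rfl

end RAM

namespace RAM
open RAM.Expr (reg)

/-- The registers and the table of powers that the join of two tables relies on. -/
structure JoinContext (k K p inf : ℕ) (s : State) : Prop where
  kp : s.reg rKp = k
  lp : s.reg rLp = 3 ^ k
  p : s.reg rP = p
  inf : s.reg rInf = inf
  S : s.reg rS = 3 ^ K
  pow : ∀ j ≤ K, s.arr aPow j = 3 ^ j

theorem JoinContext.agree {k K p inf : ℕ} {s s' : State} {q : Prog}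
    (h : JoinContext k K p inf s) (hA : Agree q s s')
    (hq : (q.keepsReg rKp && q.keepsReg rLp && q.keepsReg rP && q.keepsReg rInf && q.keepsReg rS &&
      q.keepsArr aPow) = true) : JoinContext k K p inf s' := by
  simp only [Bool.and_eq_true] at hq
  obtain ⟨⟨⟨⟨⟨h1, h2⟩, h3⟩, h4⟩, h5⟩, h6⟩ := hq
  exact ⟨hA.reg _ h1 ▸ h.kp, hA.reg _ h2 ▸ h.lp, hA.reg _ h3 ▸ h.p, hA.reg _ h4 ▸ h.inf,
    hA.reg _ h5 ▸ h.S, fun j hj => hA.arr _ h6 ▸ h.pow j hj⟩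

/-- Replace the table of the current parent by its join with the message. -/
def joinProg : Prog :=
  .forTo rC rLp (.setArr aAcc (reg rC) (aTab⟦reg rP * reg rS + reg rC⟧)) ;;
  minProg aAcc rXi1 ;;
  minProg aMsg rXi2 ;;
  rL2 ≔ (2 * reg rKp + 1) * reg rLp ;;
  indicatorProg aAcc aF rXi1 ;;
  indicatorProg aMsg aG rXi2 ;;
  transformProg aF .add ;;
  transformProg aG .add ;;
  convolveProg ;;
  transformProg aH .sub ;;
  extractProg

-- The numbers stored by the transforms and the convolution are cardinalities at every stage:
-- `sumCount_le` bounds them by `3 ^ k` during summation, `pairCount_le` by `9 ^ k` afterwards.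
-- Three transforms make `k` passes over `(2 * k + 1) * 3 ^ k` cells each, which together with the
-- convolution gives the order `k ^ 2 * 3 ^ k`.
set_option maxHeartbeats 1000000 in
theorem runs_joinProg {W : ℕ} {s : State} {k K p inf : ℕ} {A B : ℕ → ℕ}
    (h : JoinContext k K p inf s) (hkK : k ≤ K) (hW : 9 ^ k < W) (hinfW : inf < W)
    (hA : ∀ d < 3 ^ k, s.arr aTab (p * 3 ^ K + d) = A d) (hAW : ∀ d < 3 ^ k, A d < W)
    (hB : ∀ d < 3 ^ k, s.arr aMsg d = B d) :
    Runs W joinProg s (1000 * ((k + 1) ^ 2 * 3 ^ k))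
      fun s' => ∀ y, s'.arr aTab y = if p * 3 ^ K ≤ y ∧ y < p * 3 ^ K + 3 ^ k then
        joinTable k inf A B (y - p * 3 ^ K) else s.arr aTab y := by
  have hpos : 0 < 3 ^ k := by positivity
  have hk2 := two_mul_add_one_le_three_pow k
  have h93 : 9 ^ k = 3 ^ k * 3 ^ k := by rw [← mul_pow]; norm_num
  have hmul : (2 * k + 1) * 3 ^ k < W :=
    lt_of_le_of_lt ((Nat.mul_le_mul_right _ hk2).trans h93.ge) hW
  have h3 : 3 ^ k < W := lt_of_le_of_lt (by nlinarith) hW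
  set L₂ := (2 * k + 1) * 3 ^ k with hL₂
  set xi := tableMin inf A (3 ^ k) with hxi
  set xi' := tableMin inf B (3 ^ k) with hxi'
  have hpow {s : State} (h : JoinContext k K p inf s) : ∀ j < k, s.arr aPow j = 3 ^ j :=
    fun j hj => h.pow j (by omega)
  set f := indicatorTable k inf xi A with hf
  set g := indicatorTable k inf xi' B with hg
  have hconv (y : ℕ) : convolve k (transform .add f k) (transform .add g k) y =
      pairCount k inf xi xi' A B 0 y := by
    rw [funext (transform_add_indicatorTable k inf xi A le_rfl),
      funext (transform_add_indicatorTable k inf xi' B le_rfl), convolve_sumCount]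
  refine .seq (fun s' => ∀ d < 3 ^ k, s'.arr aAcc d = A d) (3 ^ k * 20 + 6)
    (3 ^ k * (100 * k + 200) + 2 * (L₂ * 40) + 3 * (k * (L₂ * 30 + 20)) +
      L₂ * ((2 * k + 1) * 40 + 40) + 120) ?_
    (.forTo (fun j s' => ∀ d < j, s'.arr aAcc d = A d) 12 h.lp h3 rfl rfl (by simp) ?_
      (by omega) fun _ _ h => h) ?_
  · nlinarith
  · intro d hd s₁ hA₁ hi hI
    have h₁ := h.agree hA₁ rfl
    have e : s₁.arr aTab (p * 3 ^ K + d) = A d := by rw [hA₁.arr _ rfl]; exact hA d hd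
    refine .of_wp_le rfl ?_
    simp only [Prog.wp, Expr.val_get, Expr.val_add, Expr.val_mul, Expr.val_reg, hi, h₁.p, h₁.S, e]
    refine ⟨hAW d hd, fun y hy => ?_⟩
    simp only [State.setReg_arr, State.setArr_arr, if_true, Function.update_apply]
    split
    next h => rw [h]
    next h => exact hI y (by omega)
  intro s₁ A₁ hacc
  have h₁ := h.agree A₁ rfl
  have eB₁ : ∀ d < 3 ^ k, s₁.arr aMsg d = B d := by rw [A₁.arr _ rfl]; exact hB
  refine .seq _ (3 ^ k * 20 + 10) (3 ^ k * (100 * k + 180) + 2 * (L₂ * 40) +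
      3 * (k * (L₂ * 30 + 20)) + L₂ * ((2 * k + 1) * 40 + 40) + 110) (by nlinarith)
    (runs_minProg (by norm_num) h₁.lp h₁.inf h3 hinfW hacc) fun s₂ A₂ e₂ => ?_
  have h₂ := h₁.agree A₂ rfl
  have eA₂ : ∀ d < 3 ^ k, s₂.arr aAcc d = A d := by rw [A₂.arr _ rfl]; exact hacc
  have eB₂ : ∀ d < 3 ^ k, s₂.arr aMsg d = B d := by rw [A₂.arr _ rfl]; exact eB₁
  refine .seq _ (3 ^ k * 20 + 10) (3 ^ k * (100 * k + 160) + 2 * (L₂ * 40) +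
      3 * (k * (L₂ * 30 + 20)) + L₂ * ((2 * k + 1) * 40 + 40) + 100) (by nlinarith)
    (runs_minProg (by norm_num) h₂.lp h₂.inf h3 hinfW eB₂) fun s₃ A₃ e₃ => ?_
  have h₃ := h₂.agree A₃ rfl
  have eA₃ : ∀ d < 3 ^ k, s₃.arr aAcc d = A d := by rw [A₃.arr _ rfl]; exact eA₂
  have eB₃ : ∀ d < 3 ^ k, s₃.arr aMsg d = B d := by rw [A₃.arr _ rfl]; exact eB₂
  have x₃ : s₃.reg rXi1 = xi := (A₃.reg _ rfl).trans e₂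
  refine .seq (fun s' => s'.reg rL2 = L₂) 10 (3 ^ k * (100 * k + 160) + 2 * (L₂ * 40) +
      3 * (k * (L₂ * 30 + 20)) + L₂ * ((2 * k + 1) * 40 + 40) + 90) (by omega)
    (.of_wp_le rfl (by simpa [h₃.kp, h₃.lp, hL₂] using hmul)) fun s₄ A₄ l₄ => ?_
  have h₄ := h₃.agree A₄ rfl
  have eA₄ : ∀ d < 3 ^ k, s₄.arr aAcc d = A d := by rw [A₄.arr _ rfl]; exact eA₃
  have eB₄ : ∀ d < 3 ^ k, s₄.arr aMsg d = B d := by rw [A₄.arr _ rfl]; exact eB₃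
  have x₄ : s₄.reg rXi1 = xi := (A₄.reg _ rfl).trans x₃
  have y₄ : s₄.reg rXi2 = xi' := (A₄.reg _ rfl).trans e₃
  refine .seq _ (L₂ * 40 + 6) (3 ^ k * (100 * k + 160) + L₂ * 40 +
      3 * (k * (L₂ * 30 + 20)) + L₂ * ((2 * k + 1) * 40 + 40) + 80) (by omega)
    (runs_indicatorProg (by norm_num) rfl h₄.lp l₄ h₄.inf x₄ hmul eA₄) fun s₅ A₅ f₅ => ?_
  have h₅ := h₄.agree A₅ rfl
  have eB₅ : ∀ d < 3 ^ k, s₅.arr aMsg d = B d := by rw [A₅.arr _ rfl]; exact eB₄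
  have x₅ : s₅.reg rXi1 = xi := (A₅.reg _ rfl).trans x₄
  have y₅ : s₅.reg rXi2 = xi' := (A₅.reg _ rfl).trans y₄
  have l₅ : s₅.reg rL2 = L₂ := (A₅.reg _ rfl).trans l₄
  refine .seq _ (L₂ * 40 + 6) (3 ^ k * (100 * k + 160) +
      3 * (k * (L₂ * 30 + 20)) + L₂ * ((2 * k + 1) * 40 + 40) + 70) (by omega)
    (runs_indicatorProg (by norm_num) rfl h₅.lp l₅ h₅.inf y₅ hmul eB₅) fun s₆ A₆ g₆ => ?_
  have h₆ := h₅.agree A₆ rfl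
  have f₆ : ∀ y < L₂, s₆.arr aF y = f y := by rw [A₆.arr _ rfl]; exact f₅
  have x₆ : s₆.reg rXi1 = xi := (A₆.reg _ rfl).trans x₅
  have y₆ : s₆.reg rXi2 = xi' := (A₆.reg _ rfl).trans y₅
  have l₆ : s₆.reg rL2 = L₂ := (A₆.reg _ rfl).trans l₅
  refine .seq _ (k * (L₂ * 30 + 20) + 6) (3 ^ k * (100 * k + 160) +
      2 * (k * (L₂ * 30 + 20)) + L₂ * ((2 * k + 1) * 40 + 40) + 60) (by omega)
    (runs_transformProg rfl h₆.kp l₆ (by omega) hmul (hpow h₆) h3 f₆ fun j hj x _ => by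
      rw [hf, transform_add_indicatorTable k inf xi A hj]
      exact lt_of_le_of_lt (sumCount_le ..) h3) fun s₇ A₇ f₇ => ?_
  have h₇ := h₆.agree A₇ rfl
  have g₇ : ∀ y < L₂, s₇.arr aG y = g y := by rw [A₇.arr _ rfl]; exact g₆
  have x₇ : s₇.reg rXi1 = xi := (A₇.reg _ rfl).trans x₆
  have y₇ : s₇.reg rXi2 = xi' := (A₇.reg _ rfl).trans y₆
  have l₇ : s₇.reg rL2 = L₂ := (A₇.reg _ rfl).trans l₆
  refine .seq _ (k * (L₂ * 30 + 20) + 6) (3 ^ k * (100 * k + 160) +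
      k * (L₂ * 30 + 20) + L₂ * ((2 * k + 1) * 40 + 40) + 50) (by omega)
    (runs_transformProg rfl h₇.kp l₇ (by omega) hmul (hpow h₇) h3 g₇ fun j hj x _ => by
      rw [hg, transform_add_indicatorTable k inf xi' B hj]
      exact lt_of_le_of_lt (sumCount_le ..) h3) fun s₈ A₈ g₈ => ?_
  have h₈ := h₇.agree A₈ rfl
  have f₈ : ∀ y < L₂, s₈.arr aF y = transform .add f k y := by rw [A₈.arr _ rfl]; exact f₇
  have x₈ : s₈.reg rXi1 = xi := (A₈.reg _ rfl).trans x₇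
  have y₈ : s₈.reg rXi2 = xi' := (A₈.reg _ rfl).trans y₇
  have l₈ : s₈.reg rL2 = L₂ := (A₈.reg _ rfl).trans l₇
  refine .seq _ (L₂ * ((2 * k + 1) * 40 + 40) + 6) (3 ^ k * (100 * k + 160) +
      k * (L₂ * 30 + 20) + 40) (by omega)
    (runs_convolveProg h₈.lp l₈ hmul f₈ g₈ fun y => by
      rw [hconv]; exact lt_of_le_of_lt (pairCount_le ..) hW) fun s₉ A₉ c₉ => ?_
  have h₉ := h₈.agree A₉ rfl
  have x₉ : s₉.reg rXi1 = xi := (A₉.reg _ rfl).trans x₈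
  have y₉ : s₉.reg rXi2 = xi' := (A₉.reg _ rfl).trans y₈
  have l₉ : s₉.reg rL2 = L₂ := (A₉.reg _ rfl).trans l₈
  refine .seq _ (k * (L₂ * 30 + 20) + 6) (3 ^ k * (100 * k + 160) + 30) (by omega)
    (runs_transformProg rfl h₉.kp l₉ (by omega) hmul (hpow h₉) h3 c₉ fun j hj x _ => by
      rw [funext hconv, transform_sub_pairCount k inf xi xi' A B hj]
      exact lt_of_le_of_lt (pairCount_le ..) hW) fun s' A' c' => ?_
  have h' := h₉.agree A' rfl
  have htab : s'.arr aTab = s.arr aTab := by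
    rw [A'.arr _ rfl, A₉.arr _ rfl, A₈.arr _ rfl, A₇.arr _ rfl, A₆.arr _ rfl, A₅.arr _ rfl,
      A₄.arr _ rfl, A₃.arr _ rfl, A₂.arr _ rfl, A₁.arr _ rfl]
  refine (runs_extractProg h'.lp h'.kp h'.inf ((A'.reg _ rfl).trans x₉) ((A'.reg _ rfl).trans y₉)
    h'.p h'.S h3 hinfW c').mono (by nlinarith) fun s'' _ hs y => ?_
  rw [hs y, htab]
  rfl

end RAM

/-! ### Dynamic programming over a rooted tree decomposition -/

/-- `D` dominates all vertices less than `n`. -/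
def Dominates (Adj : ℕ → ℕ → Prop) (n : ℕ) (D : Finset ℕ) : Prop :=
  ∀ v < n, v ∈ D ∨ ∃ u ∈ D, Adj u v

/-- The vertices of a bag. -/
def bagSet (k : ℕ) (b : ℕ → ℕ) : Finset ℕ := (Finset.range k).image b

theorem mem_bagSet {k : ℕ} {b : ℕ → ℕ} {v : ℕ} : v ∈ bagSet k b ↔ ∃ q < k, b q = v := by
  simp [bagSet]

theorem apply_mem_bagSet {k q : ℕ} (b : ℕ → ℕ) (hq : q < k) : b q ∈ bagSet k b :=
  mem_bagSet.mpr ⟨q, hq, rfl⟩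

/-- The state of the vertex `v` with respect to a set `D`: in `D`, or dominated by a forgotten
vertex of `D`, or neither. -/
noncomputable def vertexState (Adj : ℕ → ℕ → Prop) (D F : Finset ℕ) (v : ℕ) : ℕ :=
  open Classical in if v ∈ D then 2 else if ∃ u ∈ D, u ∈ F ∧ Adj u v then 1 else 0

theorem vertexState_lt (Adj : ℕ → ℕ → Prop) (D F : Finset ℕ) (v : ℕ) :
    vertexState Adj D F v < 3 := by
  rw [vertexState]; split_ifs <;> omega

theorem vertexState_eq_two {Adj : ℕ → ℕ → Prop} {D F : Finset ℕ} {v : ℕ} :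
    vertexState Adj D F v = 2 ↔ v ∈ D := by
  rw [vertexState]; split_ifs <;> simp [*]

theorem vertexState_eq_one {Adj : ℕ → ℕ → Prop} {D F : Finset ℕ} {v : ℕ} :
    vertexState Adj D F v = 1 ↔ v ∉ D ∧ ∃ u ∈ D, u ∈ F ∧ Adj u v := by
  rw [vertexState]
  split_ifs with h h'
  · simp [h]
  · exact iff_of_true rfl ⟨h, h'⟩
  · exact iff_of_false (by norm_num) fun e => h' e.2

/-- `A` is a correct table for a bag and a set `F` of forgotten vertices: each of its finite
entries is an upper bound for a partial solution, and the entry that belongs to the optimal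
solution `S` is at most the number of forgotten vertices of `S`. -/
structure IsTable (Adj : ℕ → ℕ → Prop) (n : ℕ) (S : Finset ℕ) (k : ℕ) (b : ℕ → ℕ) (F : Finset ℕ)
    (A : ℕ → ℕ) : Prop where
  le : ∀ c < 3 ^ k, A c ≤ n + 1
  sound : ∀ c < 3 ^ k, A c < n + 1 → ∃ D ⊆ F ∪ bagSet k b, (D ∩ F).card ≤ A c ∧
    (∀ q < k, digit c q = 2 ↔ b q ∈ D) ∧
    (∀ q < k, digit c q = 1 → ∃ u ∈ D, Adj u (b q)) ∧ ∀ v ∈ F, v ∈ D ∨ ∃ u ∈ D, Adj u v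
  complete : A (encode (fun q => vertexState Adj S F (b q)) k) ≤ (S ∩ F).card

section

variable {Adj : ℕ → ℕ → Prop} {n : ℕ} {S : Finset ℕ} {k : ℕ} {b : ℕ → ℕ}

/-- Exchange argument: replace the part of `S` in `F` by `D ∩ F` and add the whole bag. Vertices of
`F` are dominated by `D`, vertices of the bag are included, and any other vertex keeps its dominator
in `S`, which cannot lie in `F` because neighbours of `F` are in `F` or in the bag. Minimality of
`S` gives the bound. -/
theorem IsTable.card_inter_le {F : Finset ℕ} {A : ℕ → ℕ} (hS : Dominates Adj n S)
    (hmin : ∀ D, Dominates Adj n D → S.card ≤ D.card) (h : IsTable Adj n S k b F A)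
    (hF : ∀ v ∈ F, ∀ u, Adj v u → u ∈ F ∪ bagSet k b)
    {c : ℕ} (hc : c < 3 ^ k) (hA : A c < n + 1) : (S ∩ F).card ≤ A c + k := by
  obtain ⟨D, hD, hcard, -, -, hdom⟩ := h.sound c hc hA
  have key : Dominates Adj n ((D ∩ F) ∪ bagSet k b ∪ (S \ F)) := by
    have hsub : ∀ v ∈ D, v ∈ (D ∩ F) ∪ bagSet k b ∪ (S \ F) := by
      intro v hv
      have := hD hv
      simp only [Finset.mem_union, Finset.mem_inter] at this ⊢
      tauto
    intro v hv
    by_cases hvF : v ∈ F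
    · exact (hdom v hvF).imp (hsub v) fun ⟨u, hu, hu'⟩ => ⟨u, hsub u hu, hu'⟩
    by_cases hvb : v ∈ bagSet k b
    · exact .inl (by simp [hvb])
    rcases hS v hv with hvS | ⟨u, hu, huv⟩
    · exact .inl (by simp [hvS, hvF])
    · refine .inr ⟨u, ?_, huv⟩
      have : u ∉ F := fun huF => by
        have := hF u huF v huv
        simp [hvF, hvb] at this
      simp [hu, this]
  have h1 := hmin _ key
  have h2 := Finset.card_union_le ((D ∩ F) ∪ bagSet k b) (S \ F)
  have h3 := Finset.card_union_le (D ∩ F) (bagSet k b)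
  have h4 : (bagSet k b).card ≤ k := Finset.card_image_le.trans (by simp)
  have h5 := Finset.card_inter_add_card_sdiff S F
  omega

/-- Sound because the union of two partial solutions that agree on the bag is a partial solution,
and `F`, `F'` and the bag are disjoint. Complete because the entries of `S` satisfy the
near-minimality conditions of `joinTable_le_add`, by `IsTable.card_inter_le`. -/
theorem IsTable.join {F F' : Finset ℕ} {A B : ℕ → ℕ} (hS : Dominates Adj n S)
    (hmin : ∀ D, Dominates Adj n D → S.card ≤ D.card) (hSn : S.card ≤ n)
    (hA : IsTable Adj n S k b F A) (hB : IsTable Adj n S k b F' B)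
    (hF : ∀ v ∈ F, ∀ u, Adj v u → u ∈ F ∪ bagSet k b)
    (hF' : ∀ v ∈ F', ∀ u, Adj v u → u ∈ F' ∪ bagSet k b) (hFF : Disjoint F F')
    (hFb : Disjoint F (bagSet k b)) (hFb' : Disjoint F' (bagSet k b)) :
    IsTable Adj n S k b (F ∪ F') (joinTable k (n + 1) A B) where
  le c _ := joinTable_le ..
  sound d hd hJ := by
    obtain ⟨c₁, h₁, c₂, h₂, l₁, l₂, hj, he⟩ := exists_of_joinTable_lt hd hJ
    obtain ⟨D₁, s₁, n₁, t₁, o₁, d₁⟩ := hA.sound c₁ h₁ l₁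
    obtain ⟨D₂, s₂, n₂, t₂, o₂, d₂⟩ := hB.sound c₂ h₂ l₂
    refine ⟨D₁ ∪ D₂, fun v hv => ?_, ?_, fun q hq => ?_, fun q hq hd => ?_, fun v hv => ?_⟩
    · have a₁ := @s₁ v
      have a₂ := @s₂ v
      simp only [Finset.mem_union] at *
      tauto
    · rw [← he]
      refine (Finset.card_le_card (t := (D₁ ∩ F) ∪ (D₂ ∩ F')) fun v hv => ?_).trans
        ((Finset.card_union_le _ _).trans (Nat.add_le_add n₁ n₂))
      have a₁ := @s₁ v
      have a₂ := @s₂ v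
      have e₁ : v ∈ F → v ∉ F' := fun h => Finset.disjoint_left.mp hFF h
      have e₂ : v ∈ F → v ∉ bagSet k b := fun h => Finset.disjoint_left.mp hFb h
      have e₃ : v ∈ F' → v ∉ bagSet k b := fun h => Finset.disjoint_left.mp hFb' h
      simp only [Finset.mem_union, Finset.mem_inter] at *
      tauto
    · obtain ⟨x, y, z⟩ := hj q hq
      rw [Finset.mem_union, ← t₁ q hq, ← t₂ q hq]
      simp only [SubDigit] at x y
      omega
    · obtain ⟨-, -, z⟩ := hj q hq
      rcases z hd with h | h
      · obtain ⟨u, hu, hu'⟩ := o₁ q hq h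
        exact ⟨u, Finset.mem_union_left _ hu, hu'⟩
      · obtain ⟨u, hu, hu'⟩ := o₂ q hq h
        exact ⟨u, Finset.mem_union_right _ hu, hu'⟩
    · rcases Finset.mem_union.mp hv with h | h
      · exact (d₁ v h).imp (Finset.mem_union_left _)
          fun ⟨u, hu, hu'⟩ => ⟨u, Finset.mem_union_left _ hu, hu'⟩
      · exact (d₂ v h).imp (Finset.mem_union_right _)
          fun ⟨u, hu, hu'⟩ => ⟨u, Finset.mem_union_right _ hu, hu'⟩
  complete := by
    have hst (F : Finset ℕ) : ∀ q < k, vertexState Adj S F (b q) < 3 :=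
      fun q _ => vertexState_lt ..
    have hle (F : Finset ℕ) : (S ∩ F).card < n + 1 :=
      Nat.lt_succ_of_le ((Finset.card_le_card Finset.inter_subset_left).trans hSn)
    refine (joinTable_le_add (encode_lt (hst F)) (encode_lt (hst F')) (encode_lt (hst _))
      (hA.complete.trans_lt (hle F)) (hB.complete.trans_lt (hle F'))
      (fun c hc hc' => hA.complete.trans (hA.card_inter_le hS hmin hF hc hc'))
      (fun c hc hc' => hB.complete.trans (hB.card_inter_le hS hmin hF' hc hc'))
      fun q hq => ?_).trans ((Nat.add_le_add hA.complete hB.complete).trans_eq ?_)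
    -- The state of a vertex with respect to `F ∪ F'` is the join of its states with respect to `F`
    -- and `F'`; the cases below run through the definition of the state.
    · rw [digit_encode (hst _) hq, digit_encode (hst _) hq, digit_encode (hst _) hq]
      have hor : (∃ u ∈ S, u ∈ F ∪ F' ∧ Adj u (b q)) ↔
          (∃ u ∈ S, u ∈ F ∧ Adj u (b q)) ∨ ∃ u ∈ S, u ∈ F' ∧ Adj u (b q) := by
        simp only [Finset.mem_union]
        grind
      simp only [vertexState]
      clear * - hor
      by_cases hs : b q ∈ S
      · simp only [hs, if_true]; decide
      rw [if_neg hs, if_neg hs, if_neg hs]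
      by_cases hP : ∃ u ∈ S, u ∈ F ∧ Adj u (b q) <;>
        by_cases hQ : ∃ u ∈ S, u ∈ F' ∧ Adj u (b q)
      · rw [if_pos hP, if_pos hQ, if_pos (hor.mpr (.inl hP))]; decide
      · rw [if_pos hP, if_neg hQ, if_pos (hor.mpr (.inl hP))]; decide
      · rw [if_neg hP, if_pos hQ, if_pos (hor.mpr (.inr hQ))]; decide
      · rw [if_neg hP, if_neg hQ, if_neg fun h => (hor.mp h).elim hP hQ]; decide
    · rw [Finset.inter_union_distrib_left, Finset.card_union_of_disjoint]
      exact hFF.mono Finset.inter_subset_right Finset.inter_subset_right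

/-- The table of a bag before anything has been forgotten. -/
def initTable (k inf c : ℕ) : ℕ := if ∃ q < k, digit c q = 1 then inf else 0

/-- With nothing forgotten, no vertex is dominated from below and the count is 0; the witness for a
colouring is the set of bag vertices with digit 2. -/
theorem isTable_initTable (hb : Set.InjOn b (Set.Iio k)) :
    IsTable Adj n S k b ∅ (initTable k (n + 1)) where
  le c _ := by rw [initTable]; split <;> omega
  sound c _ h := by
    rw [initTable] at h
    have h1 : ¬ ∃ q < k, digit c q = 1 := fun h' => by simp [h'] at h
    refine ⟨((Finset.range k).filter fun q => digit c q = 2).image b, fun v hv => ?_, by simp,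
      fun q hq => ?_, fun q hq e => (h1 ⟨q, hq, e⟩).elim, by simp⟩
    · obtain ⟨q, hq, rfl⟩ := Finset.mem_image.mp hv
      simp only [Finset.mem_filter, Finset.mem_range] at hq
      simpa using apply_mem_bagSet b hq.1
    · simp only [Finset.mem_image, Finset.mem_filter, Finset.mem_range]
      refine ⟨fun h => ⟨q, ⟨hq, h⟩, rfl⟩, ?_⟩
      rintro ⟨q', ⟨hq', h⟩, e⟩
      rwa [← hb hq' hq e]
  complete := by
    rw [initTable, if_neg]
    · simp
    · rintro ⟨q, hq, h⟩
      rw [digit_encode (fun _ _ => vertexState_lt ..) hq, vertexState_eq_one] at h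
      simp at h

end

/-! ### Passing a table to the parent -/

section

variable (Adj : ℕ → ℕ → Prop) (k k' : ℕ) (b b' : ℕ → ℕ) (pos pos' : ℕ → ℕ)

/-- `pos v - 1` is the position of the vertex `v < n` in a bag; `pos v = 0` if `v` is not in
the bag. -/
def IsPosition (n k : ℕ) (b pos : ℕ → ℕ) : Prop :=
  (∀ q < k, pos (b q) = q + 1) ∧ ∀ v < n, pos v ≠ 0 → pos v ≤ k ∧ b (pos v - 1) = v

/-- The digit of `c` at position `q` after the edges with a forgotten end have been taken into
account. -/
def updatedDigit [DecidableRel Adj] (c q : ℕ) : ℕ :=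
  if digit c q = 0 ∧ ∃ q' < k, Adj (b q') (b q) ∧ digit c q' = 2 ∧
    (pos' (b q') = 0 ∨ pos' (b q) = 0) then 1 else digit c q

/-- No forgotten vertex is left undominated. -/
def ForgetOk [DecidableRel Adj] (c : ℕ) : Prop :=
  ∀ q < k, pos' (b q) = 0 → updatedDigit Adj k b pos' c q ≠ 0

instance [DecidableRel Adj] (c : ℕ) : Decidable (ForgetOk Adj k b pos' c) :=
  inferInstanceAs (Decidable (∀ q < k, _ → _))

/-- The number of forgotten vertices in the solution. -/
def forgetCount (c : ℕ) : ℕ := ∑ q ∈ Finset.range k, if pos' (b q) = 0 ∧ digit c q = 2 then 1 else 0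

/-- The digits `d` of the bag of a child, as a colouring of the bag of its parent. -/
def transfer (d : ℕ → ℕ) : ℕ :=
  encode (fun q => if pos (b' q) = 0 then 0 else d (pos (b' q) - 1)) k'

/-- The table of the child after vertices have been forgotten. -/
def forgetTable [DecidableRel Adj] (inf : ℕ) (A : ℕ → ℕ) (r : ℕ) : ℕ :=
  tableMin inf (fun c => if ForgetOk Adj k b pos' c ∧
    transfer k' b' pos (updatedDigit Adj k b pos' c) = r then A c + forgetCount k b pos' c
    else inf) (3 ^ k)

/-- The table of the child, extended to the bag of the parent. -/
def messageTable [DecidableRel Adj] (inf : ℕ) (A : ℕ → ℕ) (d : ℕ) : ℕ :=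
  if ∃ q < k', pos (b' q) = 0 ∧ digit d q = 1 then inf else
    forgetTable Adj k k' b b' pos pos' inf A
      (encode (fun q => if pos (b' q) = 0 then 0 else digit d q) k')

end

section

variable {Adj : ℕ → ℕ → Prop} [DecidableRel Adj] {n k k' : ℕ} {b b' : ℕ → ℕ} {pos pos' : ℕ → ℕ}

theorem IsPosition.eq_zero_iff (h : IsPosition n k b pos) {v : ℕ} (hv : v < n) :
    pos v = 0 ↔ v ∉ bagSet k b := by
  rw [mem_bagSet]
  constructor
  · rintro h0 ⟨q, hq, rfl⟩
    rw [h.1 q hq] at h0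
    omega
  · intro h0
    by_contra hne
    have := h.2 v hv hne
    exact h0 ⟨pos v - 1, by omega, this.2⟩

theorem updatedDigit_lt (c q : ℕ) : updatedDigit Adj k b pos' c q < 3 := by
  rw [updatedDigit]; split
  exacts [by omega, digit_lt ..]

theorem updatedDigit_eq_two {c q : ℕ} : updatedDigit Adj k b pos' c q = 2 ↔ digit c q = 2 := by
  rw [updatedDigit]
  split
  next h => omega
  next => rfl

theorem forgetTable_le (inf : ℕ) (A : ℕ → ℕ) (r : ℕ) :
    forgetTable Adj k k' b b' pos pos' inf A r ≤ inf := tableMin_le ..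

theorem messageTable_le (inf : ℕ) (A : ℕ → ℕ) (r : ℕ) :
    messageTable Adj k k' b b' pos pos' inf A r ≤ inf := by
  rw [messageTable]; split
  exacts [le_rfl, forgetTable_le ..]

/-- The hypothesis `hcl` is used twice in the completeness part: a vertex being forgotten has its
dominator in `F` or in the bag, and a vertex being introduced has no forgotten neighbour. -/
theorem IsTable.message {S F : Finset ℕ} {A : ℕ → ℕ} (hS : Dominates Adj n S)
    (hsymm : ∀ u v, Adj u v → Adj v u)
    (hA : IsTable Adj n S k b F A) (hp : IsPosition n k b pos) (hp' : IsPosition n k' b' pos')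
    (hbn : ∀ q < k, b q < n) (hbn' : ∀ q < k', b' q < n)
    (hFb : Disjoint F (bagSet k b)) (hFb' : Disjoint F (bagSet k' b'))
    (hcl : ∀ v ∈ (F ∪ bagSet k b) \ bagSet k' b', ∀ u, Adj v u → u ∈ F ∪ bagSet k b) :
    IsTable Adj n S k' b' ((F ∪ bagSet k b) \ bagSet k' b')
      (messageTable Adj k k' b b' pos pos' (n + 1) A) where
  le c _ := messageTable_le ..
  sound d hd hM := by
    rw [messageTable] at hM ⊢
    split at hM
    · omega
    next h0 =>
    rw [if_neg h0]
    push Not at h0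
    rw [forgetTable] at hM ⊢
    obtain h | ⟨c, hc, h⟩ := tableMin_eq (n + 1) (fun c => if ForgetOk Adj k b pos' c ∧
      transfer k' b' pos (updatedDigit Adj k b pos' c) =
        (encode (fun q => if pos (b' q) = 0 then 0 else digit d q) k')
      then A c + forgetCount k b pos' c else n + 1) (3 ^ k)
    · omega
    rw [h] at hM ⊢
    split at hM
    swap
    · omega
    next hok =>
    rw [if_pos hok]
    obtain ⟨hok, htr⟩ := hok
    obtain ⟨D, hD, hcard, h2, h1, hdom⟩ := hA.sound c hc (by omega)
    have hdig : ∀ q < k', pos (b' q) ≠ 0 →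
        digit d q = updatedDigit Adj k b pos' c (pos (b' q) - 1) := by
      intro q hq hne
      have := congrArg (digit · q) htr
      simp only [transfer] at this
      rw [digit_encode _ hq, digit_encode _ hq, if_neg hne, if_neg hne] at this
      · exact this.symm
      · intro q _; split
        exacts [by omega, digit_lt ..]
      · intro q _; split
        exacts [by omega, updatedDigit_lt ..]
    have hnd : ∀ q < k, updatedDigit Adj k b pos' c q = 1 → ∃ u ∈ D, Adj u (b q) := by
      intro q hq e
      rw [updatedDigit] at e
      split at e
      next h' =>
        obtain ⟨-, q', hq', ha, e', -⟩ := h'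
        exact ⟨b q', (h2 q' hq').mp e', ha⟩
      next => exact h1 q hq e
    -- The introduced vertices that the colouring puts into the solution; they are added to the
    -- partial solution of the child.
    let I := ((Finset.range k').filter fun q => pos (b' q) = 0 ∧ digit d q = 2).image b'
    have hI {v : ℕ} : v ∈ I ↔ ∃ q < k', (pos (b' q) = 0 ∧ digit d q = 2) ∧ b' q = v := by
      simp [I, and_assoc]
    refine ⟨D ∪ I, fun v hv => ?_, ?_, fun q hq => ?_, fun q hq e => ?_, fun v hv => ?_⟩
    · have : v ∈ I → v ∈ bagSet k' b' := fun h => by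
        obtain ⟨q, hq, -, rfl⟩ := hI.mp h
        exact apply_mem_bagSet _ hq
      have hD := @hD v
      simp only [Finset.mem_union, Finset.mem_sdiff] at *
      tauto
    -- Newly counted vertices of the solution are bag vertices with digit 2 that the parent lacks;
    -- `forgetCount` accounts for them.
    · let J := ((Finset.range k).filter fun q => pos' (b q) = 0 ∧ digit c q = 2).image b
      have hJ : J.card ≤ forgetCount k b pos' c := by
        rw [forgetCount, ← Finset.card_filter]
        exact Finset.card_image_le
      refine (Finset.card_le_card (t := (D ∩ F) ∪ J) fun v hv => ?_).trans
        ((Finset.card_union_le _ _).trans (Nat.add_le_add hcard hJ))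
      simp only [Finset.mem_union, Finset.mem_sdiff, Finset.mem_inter] at hv ⊢
      rcases hv with ⟨hv | hv, hv', hvb⟩
      · rcases hv' with h | h
        · exact .inl ⟨hv, h⟩
        · obtain ⟨q, hq, rfl⟩ := mem_bagSet.mp h
          exact .inr (Finset.mem_image.mpr ⟨q, by
            simp [hq, (h2 q hq).mpr hv, (hp'.eq_zero_iff (hbn q hq)).mpr hvb], rfl⟩)
      · obtain ⟨q, hq, -, rfl⟩ := hI.mp hv
        exact (hvb (apply_mem_bagSet _ hq)).elim
    · have hv := apply_mem_bagSet b' hq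
      rw [Finset.mem_union]
      by_cases hne : pos (b' q) = 0
      · have hD' : b' q ∉ D := fun h => by
          rcases Finset.mem_union.mp (hD h) with h | h
          · exact Finset.disjoint_left.mp hFb' h hv
          · exact (hp.eq_zero_iff (hbn' q hq)).mp hne h
        refine ⟨fun e => .inr (hI.mpr ⟨q, hq, ⟨hne, e⟩, rfl⟩), fun h => ?_⟩
        obtain ⟨q', hq', ⟨-, e⟩, e'⟩ := hI.mp (h.resolve_left hD')
        have := hp'.1 q' hq'
        rw [e', hp'.1 q hq] at this
        rwa [show q = q' by omega]
      · have hI' : b' q ∉ I := fun h => by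
          obtain ⟨q', hq', ⟨e, -⟩, e'⟩ := hI.mp h
          exact hne (e' ▸ e)
        obtain ⟨l, e⟩ := hp.2 _ (hbn' q hq) hne
        rw [hdig q hq hne, updatedDigit_eq_two, h2 _ (by omega), e]
        simp [hI']
    · have hne : pos (b' q) ≠ 0 := fun h => h0 q hq h e
      rw [hdig q hq hne] at e
      obtain ⟨l, e'⟩ := hp.2 _ (hbn' q hq) hne
      obtain ⟨u, hu, hu'⟩ := hnd _ (by omega) e
      exact ⟨u, Finset.mem_union_left _ hu, e' ▸ hu'⟩
    · rw [Finset.mem_sdiff, Finset.mem_union] at hv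
      obtain ⟨hv | hv, hvb⟩ := hv
      · exact (hdom v hv).imp (Finset.mem_union_left _)
          fun ⟨u, hu, hu'⟩ => ⟨u, Finset.mem_union_left _ hu, hu'⟩
      · obtain ⟨q, hq, rfl⟩ := mem_bagSet.mp hv
        have h3 := updatedDigit_lt (Adj := Adj) (k := k) (b := b) (pos' := pos') c q
        have h4 := hok q hq ((hp'.eq_zero_iff (hbn q hq)).mpr hvb)
        by_cases h5 : updatedDigit Adj k b pos' c q = 2
        · exact .inl (Finset.mem_union_left _ ((h2 q hq).mp (updatedDigit_eq_two.mp h5)))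
        · obtain ⟨u, hu, hu'⟩ := hnd q hq (by omega)
          exact .inr ⟨u, Finset.mem_union_left _ hu, hu'⟩
  complete := by
    set F' := (F ∪ bagSet k b) \ bagSet k' b' with hF'
    set c := encode (fun q => vertexState Adj S F (b q)) k with hc
    have hF'mem {v : ℕ} : v ∈ F' ↔ v ∈ F ∨ v ∈ bagSet k b ∧ v ∉ bagSet k' b' := by
      have e : v ∈ F → v ∉ bagSet k' b' := fun h => Finset.disjoint_left.mp hFb' h
      rw [hF', Finset.mem_sdiff, Finset.mem_union]
      tauto
    have hcd : ∀ q < k, digit c q = vertexState Adj S F (b q) :=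
      fun q hq => digit_encode (fun _ _ => vertexState_lt ..) hq
    have hcd2 : ∀ q < k, (digit c q = 2 ↔ b q ∈ S) := fun q hq => by
      rw [hcd q hq, vertexState_eq_two]
    have hd : ∀ q < k', digit (encode (fun q => vertexState Adj S F' (b' q)) k') q =
        vertexState Adj S F' (b' q) :=
      fun q hq => digit_encode (fun _ _ => vertexState_lt ..) hq
    have hupd : ∀ q < k, b q ∈ bagSet k' b' →
        updatedDigit Adj k b pos' c q = vertexState Adj S F' (b q) := by
      intro q hq hb
      have hne : pos' (b q) ≠ 0 := fun h => (hp'.eq_zero_iff (hbn q hq)).mp h hb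
      -- A neighbour forgotten after the step was forgotten before or is a bag vertex forgotten now.
      -- The alternative `pos' (b q) = 0` in `updatedDigit` does not apply, since `b q` survives.
      have hiff : (∃ u ∈ S, u ∈ F' ∧ Adj u (b q)) ↔ (∃ u ∈ S, u ∈ F ∧ Adj u (b q)) ∨
          ∃ q' < k, Adj (b q') (b q) ∧ digit c q' = 2 ∧ (pos' (b q') = 0 ∨ pos' (b q) = 0) := by
        constructor
        · rintro ⟨u, hu, hu', ha⟩
          rcases hF'mem.mp hu' with h | ⟨h, h'⟩
          · exact .inl ⟨u, hu, h, ha⟩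
          · obtain ⟨q', hq', rfl⟩ := mem_bagSet.mp h
            exact .inr ⟨q', hq', ha, (hcd2 q' hq').mpr hu,
              .inl ((hp'.eq_zero_iff (hbn q' hq')).mpr h')⟩
        · rintro (⟨u, hu, hu', ha⟩ | ⟨q', hq', ha, h2, h0⟩)
          · exact ⟨u, hu, hF'mem.mpr (.inl hu'), ha⟩
          · exact ⟨b q', (hcd2 q' hq').mp h2, hF'mem.mpr (.inr ⟨apply_mem_bagSet b hq',
              (hp'.eq_zero_iff (hbn q' hq')).mp (h0.resolve_right hne)⟩), ha⟩
      rw [updatedDigit, hcd q hq]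
      simp only [vertexState]
      clear * - hiff
      by_cases hs : b q ∈ S
      · simp [hs]
      by_cases hP : ∃ u ∈ S, u ∈ F ∧ Adj u (b q)
      · rw [if_pos (hiff.mpr (.inl hP))]
        simp [hs, hP]
      · simp only [hs, hP, if_false, true_and, hiff, false_or]
    -- A vertex of the bag that disappears is dominated by `S` from `F`, which gives digit 1, or
    -- from the bag, which `updatedDigit` takes into account because one end of that edge is being
    -- forgotten.
    have hok : ForgetOk Adj k b pos' c := by
      intro q hq h0
      have hb' := (hp'.eq_zero_iff (hbn q hq)).mp h0
      have hbF : b q ∈ F' := hF'mem.mpr (.inr ⟨apply_mem_bagSet b hq, hb'⟩)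
      rw [updatedDigit]
      split
      · omega
      next h =>
      intro h1
      have hbS : b q ∉ S := fun h => by rw [(hcd2 q hq).mpr h] at h1; omega
      obtain ⟨u, hu, ha⟩ := (hS (b q) (hbn q hq)).resolve_left hbS
      rcases Finset.mem_union.mp (hcl _ hbF u (hsymm _ _ ha)) with hu' | hu'
      · have := vertexState_eq_one.mpr ⟨hbS, u, hu, hu', ha⟩
        rw [← hcd q hq] at this
        omega
      · obtain ⟨q', hq', rfl⟩ := mem_bagSet.mp hu'
        exact h ⟨h1, q', hq', ha, (hcd2 q' hq').mpr hu, .inr h0⟩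
    rw [messageTable, if_neg]
    · refine (tableMin_le_apply _ _ (encode_lt (d := fun q => vertexState Adj S F (b q))
        fun _ _ => vertexState_lt ..)).trans ?_
      rw [← hc, if_pos]
      · have hcount : forgetCount k b pos' c = (S ∩ (bagSet k b \ bagSet k' b')).card := by
          rw [forgetCount, ← Finset.card_filter]
          rw [← Finset.card_image_of_injOn (f := b)]
          · congr 1
            ext v
            simp only [Finset.mem_image, Finset.mem_filter, Finset.mem_range, Finset.mem_inter,
              Finset.mem_sdiff]
            constructor
            · rintro ⟨q, ⟨hq, h0, h2⟩, rfl⟩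
              exact ⟨(hcd2 q hq).mp h2, apply_mem_bagSet b hq,
                (hp'.eq_zero_iff (hbn q hq)).mp h0⟩
            · rintro ⟨hv, h, h'⟩
              obtain ⟨q, hq, rfl⟩ := mem_bagSet.mp h
              exact ⟨q, ⟨hq, (hp'.eq_zero_iff (hbn q hq)).mpr h', (hcd2 q hq).mpr hv⟩, rfl⟩
          · intro q hq q' hq' e
            simp only [Finset.coe_filter, Finset.mem_range, Set.mem_ofPred_eq] at hq hq'
            have h1 := hp.1 q hq.1
            rw [e, hp.1 q' hq'.1] at h1
            omega
        have hFF : S ∩ F' = (S ∩ F) ∪ (S ∩ (bagSet k b \ bagSet k' b')) := by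
          ext v
          simp only [Finset.mem_inter, Finset.mem_union, hF'mem, Finset.mem_sdiff]
          tauto
        rw [hcount, hFF, Finset.card_union_of_disjoint]
        · exact Nat.add_le_add_right hA.complete _
        · exact (hFb.mono_right Finset.sdiff_subset).mono Finset.inter_subset_right
            Finset.inter_subset_right
      · refine ⟨hok, encode_congr fun q hq => ?_⟩
        by_cases h0 : pos (b' q) = 0
        · rw [if_pos h0, if_pos h0]
        · obtain ⟨l, e⟩ := hp.2 _ (hbn' q hq) h0
          rw [if_neg h0, if_neg h0, hd q hq, hupd _ (by omega), e]
          rw [e]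
          exact apply_mem_bagSet b' hq
    -- A vertex absent from the child's bag cannot be in state 1: a forgotten neighbour would, by
    -- `hcl`, force it into `F` or that bag.
    · rintro ⟨q, hq, h0, h1⟩
      rw [hd q hq, vertexState_eq_one] at h1
      obtain ⟨-, u, -, hu, ha⟩ := h1
      rcases Finset.mem_union.mp (hcl u hu _ ha) with h | h
      · exact Finset.disjoint_left.mp hFb' h (apply_mem_bagSet b' hq)
      · exact (hp.eq_zero_iff (hbn' q hq)).mp h0 h

end

/-! ### Processing the nodes of a rooted tree decomposition -/

/-- A tree decomposition with nodes `0, …, N - 1`, rooted at an additional node `N` with an empty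
bag: `par` is the parent function, `rank` decreases towards the root, `k` and `b` give the sizes
and the members of the bags, and `top v` is the node closest to the root whose bag contains
`v`. -/
structure RootedDecomposition (Adj : ℕ → ℕ → Prop) (n N : ℕ) (k : ℕ → ℕ) (b : ℕ → ℕ → ℕ)
    (par rank top : ℕ → ℕ) : Prop where
  symm : ∀ u v, Adj u v → Adj v u
  bag_lt : ∀ i ≤ N, ∀ q < k i, b i q < n
  bag_inj : ∀ i ≤ N, Set.InjOn (b i) (Set.Iio (k i))
  size_root : k N = 0
  par_le : ∀ i < N, par i ≤ N
  rank_par : ∀ i < N, rank (par i) < rank i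
  rank_root : rank N = 0
  rank_le : ∀ i ≤ N, rank i ≤ N
  rank_inj : Set.InjOn rank (Set.Iic N)
  top_lt : ∀ v < n, top v < N
  mem_top : ∀ v < n, v ∈ bagSet (k (top v)) (b (top v))
  eq_top : ∀ i < N, ∀ v, v ∈ bagSet (k i) (b i) → v ∉ bagSet (k (par i)) (b (par i)) → i = top v
  edge : ∀ u v, Adj u v → ∃ i < N, u ∈ bagSet (k i) (b i) ∧ v ∈ bagSet (k i) (b i)

/-- The node at which the vertex `v` is located after the first `t` nodes of `node` have been
processed: processing a node moves everything to its parent. -/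
def location (par top node : ℕ → ℕ) (v : ℕ) : ℕ → ℕ
  | 0 => top v
  | t + 1 => if location par top node v t = node t then par (node t)
      else location par top node v t

/-- The vertices that have been forgotten below the node `j` after `t` nodes have been
processed. -/
def forgotten (n : ℕ) (k : ℕ → ℕ) (b : ℕ → ℕ → ℕ) (par top node : ℕ → ℕ) (t j : ℕ) : Finset ℕ :=
  (Finset.range n).filter fun v => location par top node v t = j ∧ v ∉ bagSet (k j) (b j)

namespace RootedDecomposition

variable {Adj : ℕ → ℕ → Prop} {n N : ℕ} {k : ℕ → ℕ} {b : ℕ → ℕ → ℕ} {par rank top : ℕ → ℕ}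
  {node : ℕ → ℕ}

theorem lt_of_mem (h : RootedDecomposition Adj n N k b par rank top) {j v : ℕ} (hj : j ≤ N)
    (hv : v ∈ bagSet (k j) (b j)) : v < n := by
  obtain ⟨q, hq, rfl⟩ := mem_bagSet.mp hv
  exact h.bag_lt j hj q hq

theorem not_mem_root (h : RootedDecomposition Adj n N k b par rank top) (v : ℕ) :
    v ∉ bagSet (k N) (b N) := by
  simp [bagSet, h.size_root]

/-- Climb from `j` to its ancestors while their bags contain `v`; the last such node is `top v` by
`eq_top`, and ranks decrease on the way. -/
theorem rank_top_le (h : RootedDecomposition Adj n N k b par rank top) {j v : ℕ} (hj : j ≤ N)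
    (hv : v ∈ bagSet (k j) (b j)) : rank (top v) ≤ rank j := by
  induction hr : rank j using Nat.strong_induction_on generalizing j with
  | _ r ih =>
    have hjN : j < N := lt_of_le_of_ne hj fun e => h.not_mem_root v (e ▸ hv)
    by_cases hp : v ∈ bagSet (k (par j)) (b (par j))
    · have := h.rank_par j hjN
      exact (ih _ (hr ▸ this) (h.par_le j hjN) hp rfl).trans (hr ▸ this.le)
    · rw [← h.eq_top j hjN v hv hp, hr]

/-- Nodes are processed in order of decreasing rank, so a vertex leaving the node of rank `N - t`
moves to a smaller rank, and no other vertex sits at that node. -/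
theorem location_le (h : RootedDecomposition Adj n N k b par rank top)
    (hnode : ∀ t < N, node t < N ∧ rank (node t) = N - t) {v t : ℕ} (hv : v < n) (ht : t ≤ N) :
    location par top node v t ≤ N ∧ rank (location par top node v t) ≤ N - t := by
  induction t with
  | zero => exact ⟨(h.top_lt v hv).le, h.rank_le _ (h.top_lt v hv).le⟩
  | succ t ih =>
    obtain ⟨h1, h2⟩ := ih (by omega)
    obtain ⟨h3, h4⟩ := hnode t (by omega)
    rw [location]
    split
    next => exact ⟨h.par_le _ h3, by have := h.rank_par _ h3; omega⟩
    next hne =>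
      refine ⟨h1, ?_⟩
      have : rank (location par top node v t) ≠ rank (node t) := fun e =>
        hne (h.rank_inj h1 h3.le e)
      omega

theorem location_eq_top (_h : RootedDecomposition Adj n N k b par rank top)
    (hnode : ∀ t < N, node t < N ∧ rank (node t) = N - t) {v t : ℕ} (ht : t ≤ N)
    (hr : rank (top v) ≤ N - t) : location par top node v t = top v := by
  induction t with
  | zero => rfl
  | succ t ih =>
    obtain ⟨h3, h4⟩ := hnode t (by omega)
    rw [location, ih (by omega) (by omega), if_neg]
    intro e
    rw [e] at hr
    omega

theorem location_eq_top_of_mem (h : RootedDecomposition Adj n N k b par rank top)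
    (hnode : ∀ t < N, node t < N ∧ rank (node t) = N - t) {v t j : ℕ} (ht : t ≤ N) (hj : j ≤ N)
    (hv : v ∈ bagSet (k j) (b j)) (hr : rank j ≤ N - t) : location par top node v t = top v :=
  h.location_eq_top hnode ht ((h.rank_top_le hj hv).trans hr)

/-- Start with a bag that contains both ends. When that node is processed, its parent takes over: an
end located at the node moves along, and an end that is only in its bag must be in the parent's bag
too, since otherwise the node would be its top and hence its location. -/
theorem edge_location (h : RootedDecomposition Adj n N k b par rank top)
    (hnode : ∀ t < N, node t < N ∧ rank (node t) = N - t) {u v t : ℕ} (ht : t ≤ N)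
    (huv : Adj u v) : ∃ j ≤ N, rank j ≤ N - t ∧
      (location par top node u t = j ∨ u ∈ bagSet (k j) (b j)) ∧
      (location par top node v t = j ∨ v ∈ bagSet (k j) (b j)) := by
  induction t with
  | zero =>
    obtain ⟨i, hi, hu, hv⟩ := h.edge u v huv
    exact ⟨i, hi.le, h.rank_le i hi.le, .inr hu, .inr hv⟩
  | succ t ih =>
    obtain ⟨j, hj, hr, hu, hv⟩ := ih (by omega)
    obtain ⟨h3, h4⟩ := hnode t (by omega)
    by_cases hjt : j = node t
    · subst hjt
      have key (w : ℕ) (hw : location par top node w t = node t ∨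
          w ∈ bagSet (k (node t)) (b (node t))) : location par top node w (t + 1) = par (node t) ∨
            w ∈ bagSet (k (par (node t))) (b (par (node t))) := by
        rw [location]
        by_cases hw' : location par top node w t = node t
        · rw [if_pos hw']; exact .inl rfl
        · right
          by_contra hp
          have hw := hw.resolve_left hw'
          rw [h.location_eq_top_of_mem hnode (by omega) hj hw hr] at hw'
          exact hw' (h.eq_top _ h3 w hw hp).symm
      exact ⟨par (node t), h.par_le _ h3, by have := h.rank_par _ h3; omega, key u hu, key v hv⟩
    · have hne : rank j ≠ rank (node t) := fun e => hjt (h.rank_inj hj h3.le e)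
      have key (w : ℕ) (hw : location par top node w t = j) :
          location par top node w (t + 1) = j := by
        rw [location, if_neg (by rw [hw]; exact hjt), hw]
      exact ⟨j, hj, by omega, hu.imp_left (key u), hv.imp_left (key v)⟩

theorem mem_forgotten {t j v : ℕ} : v ∈ forgotten n k b par top node t j ↔
      v < n ∧ location par top node v t = j ∧ v ∉ bagSet (k j) (b j) := by
  simp [forgotten]

theorem disjoint_forgotten (t j : ℕ) :
    Disjoint (forgotten n k b par top node t j) (bagSet (k j) (b j)) :=
  Finset.disjoint_left.mpr fun _ hv => (mem_forgotten.mp hv).2.2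

/-- Neighbours of vertices located at `j` and not visible above are located at `j` or in its
bag. -/
theorem mem_of_adj (h : RootedDecomposition Adj n N k b par rank top)
    (hlt : ∀ u v, Adj u v → v < n)
    (hnode : ∀ t < N, node t < N ∧ rank (node t) = N - t) {t j v u : ℕ} (ht : t ≤ N)
    (hv : location par top node v t = j)
    (hj : ∀ i ≤ N, rank i ≤ N - t → v ∈ bagSet (k i) (b i) → i = j) (ha : Adj v u) :
    u ∈ forgotten n k b par top node t j ∪ bagSet (k j) (b j) := by
  obtain ⟨i, hi, hr, hv', hu⟩ := h.edge_location hnode ht ha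
  have hij : i = j := hv'.elim (fun e => e.symm.trans hv) (hj i hi hr)
  subst hij
  rw [Finset.mem_union, mem_forgotten]
  by_cases hub : u ∈ bagSet (k i) (b i)
  · exact .inr hub
  · exact .inl ⟨hlt v u ha, hu.resolve_right hub, hub⟩

theorem forgotten_closed (h : RootedDecomposition Adj n N k b par rank top)
    (hlt : ∀ u v, Adj u v → v < n)
    (hnode : ∀ t < N, node t < N ∧ rank (node t) = N - t) {t j v u : ℕ} (ht : t ≤ N)
    (hv : v ∈ forgotten n k b par top node t j) (ha : Adj v u) :
    u ∈ forgotten n k b par top node t j ∪ bagSet (k j) (b j) := by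
  obtain ⟨hvn, hloc, hvb⟩ := mem_forgotten.mp hv
  refine h.mem_of_adj hlt hnode ht hloc (fun i hi hr hvi => ?_) ha
  have := h.location_eq_top_of_mem hnode ht hi hvi hr
  rw [hloc] at this
  exact (hvb (this ▸ h.mem_top v hvn)).elim

/-- Vertices of the bag that the parent lacks have their top, and so their location, at the
processed node. This describes in terms of `location` what the message moves to the parent. -/
theorem mem_passed (h : RootedDecomposition Adj n N k b par rank top)
    (hnode : ∀ t < N, node t < N ∧ rank (node t) = N - t) {t : ℕ} (ht : t < N)
    {v : ℕ} :
    v ∈ (forgotten n k b par top node t (node t) ∪ bagSet (k (node t)) (b (node t))) \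
      bagSet (k (par (node t))) (b (par (node t))) ↔
    v < n ∧ location par top node v t = node t ∧
      v ∉ bagSet (k (par (node t))) (b (par (node t))) := by
  obtain ⟨h3, h4⟩ := hnode t ht
  rw [Finset.mem_sdiff, Finset.mem_union, mem_forgotten]
  constructor
  · rintro ⟨⟨h1, h2, -⟩ | hv, hvp⟩
    · exact ⟨h1, h2, hvp⟩
    · refine ⟨h.lt_of_mem h3.le hv, ?_, hvp⟩
      rw [h.location_eq_top_of_mem hnode ht.le h3.le hv h4.le]
      exact (h.eq_top _ h3 v hv hvp).symm
  · rintro ⟨h1, h2, hvp⟩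
    by_cases hv : v ∈ bagSet (k (node t)) (b (node t))
    · exact ⟨.inr hv, hvp⟩
    · exact ⟨.inl ⟨h1, h2, hv⟩, hvp⟩

theorem passed_closed (h : RootedDecomposition Adj n N k b par rank top)
    (hnode : ∀ t < N, node t < N ∧ rank (node t) = N - t) {t : ℕ} (ht : t < N)
    (hlt : ∀ u v, Adj u v → v < n) {v u : ℕ}
    (hv : v ∈ (forgotten n k b par top node t (node t) ∪ bagSet (k (node t)) (b (node t))) \
      bagSet (k (par (node t))) (b (par (node t)))) (ha : Adj v u) :
    u ∈ forgotten n k b par top node t (node t) ∪ bagSet (k (node t)) (b (node t)) := by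
  obtain ⟨h3, h4⟩ := hnode t ht
  obtain ⟨hvn, hloc, hvp⟩ := (h.mem_passed hnode ht).mp hv
  refine h.mem_of_adj hlt hnode ht.le hloc (fun i hi hr hvi => ?_) ha
  have h1 := h.location_eq_top_of_mem hnode ht.le hi hvi hr
  have h2 := h.rank_top_le hi hvi
  rw [← h1, hloc] at h2
  exact h.rank_inj hi h3.le (by omega)

/-- A vertex of the parent's bag is still located at its top, whose rank is at most that of the
parent. -/
theorem disjoint_forgotten_par (h : RootedDecomposition Adj n N k b par rank top)
    (hnode : ∀ t < N, node t < N ∧ rank (node t) = N - t) {t : ℕ} (ht : t < N)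
    :
    Disjoint (forgotten n k b par top node t (node t))
      (bagSet (k (par (node t))) (b (par (node t)))) := by
  obtain ⟨h3, h4⟩ := hnode t ht
  refine Finset.disjoint_left.mpr fun v hv hvp => ?_
  obtain ⟨hvn, hloc, hvb⟩ := mem_forgotten.mp hv
  have hr := h.rank_par _ h3
  have h1 := h.location_eq_top_of_mem hnode ht.le (h.par_le _ h3) hvp (by omega)
  have h2 := h.rank_top_le (h.par_le _ h3) hvp
  rw [← h1, hloc] at h2
  omega

theorem disjoint_passed (h : RootedDecomposition Adj n N k b par rank top)
    (hnode : ∀ t < N, node t < N ∧ rank (node t) = N - t) {t : ℕ} (ht : t < N)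
    :
    Disjoint (forgotten n k b par top node t (par (node t)))
      ((forgotten n k b par top node t (node t) ∪ bagSet (k (node t)) (b (node t))) \
        bagSet (k (par (node t))) (b (par (node t)))) := by
  obtain ⟨h3, h4⟩ := hnode t ht
  have hr := h.rank_par _ h3
  refine Finset.disjoint_left.mpr fun v hv hv' => ?_
  have h1 := (mem_forgotten.mp hv).2.1
  have h2 := ((h.mem_passed hnode ht).mp hv').2.1
  rw [h1] at h2
  rw [h2] at hr
  omega

theorem forgotten_succ_par (h : RootedDecomposition Adj n N k b par rank top)
    (hnode : ∀ t < N, node t < N ∧ rank (node t) = N - t) {t : ℕ} (ht : t < N)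
    :
    forgotten n k b par top node (t + 1) (par (node t)) =
      forgotten n k b par top node t (par (node t)) ∪
        ((forgotten n k b par top node t (node t) ∪ bagSet (k (node t)) (b (node t))) \
          bagSet (k (par (node t))) (b (par (node t)))) := by
  ext v
  rw [Finset.mem_union, h.mem_passed hnode ht, mem_forgotten, mem_forgotten, location]
  split
  next e => simp only [e, true_and]; tauto
  next e => simp [e]

theorem forgotten_succ_of_ne {t : ℕ} {j : ℕ} (hj : j ≠ par (node t)) (hj' : j ≠ node t) :
    forgotten n k b par top node (t + 1) j = forgotten n k b par top node t j := by
  ext v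
  rw [mem_forgotten, mem_forgotten, location]
  split
  next e => simp [e, hj.symm, hj'.symm]
  next e => rfl

/-- Processing one node keeps the tables correct. -/
theorem isTable_step (h : RootedDecomposition Adj n N k b par rank top)
    (hnode : ∀ t < N, node t < N ∧ rank (node t) = N - t) {t : ℕ} (ht : t < N)
    [DecidableRel Adj]
    {S : Finset ℕ} {T : ℕ → ℕ → ℕ} {pos : ℕ → ℕ → ℕ}
    (hlt : ∀ u v, Adj u v → v < n) (hS : Dominates Adj n S)
    (hmin : ∀ D, Dominates Adj n D → S.card ≤ D.card) (hSn : S.card ≤ n)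
    (hpos : ∀ i ≤ N, IsPosition n (k i) (b i) (pos i))
    (hi : IsTable Adj n S (k (node t)) (b (node t)) (forgotten n k b par top node t (node t))
      (T (node t)))
    (hp : IsTable Adj n S (k (par (node t))) (b (par (node t)))
      (forgotten n k b par top node t (par (node t))) (T (par (node t)))) :
    IsTable Adj n S (k (par (node t))) (b (par (node t)))
      (forgotten n k b par top node (t + 1) (par (node t)))
      (joinTable (k (par (node t))) (n + 1) (T (par (node t)))
        (messageTable Adj (k (node t)) (k (par (node t))) (b (node t)) (b (par (node t)))
          (pos (node t)) (pos (par (node t))) (n + 1) (T (node t)))) := by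
  obtain ⟨h3, h4⟩ := hnode t ht
  have hm := hi.message hS h.symm (hpos _ h3.le) (hpos _ (h.par_le _ h3)) (h.bag_lt _ h3.le)
    (h.bag_lt _ (h.par_le _ h3)) (disjoint_forgotten ..) (h.disjoint_forgotten_par hnode ht)
    fun v hv u ha => h.passed_closed hnode ht hlt hv ha
  rw [h.forgotten_succ_par hnode ht]
  refine hp.join hS hmin hSn hm (fun v hv u ha => h.forgotten_closed hlt hnode ht.le hv ha)
    (fun v hv u ha => ?_) (h.disjoint_passed hnode ht) (disjoint_forgotten ..)
    Finset.sdiff_disjoint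
  have := h.passed_closed hnode ht hlt hv ha
  by_cases hu : u ∈ bagSet (k (par (node t))) (b (par (node t)))
  · exact Finset.mem_union_right _ hu
  · exact Finset.mem_union_left _ (Finset.mem_sdiff.mpr ⟨this, hu⟩)

theorem forgotten_zero (h : RootedDecomposition Adj n N k b par rank top) (j : ℕ) :
    forgotten n k b par top node 0 j = ∅ := by
  ext v
  simp only [mem_forgotten, Finset.notMem_empty, iff_false, location]
  rintro ⟨h1, rfl, h2⟩
  exact h2 (h.mem_top v h1)

/-- After `N` steps every location has rank 0, so it is the virtual root, whose empty bag leaves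
every vertex forgotten. -/
theorem forgotten_root (h : RootedDecomposition Adj n N k b par rank top)
    (hnode : ∀ t < N, node t < N ∧ rank (node t) = N - t) :
    forgotten n k b par top node N N = Finset.range n := by
  ext v
  rw [mem_forgotten, Finset.mem_range]
  refine ⟨fun h => h.1, fun hv => ⟨hv, ?_, h.not_mem_root v⟩⟩
  obtain ⟨h1, h2⟩ := h.location_le hnode hv le_rfl
  exact h.rank_inj h1 (le_refl N) (by rw [h.rank_root]; omega)

end RootedDecomposition

/-- With an empty bag and all vertices forgotten, a partial solution is a dominating set, so
soundness bounds the only entry from below by minimality of `S`. -/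
theorem IsTable.eq_card {Adj : ℕ → ℕ → Prop} {n : ℕ} {S : Finset ℕ} {b A : ℕ → ℕ}
    (hmin : ∀ D, Dominates Adj n D → S.card ≤ D.card) (hSn : S.card ≤ n)
    (h : IsTable Adj n S 0 b (Finset.range n) A) : A 0 = S.card := by
  have h1 : A 0 ≤ S.card := h.complete.trans (Finset.card_le_card Finset.inter_subset_left)
  obtain ⟨D, hD, hcard, -, -, hdom⟩ := h.sound 0 (by simp) (by omega)
  have hDn : D ∩ Finset.range n = D := Finset.inter_eq_left.mpr (by simpa [bagSet] using hD)
  rw [hDn] at hcard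
  exact le_antisymm h1 ((hmin D fun v hv => hdom v (Finset.mem_range.mpr hv)).trans hcard)

/-- The recursion followed by the loop in `digitProg`. Testing the current digit instead of the
original one makes no difference: once it is 1, it stays 1. -/
theorem updatedDigit_succ {Adj : ℕ → ℕ → Prop} [DecidableRel Adj] {b pos' : ℕ → ℕ} (j c q : ℕ) :
    updatedDigit Adj (j + 1) b pos' c q = if updatedDigit Adj j b pos' c q = 0 ∧
      Adj (b j) (b q) ∧ digit c j = 2 ∧ (pos' (b j) = 0 ∨ pos' (b q) = 0) then 1
    else updatedDigit Adj j b pos' c q := by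
  simp only [updatedDigit, Nat.exists_lt_succ_right]
  by_cases h0 : digit c q = 0
  · by_cases hE : ∃ q' < j, Adj (b q') (b q) ∧ digit c q' = 2 ∧
      (pos' (b q') = 0 ∨ pos' (b q) = 0)
    · simp [h0, hE]
    · simp [h0, hE]
  · simp [h0]

/-! ### Programs for forgetting and introducing vertices -/

namespace RAM
open RAM.Expr (reg)

/-- The data that the main loop works on: the numbers of vertices and of nodes, a bound for the
sizes of the bags, the bags as offsets and entries, the graph and the positions of the vertices
in the bags. -/
structure Layout where
  n : ℕ
  N : ℕ
  K : ℕ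
  off : ℕ → ℕ
  ent : ℕ → ℕ
  Adj : ℕ → ℕ → Prop
  dec : DecidableRel Adj
  pos : ℕ → ℕ → ℕ

namespace Layout

instance (d : Layout) : DecidableRel d.Adj := d.dec

/-- The size of the bag of a node. -/
def size (d : Layout) (i : ℕ) : ℕ := d.off (i + 1) - d.off i

/-- The members of the bag of a node. -/
def bag (d : Layout) (i q : ℕ) : ℕ := d.ent (d.off i + q)

/-- The data are consistent, and small compared with `W`. -/
structure Valid (d : Layout) (W : ℕ) : Prop where
  size_le : ∀ i ≤ d.N, d.size i ≤ d.K
  bag_lt : ∀ i ≤ d.N, ∀ q < d.size i, d.bag i q < d.n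
  isPosition : ∀ i ≤ d.N, IsPosition d.n (d.size i) (d.bag i) (d.pos i)
  nine_pow_lt : 9 ^ d.K < W
  add_lt : d.n + d.N + d.K + 2 < W
  off_lt : ∀ i, d.off i < W

theorem Valid.three_pow_lt {d : Layout} {W : ℕ} (h : d.Valid W) {k : ℕ} (hk : k ≤ d.K) :
    3 ^ k < W :=
  lt_of_le_of_lt ((Nat.pow_le_pow_left (by norm_num) k).trans
    (Nat.pow_le_pow_right (by norm_num) hk)) h.nine_pow_lt

theorem Valid.pos_le {d : Layout} {W : ℕ} (h : d.Valid W) {i v : ℕ} (hi : i ≤ d.N)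
    (hv : v < d.n) : d.pos i v ≤ d.size i := by
  by_cases h0 : d.pos i v = 0
  · omega
  · exact ((h.isPosition i hi).2 v hv h0).1

/-- The memory contains the data. -/
structure Context (d : Layout) (s : State) : Prop where
  n : s.reg rn = d.n
  N : s.reg rN = d.N
  Np : s.reg rNp = d.N + 1
  S : s.reg rS = 3 ^ d.K
  inf : s.reg rInf = d.n + 1
  off : s.arr 4 = d.off
  ent : s.arr 5 = d.ent
  pow : ∀ j ≤ d.K, s.arr aPow j = 3 ^ j
  pos : ∀ i ≤ d.N, ∀ v < d.n, s.arr aPos (i * d.n + v) = d.pos i v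
  adj : ∀ u < d.n, ∀ v < d.n, s.arr aAdj (u * d.n + v) = if d.Adj u v then 1 else 0

theorem Context.agree {d : Layout} {s s' : State} {q : Prog} (h : d.Context s) (hA : Agree q s s')
    (hq : (q.keepsReg rn && q.keepsReg rN && q.keepsReg rNp && q.keepsReg rS && q.keepsReg rInf &&
      q.keepsArr 4 && q.keepsArr 5 && q.keepsArr aPow && q.keepsArr aPos && q.keepsArr aAdj) =
        true) : d.Context s' := by
  simp only [Bool.and_eq_true] at hq
  obtain ⟨⟨⟨⟨⟨⟨⟨⟨⟨h1, h2⟩, h3⟩, h4⟩, h5⟩, h6⟩, h7⟩, h8⟩, h9⟩, h10⟩ := hq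
  constructor
  · rw [hA.reg _ h1, h.n]
  · rw [hA.reg _ h2, h.N]
  · rw [hA.reg _ h3, h.Np]
  · rw [hA.reg _ h4, h.S]
  · rw [hA.reg _ h5, h.inf]
  · rw [hA.arr _ h6, h.off]
  · rw [hA.arr _ h7, h.ent]
  · rw [hA.arr _ h8]; exact h.pow
  · rw [hA.arr _ h9]; exact h.pos
  · rw [hA.arr _ h10]; exact h.adj

/-- The memory contains the data, and the registers for the current node and its parent are
set. -/
structure NodeContext (d : Layout) (i p : ℕ) (s : State) : Prop extends d.Context s where
  node : s.reg rI = i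
  parent : s.reg rP = p
  ki : s.reg rKi = d.size i
  kp : s.reg rKp = d.size p
  bi : s.reg rBi = d.off i
  bp : s.reg rBp = d.off p
  li : s.reg rLi = 3 ^ d.size i
  lp : s.reg rLp = 3 ^ d.size p

theorem NodeContext.agree {d : Layout} {i p : ℕ} {s s' : State} {q : Prog}
    (h : d.NodeContext i p s) (hA : Agree q s s')
    (hq : (q.keepsReg rn && q.keepsReg rN && q.keepsReg rNp && q.keepsReg rS && q.keepsReg rInf &&
      q.keepsArr 4 && q.keepsArr 5 && q.keepsArr aPow && q.keepsArr aPos && q.keepsArr aAdj) =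
        true)
    (hq' : (q.keepsReg rI && q.keepsReg rP && q.keepsReg rKi && q.keepsReg rKp &&
      q.keepsReg rBi && q.keepsReg rBp && q.keepsReg rLi && q.keepsReg rLp) = true) :
    d.NodeContext i p s' := by
  refine ⟨h.toContext.agree hA hq, ?_, ?_, ?_, ?_, ?_, ?_, ?_, ?_⟩
  all_goals simp only [Bool.and_eq_true] at hq'
  · rw [hA.reg _ hq'.1.1.1.1.1.1.1, h.node]
  · rw [hA.reg _ hq'.1.1.1.1.1.1.2, h.parent]
  · rw [hA.reg _ hq'.1.1.1.1.1.2, h.ki]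
  · rw [hA.reg _ hq'.1.1.1.1.2, h.kp]
  · rw [hA.reg _ hq'.1.1.1.2, h.bi]
  · rw [hA.reg _ hq'.1.1.2, h.bp]
  · rw [hA.reg _ hq'.1.2, h.li]
  · rw [hA.reg _ hq'.2, h.lp]

end Layout

/-- Fill the array of the restricted table with the infinite value. -/
def clearProg : Prog := .forTo rC rLp (.setArr aPre (reg rC) (reg rInf))

theorem runs_clearProg {W : ℕ} {d : Layout} {i p : ℕ} {s : State} (hd : d.Valid W)
    (h : d.NodeContext i p s) (hp : p ≤ d.N) :
    Runs W clearProg s (3 ^ d.size p * 12 + 6)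
      fun s' => ∀ r < 3 ^ d.size p, s'.arr aPre r = d.n + 1 := by
  refine .forTo (fun j s' => ∀ r < j, s'.arr aPre r = d.n + 1) 4 h.lp
    (hd.three_pow_lt (hd.size_le p hp)) rfl rfl (by simp) ?_ (by omega) fun _ _ h => h
  intro j hj s₁ hA₁ hi hI
  have h₁ := h.agree hA₁ rfl rfl
  refine .of_wp_le rfl ?_
  simp only [Prog.wp, Expr.val_reg, hi, h₁.inf]
  refine ⟨by have := hd.add_lt; omega, fun r hr => ?_⟩
  simp only [State.setReg_arr, State.setArr_arr, if_true, Function.update_apply]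
  split
  next h => rfl
  next h => exact hI r (by omega)

/-- Compute the updated digit at a position. -/
def digitProg : Prog :=
  .forTo rJ rKi (rU ≔ 5⟦reg rBi + reg rJ⟧ ;;
    .ite ((reg rD ≐ 0) * aAdj⟦reg rU * reg rn + reg rV⟧ * (reg rC / aPow⟦reg rJ⟧ % 3 ≐ 2) *
      ((aPos⟦reg rP * reg rn + reg rU⟧ ≐ 0) + reg rF)) (rD ≔ 1) .skip)

/-- Conjunction is coded as a product and disjunction as a sum; register `rF` holds whether the
vertex at position `q` is itself being forgotten. -/
theorem runs_digitProg {W : ℕ} {d : Layout} {i p c q : ℕ} {s : State} (hd : d.Valid W)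
    (h : d.NodeContext i p s) (hi : i ≤ d.N) (hp : p ≤ d.N) (hc : s.reg rC = c)
    (hq : q < d.size i) (hv : s.reg rV = d.bag i q) (hD : s.reg rD = digit c q)
    (hF : s.reg rF = if d.pos p (d.bag i q) = 0 then 1 else 0) :
    Runs W digitProg s (d.K * 60 + 6)
      fun s' => s'.reg rD = updatedDigit d.Adj (d.size i) (d.bag i) (d.pos p) c q := by
  have hkK := hd.size_le i hi
  have hvn := hd.bag_lt i hi q hq
  refine .forTo (fun j s' => s'.reg rD =
    updatedDigit d.Adj j (d.bag i) (d.pos p) c q) 52 h.ki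
    (by have := hd.add_lt; omega) rfl rfl (by simp [updatedDigit, hD]) ?_
    (Nat.add_le_add_right (Nat.mul_le_mul_right _ hkK) _) fun _ _ h => h
  intro j hj s₁ hA₁ hi₁ hI
  have h₁ := h.agree hA₁ rfl rfl
  have hun := hd.bag_lt i hi j hj
  have e1 : s₁.reg rC = c := by rw [hA₁.reg _ rfl, hc]
  have e2 : s₁.reg rV = d.bag i q := by rw [hA₁.reg _ rfl, hv]
  have e3 : s₁.reg rF = if d.pos p (d.bag i q) = 0 then 1 else 0 := by rw [hA₁.reg _ rfl, hF]
  have e4 : d.ent (d.off i + j) = d.bag i j := rfl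
  refine .of_wp_le rfl ?_
  have hdig : c / 3 ^ j % 3 = digit c j := rfl
  have hW := hd.add_lt
  simp [hi₁, h₁.bi, h₁.ent, e1, e2, e3, e4, h₁.n, h₁.parent, h₁.pow j (by omega),
    h₁.adj _ hun _ hvn, h₁.pos _ hp _ hun, hdig]
  rw [hI, updatedDigit_succ]
  refine ⟨by omega, fun h2 ha h0 hz => ⟨by omega, ?_⟩, fun hn => ?_⟩
  · rw [if_pos ⟨h0, ha, h2, by tauto⟩]
  · rw [if_neg]
    rintro ⟨h0, ha, h2, hz⟩
    have := hn h2 ha h0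
    tauto

/-- Compute the updated digits of an entry, its value, and whether it survives. -/
def digitsProg : Prog :=
  .forTo rQ rKi (
    (rV ≔ 5⟦reg rBi + reg rQ⟧ ;; rF ≔ (aPos⟦reg rP * reg rn + reg rV⟧ ≐ 0) ;;
      rD ≔ reg rC / aPow⟦reg rQ⟧ % 3) ;;
    digitProg ;;
    .setArr aDig (reg rQ) (reg rD) ;;
    .ite (reg rF) (.ite (reg rD) (.ite (reg rD ≐ 2) (rVal ≔ reg rVal + 1) .skip) (rBad ≔ 1))
      .skip)

/-- Comparing all pairs of bag vertices takes quadratic time per colouring, which is affordable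
because the join has the same order. The final digit 2 can be used for counting by
`updatedDigit_eq_two`. -/
theorem runs_digitsProg {W : ℕ} {d : Layout} {i p c a : ℕ} {s : State} (hd : d.Valid W)
    (h : d.NodeContext i p s) (hi : i ≤ d.N) (hp : p ≤ d.N) (hc : s.reg rC = c)
    (ha : s.reg rVal = a) (han : a ≤ d.n + 1) (hbad : s.reg rBad = 0) :
    Runs W digitsProg s (d.K * (d.K * 60 + 80) + 6) fun s' =>
      (∀ q < d.size i, s'.arr aDig q = updatedDigit d.Adj (d.size i) (d.bag i) (d.pos p) c q) ∧
      s'.reg rVal = a + forgetCount (d.size i) (d.bag i) (d.pos p) c ∧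
      (s'.reg rBad = 0 ↔ ForgetOk d.Adj (d.size i) (d.bag i) (d.pos p) c) := by
  have hkK := hd.size_le i hi
  have hW := hd.add_lt
  have hcount (j : ℕ) : forgetCount j (d.bag i) (d.pos p) c ≤ j :=
    (Finset.sum_le_card_nsmul _ _ 1 fun q _ => by split <;> omega).trans (by simp)
  refine .forTo (fun j s' =>
    (∀ q < j, s'.arr aDig q = updatedDigit d.Adj (d.size i) (d.bag i) (d.pos p) c q) ∧
      s'.reg rVal = a + forgetCount j (d.bag i) (d.pos p) c ∧
      (s'.reg rBad = 0 ↔ ∀ q < j, d.pos p (d.bag i q) = 0 →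
        updatedDigit d.Adj (d.size i) (d.bag i) (d.pos p) c q ≠ 0)) (d.K * 60 + 60) h.ki (by omega)
    rfl rfl (by simp [ha, hbad, forgetCount]) ?_
    (Nat.add_le_add_right (Nat.mul_le_mul hkK (by omega)) _) fun _ _ h => h
  intro q hq s₁ hA₁ hq₁ hI
  have h₁ := h.agree hA₁ rfl rfl
  have hvn := hd.bag_lt i hi q hq
  have e1 : s₁.reg rC = c := by rw [hA₁.reg _ rfl, hc]
  have e4 : d.ent (d.off i + q) = d.bag i q := rfl
  have hdig : c / 3 ^ q % 3 = digit c q := rfl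
  have hlt := digit_lt c q
  refine .seq (fun s' => s'.reg rV = d.bag i q ∧
    s'.reg rF = (if d.pos p (d.bag i q) = 0 then 1 else 0) ∧ s'.reg rD = digit c q) 25
    (d.K * 60 + 30) (by omega) (.of_wp_le rfl ?_) fun s₂ A₂ ⟨e₂, f₂, g₂⟩ => ?_
  · simp [hq₁, h₁.bi, h₁.ent, e4, h₁.n, h₁.parent, h₁.pow q (by omega), h₁.pos _ hp _ hvn, hdig,
      e1]
    refine ⟨by omega, ?_, by omega⟩
    split_ifs <;> omega
  have h₂ := h₁.agree A₂ rfl rfl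
  refine .seq _ (d.K * 60 + 6) 20 (by omega) (runs_digitProg hd h₂ hi hp
    (by rw [A₂.reg _ rfl, e1]) hq e₂ g₂ f₂) fun s₃ A₃ e₃ => ?_
  have hq₃ : s₃.reg rQ = q := by rw [A₃.reg _ rfl, A₂.reg _ rfl, hq₁]
  have f₃ : s₃.reg rF = if d.pos p (d.bag i q) = 0 then 1 else 0 := by rw [A₃.reg _ rfl, f₂]
  have v₃ : s₃.reg rVal = a + forgetCount q (d.bag i) (d.pos p) c := by
    rw [A₃.reg _ rfl, A₂.reg _ rfl, hI.2.1]
  have b₃ : s₃.reg rBad = s₁.reg rBad := by rw [A₃.reg _ rfl, A₂.reg _ rfl]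
  have d₃ : s₃.arr aDig = s₁.arr aDig := by rw [A₃.arr _ rfl, A₂.arr _ rfl]
  have hu := updatedDigit_lt (Adj := d.Adj) (k := d.size i) (b := d.bag i) (pos' := d.pos p) c q
  have hcq := hcount q
  have harr : ∀ q' < q + 1, Function.update (s₃.arr aDig) q
      (updatedDigit d.Adj (d.size i) (d.bag i) (d.pos p) c q) q' =
        updatedDigit d.Adj (d.size i) (d.bag i) (d.pos p) c q' := by
    intro q' hq'
    rw [Function.update_apply]
    split
    next h => rw [h]
    next h => rw [d₃]; exact hI.1 q' (by omega)
  have hfc : forgetCount (q + 1) (d.bag i) (d.pos p) c = forgetCount q (d.bag i) (d.pos p) c +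
      if d.pos p (d.bag i q) = 0 ∧ digit c q = 2 then 1 else 0 := Finset.sum_range_succ ..
  have hall (P : ℕ → Prop) : (∀ q' < q + 1, P q') ↔ (∀ q' < q, P q') ∧ P q :=
    Nat.forall_lt_succ_right
  simp only [← updatedDigit_eq_two (Adj := d.Adj) (k := d.size i) (b := d.bag i)
    (pos' := d.pos p)] at hfc
  refine .of_wp_le rfl ?_
  simp only [hfc, hall (fun q' => d.pos p (d.bag i q') = 0 → _)]
  simp only [Prog.wp, Expr.val_reg, hq₃, e₃, State.setArr_reg, f₃, Expr.val_add, Expr.val_ofNat,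
    Expr.val_op, Op.eval_eq, v₃, State.setReg_arr, State.setArr_arr, if_true, State.setReg_reg,
    b₃]
  refine ⟨by omega, ?_⟩
  have hb := hI.2.2
  by_cases hz : d.pos p (d.bag i q) = 0
  · by_cases hu0 : updatedDigit d.Adj (d.size i) (d.bag i) (d.pos p) c q = 0
    · rw [hu0] at harr
      simp [hz, hu0]
      exact ⟨by omega, fun q' h => harr q' (by omega)⟩
    · by_cases hu2 : updatedDigit d.Adj (d.size i) (d.bag i) (d.pos p) c q = 2
      · rw [hu2] at harr
        simp [hz, hu2]
        exact ⟨by omega, fun q' h => harr q' (by omega), by omega, hb⟩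
      · simp [hz, hu2, hu0]
        exact ⟨fun q' h => harr q' (by omega), hb⟩
  · simp [hz]
    exact ⟨fun q' h => harr q' (by omega), hb⟩

theorem encode_le_of_le {δ : ℕ → ℕ} {j k : ℕ} (h : j ≤ k) : encode δ j ≤ encode δ k := by
  induction k, h using Nat.le_induction with
  | base => exact le_rfl
  | succ k _ ih => exact ih.trans (Nat.le_add_right _ _)

/-- Encode the updated digits as a colouring of the bag of the parent. -/
def transferProg : Prog :=
  .forTo rQ rKp (
    rX ≔ aPos⟦reg rI * reg rn + 5⟦reg rBp + reg rQ⟧⟧ ;;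
    .ite (reg rX) (rRes ≔ reg rRes + aDig⟦reg rX - 1⟧ * aPow⟦reg rQ⟧) .skip)

theorem runs_transferProg {W : ℕ} {d : Layout} {i p : ℕ} {s : State} {δ : ℕ → ℕ} (hd : d.Valid W)
    (h : d.NodeContext i p s) (hi : i ≤ d.N) (hp : p ≤ d.N) (hres : s.reg rRes = 0)
    (hδ : ∀ q < d.size i, s.arr aDig q = δ q) (hδ3 : ∀ q, δ q < 3) :
    Runs W transferProg s (d.K * 40 + 6) fun s' =>
      s'.reg rRes = transfer (d.size p) (d.bag p) (d.pos i) δ := by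
  have hkK := hd.size_le p hp
  have hkK' := hd.size_le i hi
  have hW := hd.add_lt
  set e : ℕ → ℕ := fun q => if d.pos i (d.bag p q) = 0 then 0 else δ (d.pos i (d.bag p q) - 1)
    with he
  have hlt : encode e (d.size p) < W := lt_trans (encode_lt fun q _ => by
    rw [he]; dsimp only; split
    exacts [by omega, hδ3 _]) (hd.three_pow_lt hkK)
  refine .forTo (fun j s' => s'.reg rRes = encode e j) 32 h.kp (by omega) rfl rfl
    (by simp [hres, encode]) ?_ (Nat.add_le_add_right (Nat.mul_le_mul hkK (by omega)) _)
    fun _ _ h => h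
  intro q hq s₁ hA₁ hq₁ hI
  have h₁ := h.agree hA₁ rfl rfl
  have hvn := hd.bag_lt p hp q hq
  have e4 : d.ent (d.off p + q) = d.bag p q := rfl
  have hle := hd.pos_le hi hvn
  have e5 : d.pos i (d.bag p q) ≠ 0 →
      s₁.arr aDig (d.pos i (d.bag p q) - 1) = δ (d.pos i (d.bag p q) - 1) := fun h0 => by
    rw [hA₁.arr _ rfl]; exact hδ _ (by omega)
  have hlt' := (encode_le_of_le (δ := e) (show q + 1 ≤ d.size p by omega)).trans_lt hlt
  have hs : encode e (q + 1) = encode e q + e q * 3 ^ q := rfl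
  refine .of_wp_le rfl ?_
  by_cases h0 : d.pos i (d.bag p q) = 0
  · have e0 : e q = 0 := by simp [he, h0]
    simp [hq₁, h₁.bp, h₁.ent, e4, h₁.n, h₁.node, h₁.pow q (by omega), h₁.pos _ hi _ hvn, h0, hI,
      hs, e0]
    omega
  · have e0 : e q = δ (d.pos i (d.bag p q) - 1) := by simp [he, h0]
    rw [hs, e0] at hlt'
    simp [hq₁, h₁.bp, h₁.ent, e4, h₁.n, h₁.node, h₁.pow q (by omega), h₁.pos _ hi _ hvn, h0, hI,
      hs, e0, e5 h0]
    exact ⟨by omega, hlt'⟩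

/-- Forget vertices: compute the restricted table from the table of the current node. -/
def scatterProg : Prog :=
  .forTo rC rLi (
    (rBad ≔ 0 ;; rRes ≔ 0 ;; rVal ≔ aTab⟦reg rI * reg rS + reg rC⟧) ;;
    digitsProg ;;
    transferProg ;;
    .ite (reg rBad) .skip
      (.ite (reg rVal ≺ aPre⟦reg rRes⟧) (.setArr aPre (reg rRes) (reg rVal)) .skip))

/-- A colouring of the child's bag can contribute a finite value to a single restricted colouring
`r`. Hence one pass over `c`, updating one cell each time, computes the minima for all `r`. -/
theorem runs_scatterProg {W : ℕ} {d : Layout} {i p : ℕ} {s : State} {A : ℕ → ℕ} (hd : d.Valid W)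
    (h : d.NodeContext i p s) (hi : i ≤ d.N) (hp : p ≤ d.N)
    (hA : ∀ c < 3 ^ d.size i, s.arr aTab (i * 3 ^ d.K + c) = A c)
    (hAn : ∀ c < 3 ^ d.size i, A c ≤ d.n + 1)
    (hpre : ∀ r < 3 ^ d.size p, s.arr aPre r = d.n + 1) :
    Runs W scatterProg s (100 * ((d.K + 1) ^ 2 * 3 ^ d.K))
      fun s' => ∀ r < 3 ^ d.size p, s'.arr aPre r = forgetTable d.Adj (d.size i) (d.size p)
        (d.bag i) (d.bag p) (d.pos i) (d.pos p) (d.n + 1) A r := by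
  have hkK := hd.size_le i hi
  have hW := hd.add_lt
  have h3K : 3 ^ d.size i ≤ 3 ^ d.K := Nat.pow_le_pow_right (by norm_num) hkK
  have hpos : 0 < 3 ^ d.K := by positivity
  set T : ℕ → ℕ → ℕ := fun r c => if ForgetOk d.Adj (d.size i) (d.bag i) (d.pos p) c ∧
    transfer (d.size p) (d.bag p) (d.pos i)
      (updatedDigit d.Adj (d.size i) (d.bag i) (d.pos p) c) = r then
      A c + forgetCount (d.size i) (d.bag i) (d.pos p) c else d.n + 1 with hT
  refine .forTo (fun c s' => ∀ r < 3 ^ d.size p, s'.arr aPre r =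
    tableMin (d.n + 1) (T r) c) (d.K * (d.K * 60 + 80) + d.K * 40 + 44) h.li
    (hd.three_pow_lt hkK) rfl rfl hpre ?_
    ((Nat.add_le_add_right (Nat.mul_le_mul_right _ h3K) _).trans (by nlinarith)) fun _ _ h => h
  intro c hc s₁ hA₁ hi₁ hI
  have h₁ := h.agree hA₁ rfl rfl
  have e1 : s₁.arr aTab (i * 3 ^ d.K + c) = A c := by rw [hA₁.arr _ rfl]; exact hA c hc
  have hAc := hAn c hc
  refine .seq (fun s' => s'.reg rBad = 0 ∧ s'.reg rRes = 0 ∧ s'.reg rVal = A c) 12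
    (d.K * (d.K * 60 + 80) + d.K * 40 + 32) (by omega) (.of_wp_le rfl ?_)
    fun s₂ A₂ ⟨b₂, r₂, v₂⟩ => ?_
  · simp [hi₁, h₁.node, h₁.S, e1]
    omega
  have h₂ := h₁.agree A₂ rfl rfl
  refine .seq _ (d.K * (d.K * 60 + 80) + 6) (d.K * 40 + 26) (by omega)
    (runs_digitsProg (c := c) (a := A c) hd h₂ hi hp (by rw [A₂.reg _ rfl, hi₁]) v₂ hAc b₂)
    fun s₃ A₃ ⟨d₃, v₃, b₃⟩ => ?_
  have h₃ := h₂.agree A₃ rfl rfl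
  refine .seq _ (d.K * 40 + 6) 20 (by omega) (runs_transferProg hd h₃ hi hp
    (by rw [A₃.reg _ rfl, r₂]) d₃ fun q => updatedDigit_lt ..) fun s₄ A₄ r₄ => ?_
  have v₄ := (A₄.reg rVal rfl).trans v₃
  rw [← A₄.reg rBad rfl] at b₃
  have p₄ : s₄.arr aPre = s₁.arr aPre := by rw [A₄.arr _ rfl, A₃.arr _ rfl, A₂.arr _ rfl]
  set r₀ := transfer (d.size p) (d.bag p) (d.pos i)
    (updatedDigit d.Adj (d.size i) (d.bag i) (d.pos p) c) with hr₀
  have hr₀lt : r₀ < 3 ^ d.size p := encode_lt fun q _ => by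
    split
    exacts [by omega, updatedDigit_lt ..]
  have hle (r : ℕ) := tableMin_le (d.n + 1) (T r) c
  have hs (r : ℕ) : tableMin (d.n + 1) (T r) (c + 1) =
    min (tableMin (d.n + 1) (T r) c) (T r c) := rfl
  refine .of_wp_le rfl ?_
  simp only [Prog.wp, Expr.val_reg, Expr.val_op, Expr.val_get, Op.eval_lt, r₄, v₄, ne_eq]
  refine ⟨fun hb r hr => ?_, fun hb => ⟨fun hlt => ⟨?_, fun r hr => ?_⟩, fun hlt r hr => ?_⟩⟩
  · have : T r c = d.n + 1 := if_neg fun h => hb (b₃.mpr h.1)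
    simp only [State.setReg_arr, p₄, hI r hr, hs, this]
    exact (min_eq_left (hle r)).symm
  · have hlt : A c + forgetCount (d.size i) (d.bag i) (d.pos p) c < s₄.arr aPre r₀ := by
      by_contra h'; simp [h'] at hlt
    rw [p₄, hI _ hr₀lt] at hlt
    have := hle r₀
    omega
  · have hlt : A c + forgetCount (d.size i) (d.bag i) (d.pos p) c < s₄.arr aPre r₀ := by
      by_contra h'; simp [h'] at hlt
    rw [p₄, hI _ hr₀lt] at hlt
    simp only [State.setReg_arr, State.setArr_arr, if_true, Function.update_apply, hs, p₄, hI r hr]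
    split
    next h =>
      have : T r c = A c + forgetCount (d.size i) (d.bag i) (d.pos p) c :=
        if_pos ⟨b₃.mp hb, h.symm⟩
      rw [this, h]
      exact (min_eq_right hlt.le).symm
    next h =>
      have : T r c = d.n + 1 := if_neg fun h' => h h'.2.symm
      rw [this]
      exact (min_eq_left (hle r)).symm
  · have hlt : ¬ A c + forgetCount (d.size i) (d.bag i) (d.pos p) c < s₄.arr aPre r₀ := by
      intro h'; simp [h'] at hlt
    rw [p₄, hI _ hr₀lt] at hlt
    simp only [State.setReg_arr, hs, p₄, hI r hr]
    by_cases h : r = r₀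
    · have : T r c = A c + forgetCount (d.size i) (d.bag i) (d.pos p) c :=
        if_pos ⟨b₃.mp hb, h.symm⟩
      rw [this, h]
      exact (min_eq_left (not_lt.mp hlt)).symm
    · have : T r c = d.n + 1 := if_neg fun h' => h h'.2.symm
      rw [this]
      exact (min_eq_left (hle r)).symm

/-- Introduce vertices: compute the message from the restricted table. -/
def extendProg : Prog :=
  .forTo rC rLp (
    (rBad ≔ 0 ;; rRes ≔ 0) ;;
    .forTo rQ rKp (
      rX ≔ aPos⟦reg rI * reg rn + 5⟦reg rBp + reg rQ⟧⟧ ;;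
      rD ≔ reg rC / aPow⟦reg rQ⟧ % 3 ;;
      .ite (reg rX) (rRes ≔ reg rRes + reg rD * aPow⟦reg rQ⟧)
        (.ite (reg rD ≐ 1) (rBad ≔ 1) .skip)) ;;
    .ite (reg rBad) (.setArr aMsg (reg rC) (reg rInf)) (.setArr aMsg (reg rC) aPre⟦reg rRes⟧))

theorem runs_extendProg {W : ℕ} {d : Layout} {i p : ℕ} {s : State} {A : ℕ → ℕ} (hd : d.Valid W)
    (h : d.NodeContext i p s) (hi : i ≤ d.N) (hp : p ≤ d.N)
    (hpre : ∀ r < 3 ^ d.size p, s.arr aPre r = forgetTable d.Adj (d.size i) (d.size p)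
        (d.bag i) (d.bag p) (d.pos i) (d.pos p) (d.n + 1) A r) :
    Runs W extendProg s (100 * ((d.K + 1) ^ 2 * 3 ^ d.K))
      fun s' => ∀ c < 3 ^ d.size p, s'.arr aMsg c = messageTable d.Adj (d.size i) (d.size p)
        (d.bag i) (d.bag p) (d.pos i) (d.pos p) (d.n + 1) A c := by
  have hkK := hd.size_le p hp
  have hkK' := hd.size_le i hi
  have hW := hd.add_lt
  have h3K : 3 ^ d.size p ≤ 3 ^ d.K := Nat.pow_le_pow_right (by norm_num) hkK
  have hpos : 0 < 3 ^ d.K := by positivity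
  refine .forTo (fun c s' => ∀ r < c, s'.arr aMsg r = messageTable d.Adj (d.size i) (d.size p)
        (d.bag i) (d.bag p) (d.pos i) (d.pos p) (d.n + 1) A r) (d.K * 50 + 30) h.lp
    (hd.three_pow_lt hkK) rfl rfl (by simp) ?_
    ((Nat.add_le_add_right (Nat.mul_le_mul_right _ h3K) _).trans (by
      have := Nat.mul_le_mul_left (3 ^ d.K) (show d.K * 50 + 44 ≤ 100 * (d.K + 1) ^ 2 by nlinarith)
      nlinarith)) fun _ _ h => h
  intro c hc s₁ hA₁ hi₁ hI
  have h₁ := h.agree hA₁ rfl rfl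
  set e : ℕ → ℕ := fun q => if d.pos i (d.bag p q) = 0 then 0 else digit c q with he
  have he3 : ∀ q, e q < 3 := fun q => by
    rw [he]; dsimp only; split
    exacts [by omega, digit_lt ..]
  have hlt : encode e (d.size p) < W :=
    lt_trans (encode_lt fun q _ => he3 q) (hd.three_pow_lt hkK)
  refine .seq (fun s' => s'.reg rBad = 0 ∧ s'.reg rRes = 0) 4
    (d.K * 50 + 20) (by omega) (.of_wp_le rfl ?_) fun s₂ A₂ ⟨b₂, r₂⟩ => ?_
  · simp; omega
  have h₂ := h₁.agree A₂ rfl rfl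
  refine .seq (fun s' => s'.reg rRes = encode e (d.size p) ∧ (s'.reg rBad = 0 ↔
      ∀ q < d.size p, ¬ (d.pos i (d.bag p q) = 0 ∧ digit c q = 1))) (d.K * 50 + 6) 10 (by omega)
    (.forTo (fun j s' => s'.reg rRes = encode e j ∧ (s'.reg rBad = 0 ↔
      ∀ q < j, ¬ (d.pos i (d.bag p q) = 0 ∧ digit c q = 1))) 40 h₂.kp (by omega)
      rfl rfl (by simp [r₂, b₂, encode]) ?_
      (Nat.add_le_add_right (Nat.mul_le_mul hkK (by omega)) _) fun _ _ h => h)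
      fun s₃ A₃ ⟨r₃, b₃⟩ => ?_
  · intro q hq s₃ hA₃ hq₃ ⟨r₃, b₃⟩
    have h₃ := h₂.agree hA₃ rfl rfl
    have hvn := hd.bag_lt p hp q hq
    have e4 : d.ent (d.off p + q) = d.bag p q := rfl
    have hle := hd.pos_le hi hvn
    have hlt' := (encode_le_of_le (δ := e) (show q + 1 ≤ d.size p by omega)).trans_lt hlt
    have hs : encode e (q + 1) = encode e q + e q * 3 ^ q := rfl
    have hc₃ : s₃.reg rC = c := by rw [hA₃.reg _ rfl, A₂.reg _ rfl, hi₁]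
    have hdig : c / 3 ^ q % 3 = digit c q := rfl
    have hdlt := digit_lt c q
    have hall (P : ℕ → Prop) : (∀ q' < q + 1, P q') ↔ (∀ q' < q, P q') ∧ P q :=
      Nat.forall_lt_succ_right
    refine .of_wp_le rfl ?_
    simp only [hall fun q => ¬ (d.pos i (d.bag p q) = 0 ∧ digit c q = 1)]
    by_cases h0 : d.pos i (d.bag p q) = 0
    · have e0 : e q = 0 := by simp [he, h0]
      by_cases h1 : digit c q = 1
      · simp [hq₃, h₃.bp, h₃.ent, e4, h₃.n, h₃.node, h₃.pow q (by omega), h₃.pos _ hi _ hvn, h0,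
          hs, e0, r₃, hc₃, hdig, h1]
        omega
      · simp [hq₃, h₃.bp, h₃.ent, e4, h₃.n, h₃.node, h₃.pow q (by omega), h₃.pos _ hi _ hvn, h0,
          hs, e0, r₃, hc₃, hdig, h1]
        exact ⟨by omega, by omega, by simpa using b₃⟩
    · have e0 : e q = digit c q := by simp [he, h0]
      rw [hs, e0] at hlt'
      simp [hq₃, h₃.bp, h₃.ent, e4, h₃.n, h₃.node, h₃.pow q (by omega), h₃.pos _ hi _ hvn, h0,
        hs, e0, r₃, hc₃, hdig]
      exact ⟨by omega, by omega, hlt', by simpa using b₃⟩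
  have h₃ := h₂.agree A₃ rfl rfl
  have hc₃ : s₃.reg rC = c := by rw [A₃.reg _ rfl, A₂.reg _ rfl, hi₁]
  have hp₃ : s₃.arr aPre = s.arr aPre := by rw [A₃.arr _ rfl, A₂.arr _ rfl, hA₁.arr _ rfl]
  have hm₃ : s₃.arr aMsg = s₁.arr aMsg := by rw [A₃.arr _ rfl, A₂.arr _ rfl]
  have hfin : ∀ r < c + 1, Function.update (s₃.arr aMsg) c (messageTable d.Adj (d.size i)
      (d.size p) (d.bag i) (d.bag p) (d.pos i) (d.pos p) (d.n + 1) A c) r =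
      messageTable d.Adj (d.size i) (d.size p) (d.bag i) (d.bag p) (d.pos i) (d.pos p)
        (d.n + 1) A r := by
    intro r hr
    rw [Function.update_apply]
    split
    next h => rw [h]
    next h => rw [hm₃]; exact hI r (by omega)
  refine .of_wp_le rfl ?_
  have hmle := messageTable_le (Adj := d.Adj) (k := d.size i) (k' := d.size p) (b := d.bag i)
    (b' := d.bag p) (pos := d.pos i) (pos' := d.pos p) (d.n + 1) A c
  simp only [Prog.wp, Expr.val_reg, Expr.val_get, hc₃, h₃.inf, r₃, hp₃]
  refine ⟨fun hb => ⟨by omega, ?_⟩, fun hb => ?_⟩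
  · have : messageTable d.Adj (d.size i) (d.size p) (d.bag i) (d.bag p) (d.pos i) (d.pos p)
        (d.n + 1) A c = d.n + 1 := by
      rw [messageTable, if_pos]
      by_contra hn
      exact hb (b₃.mpr fun q hq h => hn ⟨q, hq, h⟩)
    rw [this] at hfin
    simpa using hfin
  · have : messageTable d.Adj (d.size i) (d.size p) (d.bag i) (d.bag p) (d.pos i) (d.pos p)
        (d.n + 1) A c = s.arr aPre (encode e (d.size p)) := by
      rw [hpre _ (encode_lt fun q _ => he3 q), messageTable, if_neg]
      rintro ⟨q, hq, h⟩
      exact b₃.mp hb q hq h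
    rw [this] at hfin hmle
    exact ⟨by omega, by simpa using hfin⟩

end RAM

namespace RAM
open RAM.Expr (reg)

/-! ### Preprocessing -/

/-- Compute the size of a largest bag. -/
def maxProg : Prog :=
  .forTo rI rN (rX ≔ 4⟦reg rI + 1⟧ - 4⟦reg rI⟧ ;; .ite (reg rK ≺ reg rX) (rK ≔ reg rX) .skip)

theorem runs_maxProg {W : ℕ} {s : State} {N : ℕ} {off : ℕ → ℕ} (hN : s.reg rN = N) (hNW : N < W)
    (hK : s.reg rK = 0) (hoff : s.arr 4 = off) (hW : ∀ i, off i < W) :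
    Runs W maxProg s (N * 40 + 6)
      fun s' => s'.reg rK = (Finset.range N).sup fun i => off (i + 1) - off i := by
  refine .forTo (m := N) (fun j s' => s'.reg rK = (Finset.range j).sup fun i => off (i + 1) - off i)
    25 hN hNW rfl rfl (by simp [hK]) ?_ (by omega) fun _ _ h => h
  intro j hj s₁ hA₁ hi hI
  have e1 : s₁.arr 4 = off := by rw [hA₁.arr _ rfl, hoff]
  have h1 := hW (j + 1)
  refine .of_wp_le rfl ?_
  rw [Finset.range_add_one, Finset.sup_insert]
  generalize ((Finset.range j).sup fun i => off (i + 1) - off i) = M at hI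
  simp [hi, e1, hI]
  omega

/-- Compute the powers of `3`. -/
def powProg : Prog :=
  .setArr aPow 0 1 ;; .forTo rJ rK (.setArr aPow (reg rJ + 1) (aPow⟦reg rJ⟧ * 3)) ;;
    rS ≔ aPow⟦reg rK⟧ ;; rInf ≔ reg rn + 1 ;; rNp ≔ reg rN + 1

theorem runs_powProg {W : ℕ} {s : State} {n N K : ℕ} (hn : s.reg rn = n) (hN : s.reg rN = N)
    (hK : s.reg rK = K) (hW : n + N + K + 2 < W) (h3 : 3 ^ K < W) :
    Runs W powProg s (K * 20 + 30) fun s' => (∀ j ≤ K, s'.arr aPow j = 3 ^ j) ∧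
      s'.reg rS = 3 ^ K ∧ s'.reg rInf = n + 1 ∧ s'.reg rNp = N + 1 := by
  refine .seq (fun s' => s'.arr aPow 0 = 1) 3 (K * 20 + 27) (by omega)
    (.of_wp_le rfl (by simp; omega)) fun s₁ A₁ h₁ => ?_
  refine .seq (fun s' => ∀ j ≤ K, s'.arr aPow j = 3 ^ j) (K * 20 + 6) 15 (by omega)
    (.forTo (m := K) (fun m s' => ∀ j ≤ m, s'.arr aPow j = 3 ^ j) 10
      (by rw [A₁.reg _ rfl, hK]) (by omega) rfl rfl (by simpa using h₁) ?_ (by omega)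
      fun _ _ h => h) fun s₂ A₂ h₂ => .of_wp_le rfl ?_
  · intro j hj s₂ hA₂ hi hI
    refine .of_wp_le rfl ?_
    have := Nat.pow_le_pow_right (show 0 < 3 by norm_num) (show j + 1 ≤ K by omega)
    have e := hI j le_rfl
    simp only [Prog.wp, Expr.val_add, Expr.val_reg, Expr.val_mul, Expr.val_get, Expr.val_ofNat, hi,
      e, ← pow_succ]
    refine ⟨by omega, fun l hl => ?_⟩
    simp only [State.setReg_arr, State.setArr_arr, if_true, Function.update_apply]
    split
    next h => rw [h]
    next h => exact hI l (by omega)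
  · have e1 : s₂.reg rn = n := by rw [A₂.reg _ rfl, A₁.reg _ rfl, hn]
    have e2 : s₂.reg rN = N := by rw [A₂.reg _ rfl, A₁.reg _ rfl, hN]
    have e3 : s₂.reg rK = K := by rw [A₂.reg _ rfl, A₁.reg _ rfl, hK]
    simp [e1, e2, e3, h₂ K le_rfl]
    exact ⟨h3, by omega, by omega, h₂⟩

/-- Compute the adjacency matrix. -/
def adjProg : Prog :=
  .forTo rV rn (rT ≔ 0⟦reg rV + 1⟧ - 0⟦reg rV⟧ ;;
    .forTo rE rT (.setArr aAdj (reg rV * reg rn + 1⟦0⟦reg rV⟧ + reg rE⟧) 1))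

theorem mul_add_inj {n a b c d : ℕ} (hb : b < n) (hd : d < n) :
    a * n + b = c * n + d ↔ a = c ∧ b = d := by
  constructor
  · intro h
    have hn : 0 < n := by omega
    have h1 : (a * n + b) / n = a := by
      rw [mul_comm, Nat.mul_add_div hn, Nat.div_eq_of_lt hb, add_zero]
    have h2 : (c * n + d) / n = c := by
      rw [mul_comm, Nat.mul_add_div hn, Nat.div_eq_of_lt hd, add_zero]
    have : a = c := by rw [← h1, ← h2, h]
    subst this
    exact ⟨rfl, by omega⟩
  · rintro ⟨rfl, rfl⟩; rfl

/-- Only the ones are written; the zeros are those of the initial memory. So the matrix takes time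
linear in the number of vertices and list entries, not quadratic in `n`. -/
theorem runs_adjProg {W : ℕ} {s : State} {n K : ℕ} {off ent : ℕ → ℕ} {Adj : ℕ → ℕ → Prop}
    [DecidableRel Adj] (hn : s.reg rn = n) (hnW : n < W) (hoff : s.arr 0 = off)
    (hent : s.arr 1 = ent) (h0 : ∀ x, s.arr aAdj x = 0) (hW : ∀ i, off i < W)
    (hlt : ∀ u < n, ∀ e < off (u + 1) - off u, ent (off u + e) < n)
    (hAdj : ∀ u < n, ∀ v < n, Adj u v ↔ ∃ e < off (u + 1) - off u, ent (off u + e) = v)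
    (hK : ∑ u ∈ Finset.range n, (off (u + 1) - off u) ≤ K) :
    Runs W adjProg s (K * 20 + n * 25 + 6) fun s' => ∀ u < n, ∀ v < n,
      s'.arr aAdj (u * n + v) = if Adj u v then 1 else 0 := by
  refine .forTo_sum (m := n) (fun j s' => ∀ u < n, ∀ v < n,
    s'.arr aAdj (u * n + v) = if u < j ∧ Adj u v then 1 else 0)
    (fun u => (off (u + 1) - off u) * 20 + 17) hn hnW rfl rfl (by simp [h0]) ?_ ?_
    fun s' _ h u hu v hv => by simpa [hu] using h u hu v hv
  · intro j hj s₁ hA₁ hi hI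
    have e1 : s₁.arr 0 = off := by rw [hA₁.arr _ rfl, hoff]
    have h1 := hW (j + 1)
    refine .seq (fun s' => s'.reg rT = off (j + 1) - off j) 10 ((off (j + 1) - off j) * 20 + 7)
      (by omega) (.of_wp_le rfl (by simp [hi, e1]; omega)) fun s₂ A₂ h₂ => ?_
    refine .forTo (m := off (j + 1) - off j) (fun e s' => ∀ u < n, ∀ v < n,
      s'.arr aAdj (u * n + v) = if (u < j ∧ Adj u v) ∨ (u = j ∧ ∃ e' < e, ent (off u + e') = v)
        then 1 else 0) 12 h₂ (by omega) rfl rfl ?_ ?_ (by omega) fun s' _ h u hu v hv => ?_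
    · simpa [A₂.arr aAdj rfl] using hI
    · intro e he s₃ hA₃ hi₃ hI₃
      have e1 : s₃.arr 0 = off := by rw [hA₃.arr _ rfl, A₂.arr _ rfl, e1]
      have e2 : s₃.arr 1 = ent := by rw [hA₃.arr _ rfl, A₂.arr _ rfl, hA₁.arr _ rfl, hent]
      have e3 : s₃.reg rV = j := by rw [hA₃.reg _ rfl, A₂.reg _ rfl, hi]
      have e4 : s₃.reg rn = n := by rw [hA₃.reg _ rfl, A₂.reg _ rfl, hA₁.reg _ rfl, hn]
      refine .of_wp_le rfl ?_
      simp only [Prog.wp, Expr.val_add, Expr.val_reg, Expr.val_mul, Expr.val_get, Expr.val_ofNat,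
        hi₃, e1, e2, e3, e4]
      refine ⟨by omega, fun u hu v hv => ?_⟩
      simp only [State.setReg_arr, State.setArr_arr, if_true, Function.update_apply,
        mul_add_inj hv (hlt j hj e he), hI₃ u hu v hv, Nat.exists_lt_succ_right]
      by_cases h : u = j ∧ v = ent (off j + e)
      · obtain ⟨rfl, rfl⟩ := h
        simp
      · rw [if_neg h]
        congr 1
        refine propext ⟨fun h' => h'.imp_right fun h' => ⟨h'.1, .inl h'.2⟩,
          fun h' => h'.imp_right fun h' => ⟨h'.1, h'.2.resolve_right fun h2 => h ⟨h'.1, ?_⟩⟩⟩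
        rw [← h2, h'.1]
    · simp only [State.setReg_arr, h u hu v hv]
      congr 1
      refine propext ⟨fun h' => ?_, fun h' => ?_⟩
      · rcases h' with h' | h'
        · exact ⟨by omega, h'.2⟩
        · exact ⟨by omega, (hAdj u hu v hv).mpr (by rw [h'.1]; simpa [h'.1] using h'.2)⟩
      · rcases Nat.lt_succ_iff_lt_or_eq.mp h'.1 with h1 | h1
        · exact .inl ⟨h1, h'.2⟩
        · exact .inr ⟨h1, by simpa [h1] using (hAdj u hu v hv).mp h'.2⟩
  · have : ∑ u ∈ Finset.range n, ((off (u + 1) - off u) * 20 + 17 + 8) =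
        (∑ u ∈ Finset.range n, (off (u + 1) - off u)) * 20 + n * 25 := by
      simp only [add_assoc, Finset.sum_add_distrib, Finset.sum_mul, Finset.sum_const,
        Finset.card_range, smul_eq_mul]
      omega
    rw [this]
    omega

end RAM

/-! ### Positions of vertices and initial tables -/

/-- One plus the position of `v` in a bag, or `0` if the bag does not contain `v`. -/
def position (b : ℕ → ℕ) (v : ℕ) : ℕ → ℕ
  | 0 => 0
  | k + 1 => if b k = v then k + 1 else position b v k

theorem position_le (b : ℕ → ℕ) (v k : ℕ) : position b v k ≤ k := by
  induction k with
  | zero => exact le_rfl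
  | succ k ih => rw [position]; split <;> omega

theorem isPosition_position {n k : ℕ} {b : ℕ → ℕ} (hb : Set.InjOn b (Set.Iio k)) :
    IsPosition n k b fun v => position b v k := by
  refine ⟨fun q hq => ?_, fun v _ h => ⟨position_le .., ?_⟩⟩
  · induction k with
    | zero => omega
    | succ k ih =>
      dsimp only
      rw [position]
      split
      next h => rw [hb (by simp) (by simpa using hq) h]
      next h =>
        refine ih (hb.mono fun x hx => ?_) (lt_of_le_of_ne (by omega) fun e => h (by rw [e]))
        simp only [Set.mem_Iio] at *; omega
  · induction k with
    | zero => exact (h rfl).elim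
    | succ k ih =>
      dsimp only at h ⊢
      rw [position] at h ⊢
      split at h
      next h' => rw [if_pos h']; exact h'
      next h' =>
        rw [if_neg h']
        exact ih (hb.mono fun x hx => by simp only [Set.mem_Iio] at *; omega) h

namespace RAM
open RAM.Expr (reg)

/-- Compute the positions of the vertices in the bags. -/
def posProg : Prog :=
  .forTo rI rNp (rT ≔ 4⟦reg rI + 1⟧ - 4⟦reg rI⟧ ;;
    .forTo rQ rT (.setArr aPos (reg rI * reg rn + 5⟦4⟦reg rI⟧ + reg rQ⟧) (reg rQ + 1)))

/-- As for the adjacency matrix, absent vertices rely on the initial zeros, which is why positions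
are counted from 1. The virtual root `N` is included. -/
theorem runs_posProg {W : ℕ} {s : State} {n N K : ℕ} {off ent : ℕ → ℕ} (hn : s.reg rn = n)
    (hN : s.reg rNp = N + 1) (hoff : s.arr 4 = off)
    (hent : s.arr 5 = ent) (h0 : ∀ x, s.arr aPos x = 0) (hW : ∀ i, off i < W)
    (hlt : ∀ i ≤ N, ∀ q < off (i + 1) - off i, ent (off i + q) < n)
    (hK : ∀ i ≤ N, off (i + 1) - off i ≤ K) (hKW : n + N + K + 2 < W) :
    Runs W posProg s ((N + 1) * (K * 30 + 25) + 6) fun s' => ∀ i ≤ N, ∀ v < n,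
      s'.arr aPos (i * n + v) = position (fun q => ent (off i + q)) v (off (i + 1) - off i) := by
  refine .forTo (m := N + 1) (fun j s' => ∀ i ≤ N, ∀ v < n,
    s'.arr aPos (i * n + v) = if i < j then
      position (fun q => ent (off i + q)) v (off (i + 1) - off i) else 0)
    (K * 30 + 17) hN (by omega) rfl rfl (by simp [h0]) ?_ le_rfl
    fun s' _ h i hi v hv => by rw [h i hi v hv, if_pos (by omega)]
  intro j hj s₁ hA₁ hi hI
  have e1 : s₁.arr 4 = off := by rw [hA₁.arr _ rfl, hoff]
  have h1 := hW (j + 1)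
  have hKj := hK j (by omega)
  refine .seq (fun s' => s'.reg rT = off (j + 1) - off j) 10 (K * 30 + 7)
    (by omega) (.of_wp_le rfl (by simp [hi, e1]; omega)) fun s₂ A₂ h₂ => ?_
  refine .forTo (m := off (j + 1) - off j) (fun q s' => ∀ i ≤ N, ∀ v < n,
    s'.arr aPos (i * n + v) = if i < j then
      position (fun q => ent (off i + q)) v (off (i + 1) - off i) else if i = j then
      position (fun q => ent (off i + q)) v q else 0) 15 h₂ (by omega) rfl rfl ?_ ?_
      (by nlinarith) fun s' _ h i hi v hv => ?_
  · simp only [position, ite_self, State.setReg_arr, A₂.arr aPos rfl]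
    exact hI
  · intro q hq s₃ hA₃ hi₃ hI₃
    have e1 : s₃.arr 4 = off := by rw [hA₃.arr _ rfl, A₂.arr _ rfl, e1]
    have e2 : s₃.arr 5 = ent := by rw [hA₃.arr _ rfl, A₂.arr _ rfl, hA₁.arr _ rfl, hent]
    have e3 : s₃.reg rI = j := by rw [hA₃.reg _ rfl, A₂.reg _ rfl, hi]
    have e4 : s₃.reg rn = n := by rw [hA₃.reg _ rfl, A₂.reg _ rfl, hA₁.reg _ rfl, hn]
    refine .of_wp_le rfl ?_
    simp only [Prog.wp, Expr.val_add, Expr.val_reg, Expr.val_mul, Expr.val_get, Expr.val_ofNat,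
      hi₃, e1, e2, e3, e4]
    refine ⟨by omega, fun i hi v hv => ?_⟩
    simp only [State.setReg_arr, State.setArr_arr, if_true, Function.update_apply,
      mul_add_inj hv (hlt j (by omega) q hq), hI₃ i hi v hv, position]
    by_cases hij : i = j
    · subst hij
      by_cases h : v = ent (off i + q)
      · simp [h]
      · simp [h, Ne.symm h]
    · simp [hij]
  · simp only [State.setReg_arr, h i hi v hv]
    rcases lt_trichotomy i j with h | h | h
    · rw [if_pos h, if_pos (by omega)]
    · subst h; simp
    · rw [if_neg (by omega), if_neg (by omega), if_neg (by omega)]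

/-- Initialise the tables. -/
def initProg : Prog :=
  .forTo rI rNp ((rKi ≔ 4⟦reg rI + 1⟧ - 4⟦reg rI⟧ ;; rLi ≔ aPow⟦reg rKi⟧) ;;
    .forTo rC rLi (rBad ≔ 0 ;;
      .forTo rQ rKi (.ite (reg rC / aPow⟦reg rQ⟧ % 3 ≐ 1) (rBad ≔ 1) .skip) ;;
      .setArr aTab (reg rI * reg rS + reg rC) (reg rBad * reg rInf)))

theorem runs_initProg {W : ℕ} {s : State} {n N K : ℕ} {off : ℕ → ℕ}
    (hN : s.reg rNp = N + 1) (hS : s.reg rS = 3 ^ K) (hinf : s.reg rInf = n + 1)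
    (hoff : s.arr 4 = off) (hpow : ∀ j ≤ K, s.arr aPow j = 3 ^ j) (hW : ∀ i, off i < W)
    (hK : ∀ i ≤ N, off (i + 1) - off i ≤ K) (hKW : n + N + K + 2 < W) (h3 : 3 ^ K < W) :
    Runs W initProg s ((N + 1) * (3 ^ K * (K * 25 + 30) + 30) + 6) fun s' => ∀ i ≤ N,
      ∀ c < 3 ^ (off (i + 1) - off i),
        s'.arr aTab (i * 3 ^ K + c) = initTable (off (i + 1) - off i) (n + 1) c := by
  have hpowle (i : ℕ) (hi : i ≤ N) : 3 ^ (off (i + 1) - off i) ≤ 3 ^ K :=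
    Nat.pow_le_pow_right (by norm_num) (hK i hi)
  refine .forTo (m := N + 1) (fun j s' => ∀ i < j, ∀ c < 3 ^ (off (i + 1) - off i),
        s'.arr aTab (i * 3 ^ K + c) = initTable (off (i + 1) - off i) (n + 1) c)
    (3 ^ K * (K * 25 + 30) + 22) hN (by omega) rfl rfl (by simp) ?_ le_rfl
    fun s' _ h i hi => h i (by omega)
  intro j hj s₁ hA₁ hi hI
  have e1 : s₁.arr 4 = off := by rw [hA₁.arr _ rfl, hoff]
  have h1 := hW (j + 1)
  have hKj := hK j (by omega)
  have hpj := hpowle j (by omega)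
  have e2 : s₁.arr aPow (off (j + 1) - off j) = 3 ^ (off (j + 1) - off j) := by
    rw [hA₁.arr _ rfl, hpow _ hKj]
  refine .seq (fun s' => s'.reg rKi = off (j + 1) - off j ∧
    s'.reg rLi = 3 ^ (off (j + 1) - off j)) 15 (3 ^ K * (K * 25 + 30) + 6)
    (by omega) (.of_wp_le rfl (by simp [hi, e1, e2]; omega)) fun s₂ A₂ ⟨k₂, l₂⟩ => ?_
  refine .forTo (m := 3 ^ (off (j + 1) - off j)) (fun c s' => ∀ i ≤ j,
      ∀ x < 3 ^ (off (i + 1) - off i), i < j ∨ x < c →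
        s'.arr aTab (i * 3 ^ K + x) = initTable (off (i + 1) - off i) (n + 1) x)
    (K * 25 + 22) l₂ (by omega) rfl rfl ?_ ?_
    (Nat.add_le_add_right (Nat.mul_le_mul_right _ hpj) _)
    fun s' _ h i hi x hx => h i (by omega) x hx ?_
  · simp only [State.setReg_arr, A₂.arr aTab rfl, not_lt_zero, or_false]
    exact fun i _ x hx hij => hI i hij x hx
  · intro c hc s₃ hA₃ hc₃ hI₃
    have B₃ := (A₂.reg rI rfl).trans hi
    refine .seq (fun s' => s'.reg rBad = 0) 3 (K * 25 + 19) (by omega)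
      (.of_wp_le rfl (by simp; omega)) fun s₄ A₄ b₄ => ?_
    refine .seq (fun s' => s'.reg rBad = if ∃ q < off (j + 1) - off j, digit c q = 1 then 1 else 0)
      (K * 25 + 6) 10 (by omega) (.forTo (m := off (j + 1) - off j)
        (fun k s' => s'.reg rBad = if ∃ q < k, digit c q = 1 then 1 else 0) 16
        (by rw [A₄.reg _ rfl, hA₃.reg _ rfl, k₂]) (by omega) rfl rfl (by simp [b₄]) ?_
        (by nlinarith) fun _ _ h => h) fun s₅ A₅ b₅ => ?_
    · intro q hq s₅ hA₅ hq₅ hI₅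
      have e3 : s₅.reg rC = c := by rw [hA₅.reg _ rfl, A₄.reg _ rfl, hc₃]
      have e4 : s₅.arr aPow q = 3 ^ q := by
        rw [hA₅.arr _ rfl, A₄.arr _ rfl, hA₃.arr _ rfl, A₂.arr _ rfl, hA₁.arr _ rfl, hpow q (by omega)]
      have hdig : c / 3 ^ q % 3 = digit c q := rfl
      refine .of_wp_le rfl ?_
      simp only [Nat.exists_lt_succ_right]
      by_cases h : digit c q = 1
      · simp [e3, e4, hq₅, hdig, h]
        omega
      · simp [e3, e4, hq₅, hdig, h, hI₅]
    · have e1 : s₅.reg rI = j := by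
        rw [A₅.reg _ rfl, A₄.reg _ rfl, hA₃.reg _ rfl, B₃]
      have e2 : s₅.reg rC = c := by rw [A₅.reg _ rfl, A₄.reg _ rfl, hc₃]
      have e3 : s₅.reg rS = 3 ^ K := by
        rw [A₅.reg _ rfl, A₄.reg _ rfl, hA₃.reg _ rfl, A₂.reg _ rfl, hA₁.reg _ rfl, hS]
      have e4 : s₅.reg rInf = n + 1 := by
        rw [A₅.reg _ rfl, A₄.reg _ rfl, hA₃.reg _ rfl, A₂.reg _ rfl, hA₁.reg _ rfl, hinf]
      have e5 : s₅.arr aTab = s₃.arr aTab := by rw [A₅.arr _ rfl, A₄.arr _ rfl]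
      have hv : (if ∃ q < off (j + 1) - off j, digit c q = 1 then 1 else 0) * (n + 1) =
          initTable (off (j + 1) - off j) (n + 1) c := by
        rw [initTable]; split <;> simp
      have hle : initTable (off (j + 1) - off j) (n + 1) c ≤ n + 1 := by
        rw [initTable]; split <;> omega
      refine .of_wp_le rfl ?_
      simp only [Prog.wp, Expr.val_add, Expr.val_reg, Expr.val_mul, e1, e2, e3, e4, b₅, hv]
      refine ⟨by omega, fun i hi x hx hix => ?_⟩
      have hx' := hx.trans_le (hpowle i (by omega))
      simp only [State.setReg_arr, State.setArr_arr, if_true, Function.update_apply,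
        mul_add_inj hx' (hc.trans_le hpj), e5]
      split
      next h => rw [h.1, h.2]
      next h => exact hI₃ i hi x hx (by omega)
  · rcases Nat.lt_succ_iff_lt_or_eq.mp hi with h | h
    · exact .inl h
    · exact .inr (h ▸ hx)

end RAM

/-! ### Breadth-first search -/

/-- `queue` lists the nodes `0, …, N - 1` such that the parent of a node precedes it; the parent
of the first node is `N`. -/
structure SearchOrder (R : ℕ → ℕ → Prop) (N : ℕ) (queue par : ℕ → ℕ) : Prop where
  queue_lt : ∀ m < N, queue m < N
  queue_inj : Set.InjOn queue (Set.Iio N)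
  queue_zero : queue 0 = 0
  par_zero : par 0 = N
  par_queue : ∀ m < N, 0 < m → ∃ l < m, par (queue m) = queue l ∧ R (queue l) (queue m)

/-- The state of a search in which `tail` nodes have been found, and the first `h` of them have
been processed. -/
structure Search (R : ℕ → ℕ → Prop) (N : ℕ) (queue par vis : ℕ → ℕ) (tail h : ℕ) : Prop where
  tail_pos : 0 < tail
  queue_lt : ∀ m < tail, queue m < N
  queue_inj : Set.InjOn queue (Set.Iio tail)
  queue_zero : queue 0 = 0
  par_zero : par 0 = N
  par_queue : ∀ m < tail, 0 < m → ∃ l < m, par (queue m) = queue l ∧ R (queue l) (queue m)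
  vis_iff : ∀ j < N, vis j ≠ 0 ↔ ∃ m < tail, queue m = j
  closed : ∀ m < h, ∀ j, R (queue m) j → vis j ≠ 0

namespace Search

variable {R : ℕ → ℕ → Prop} {N : ℕ} {queue par vis : ℕ → ℕ} {tail h : ℕ}

theorem tail_le (hs : Search R N queue par vis tail h) : tail ≤ N := by
  have := Finset.card_le_card_of_injOn (s := Finset.range tail) (t := Finset.range N) queue
    (fun m hm => by simpa using hs.queue_lt m (by simpa using hm)) (by simpa using hs.queue_inj)
  simpa using this

/-- Once every found node has been processed, the found nodes are closed under `R` and contain 0, so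
by connectedness they are all the nodes. Hence the queue cannot run empty early, and a counting loop
over `N` nodes can replace a test for emptiness. -/
theorem lt_tail (hs : Search R N queue par vis tail h) (hR : ∀ i j, R i j → j < N)
    (hconn : ∀ P : ℕ → Prop, P 0 → (∀ i j, P i → R i j → P j) → ∀ j < N, P j)
    (hh : tail ≤ h) : tail = N := by
  refine le_antisymm hs.tail_le ?_
  have hsurj := hconn (fun j => ∃ m < tail, queue m = j) ⟨0, hs.tail_pos, hs.queue_zero⟩
    fun i j ⟨m, hm, hi⟩ hij =>
      (hs.vis_iff j (hR _ _ hij)).mp (hs.closed m (by omega) j (by rwa [hi]))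
  have := Finset.card_le_card_of_surjOn (s := Finset.range tail) (t := Finset.range N) queue
    fun j hj => by
      obtain ⟨m, hm, e⟩ := hsurj j (by simpa using hj)
      exact ⟨m, by simpa using hm, e⟩
  simpa using this

theorem searchOrder (hs : Search R N queue par vis N h) : SearchOrder R N queue par where
  queue_lt := hs.queue_lt
  queue_inj := hs.queue_inj
  queue_zero := hs.queue_zero
  par_zero := hs.par_zero
  par_queue := hs.par_queue

theorem push (hs : Search R N queue par vis tail h) {j : ℕ} (hh : h < tail) (hj : j < N)
    (hvis : vis j = 0) (hR : R (queue h) j) :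
    Search R N (Function.update queue tail j) (Function.update par j (queue h))
      (Function.update vis j 1) (tail + 1) h := by
  have hne : ∀ m < tail, queue m ≠ j := fun m hm e => (hs.vis_iff j hj).mpr ⟨m, hm, e⟩ hvis
  have hq : ∀ m < tail, Function.update queue tail j m = queue m := fun m hm =>
    Function.update_of_ne (by omega) ..
  have hqt : Function.update queue tail j tail = j := Function.update_self ..
  have h0 : (0 : ℕ) ≠ j := hs.queue_zero ▸ hne 0 hs.tail_pos
  refine ⟨by omega, fun m hm => ?_, fun m hm l hl e => ?_, ?_, ?_, fun m hm h0 => ?_,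
    fun i hi => ?_, fun m hm i hi => ?_⟩
  · rcases Nat.lt_succ_iff_lt_or_eq.mp hm with h | rfl
    · rw [hq m h]; exact hs.queue_lt m h
    · rwa [hqt]
  · rcases Nat.lt_succ_iff_lt_or_eq.mp hm with h | rfl <;>
      rcases Nat.lt_succ_iff_lt_or_eq.mp hl with h' | rfl
    · rw [hq m h, hq l h'] at e
      exact hs.queue_inj h h' e
    · rw [hq m h, hqt] at e
      exact (hne m h e).elim
    · rw [hq l h', hqt] at e
      exact (hne l h' e.symm).elim
    · rfl
  · rw [hq 0 hs.tail_pos, hs.queue_zero]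
  · rw [Function.update_of_ne h0, hs.par_zero]
  · rcases Nat.lt_succ_iff_lt_or_eq.mp hm with h | rfl
    · obtain ⟨l, hl, e1, e2⟩ := hs.par_queue m h h0
      refine ⟨l, hl, ?_⟩
      rw [hq m h, hq l (by omega), Function.update_of_ne (hne m h)]
      exact ⟨e1, e2⟩
    · exact ⟨h, hh, by rw [hqt, hq h hh, Function.update_self], by rwa [hqt, hq h hh]⟩
  · by_cases hij : i = j
    · subst hij
      simp only [Function.update_self, ne_eq, one_ne_zero, not_false_eq_true, true_iff]
      exact ⟨tail, by omega, hqt⟩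
    · rw [Function.update_of_ne hij, hs.vis_iff i hi]
      constructor
      · rintro ⟨m, hm, e⟩
        exact ⟨m, by omega, by rw [hq m hm, e]⟩
      · rintro ⟨m, hm, e⟩
        rcases Nat.lt_succ_iff_lt_or_eq.mp hm with h | rfl
        · exact ⟨m, h, by rw [← e, hq m h]⟩
        · rw [hqt] at e
          exact (hij e.symm).elim
  · rw [hq m (by omega)] at hi
    by_cases hij : i = j
    · subst hij; simp
    · rw [Function.update_of_ne hij]
      exact hs.closed m hm i hi

end Search

namespace RAM
open RAM.Expr (reg)

/-- Breadth-first search from node `0`. -/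
def searchProg : Prog :=
  (.setArr aVis 0 1 ;; .setArr aPar 0 (reg rN) ;; rTail ≔ 1) ;;
  .forTo rH rN ((rI ≔ aQueue⟦reg rH⟧ ;; rT ≔ 2⟦reg rI + 1⟧ - 2⟦reg rI⟧) ;;
    .forTo rE rT (rJ ≔ 3⟦2⟦reg rI⟧ + reg rE⟧ ;;
      .ite aVis⟦reg rJ⟧ .skip (.setArr aVis (reg rJ) 1 ;; .setArr aPar (reg rJ) (reg rI) ;;
        .setArr aQueue (reg rTail) (reg rJ) ;; rTail ≔ reg rTail + 1)))

/-- Which node is processed at which time is known only during the run, so the invariant records the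
cost as a sum over the queue. At the end the queue is a permutation of the nodes, and the sum
becomes the total length of the lists. -/
theorem runs_searchProg {W : ℕ} {s : State} {N K : ℕ} {off ent : ℕ → ℕ} {R : ℕ → ℕ → Prop}
    (hN : s.reg rN = N) (hN0 : 0 < N) (hNW : N + 1 < W) (hoff : s.arr 2 = off)
    (hent : s.arr 3 = ent)
    (hq0 : s.arr aQueue 0 = 0) (hv0 : ∀ x, s.arr aVis x = 0) (hW : ∀ i, off i < W)
    (hR : ∀ i j, R i j → j < N)
    (hRent : ∀ i < N, ∀ j, R i j ↔ ∃ e < off (i + 1) - off i, ent (off i + e) = j)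
    (hconn : ∀ P : ℕ → Prop, P 0 → (∀ i j, P i → R i j → P j) → ∀ j < N, P j)
    (hK : ∑ i ∈ Finset.range N, (off (i + 1) - off i) ≤ K) :
    Runs W searchProg s (K * 40 + N * 40 + 30)
      fun s' => SearchOrder R N (s'.arr aQueue) (s'.arr aPar) := by
  refine .seq (fun s' => Search R N (s'.arr aQueue) (s'.arr aPar) (s'.arr aVis) (s'.reg rTail) 0)
    10 (K * 40 + N * 40 + 20) (by omega) (.of_wp_le rfl ?_) fun s₁ A₁ h₁ => ?_
  -- The program never writes node 0 into the queue: the initial content 0 of cell 0 already is the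
  -- start node.
  · simp [hN]
    refine ⟨by omega, by omega, by omega, by omega, fun m hm => ?_, ?_, hq0, by simp,
      fun m hm h => by omega, fun j hj => ?_, fun m hm => by omega⟩
    · obtain rfl : m = 0 := by omega
      rwa [hq0]
    · intro m hm l hl _
      simp only [Set.mem_Iio] at hm hl
      omega
    · by_cases h : j = 0
      · subst h; simp [hq0]
      · simp [h, hv0, hq0, Ne.symm h]
  refine .forTo_acc (m := N) (fun h c s' =>
      Search R N (s'.arr aQueue) (s'.arr aPar) (s'.arr aVis) (s'.reg rTail) h ∧
      c = ∑ m ∈ Finset.range h, ((off (s'.arr aQueue m + 1) - off (s'.arr aQueue m)) * 40 + 30))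
    (by rw [A₁.reg _ rfl, hN]) (by omega) rfl rfl ⟨by simpa using h₁, by simp⟩ ?_ ?_
  · intro h hh c s₂ hA₂ hh₂ ⟨hs₂, hc⟩
    have e1 : s₂.arr 2 = off := by rw [hA₂.arr _ rfl, A₁.arr _ rfl, hoff]
    have e2 : s₂.arr 3 = ent := by rw [hA₂.arr _ rfl, A₁.arr _ rfl, hent]
    have hht : h < s₂.reg rTail := by
      by_contra hcon
      have := hs₂.lt_tail hR hconn (by omega)
      omega
    have hiN := hs₂.queue_lt h hht
    set i := s₂.arr aQueue h with hi
    have h1 := hW (i + 1)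
    refine ⟨(off (i + 1) - off i) * 40 + 22, .seq (fun s' => s'.reg rI = i ∧
      s'.reg rT = off (i + 1) - off i) 16 ((off (i + 1) - off i) * 40 + 6) (by omega)
      (.of_wp_le rfl ?_) fun s₃ A₃ ⟨i₃, t₃⟩ => ?_⟩
    · simp [hh₂, ← hi, e1]
      omega
    -- New nodes are appended at `tail > h`, so the processed part of the queue, and with it the
    -- recorded cost, does not change.
    refine .forTo (m := off (i + 1) - off i) (fun e s' =>
      Search R N (s'.arr aQueue) (s'.arr aPar) (s'.arr aVis) (s'.reg rTail) h ∧
      h < s'.reg rTail ∧ (∀ m ≤ h, s'.arr aQueue m = s₂.arr aQueue m) ∧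
      ∀ e' < e, s'.arr aVis (ent (off i + e')) ≠ 0) 32 t₃ (by omega) rfl rfl ?_ ?_ (by omega)
      fun s₄ A₄ ⟨h1, h2, h3, h4⟩ => ⟨?_, ?_⟩
    · simp only [State.setReg_arr, State.setReg_reg]
      rw [if_neg (by norm_num), A₃.arr _ rfl, A₃.arr _ rfl, A₃.arr _ rfl, A₃.reg _ rfl]
      exact ⟨hs₂, hht, fun _ _ => rfl, fun e' he' => by omega⟩
    · intro e he s₄ hA₄ he₄ ⟨h1, h2, h3, h4⟩
      have f1 : s₄.arr 2 = off := by rw [hA₄.arr _ rfl, A₃.arr _ rfl, e1]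
      have f2 : s₄.arr 3 = ent := by rw [hA₄.arr _ rfl, A₃.arr _ rfl, e2]
      have f3 : s₄.reg rI = i := by rw [hA₄.reg _ rfl, i₃]
      have hRij : R i (ent (off i + e)) := (hRent i hiN _).mpr ⟨e, he, rfl⟩
      have hjN := hR _ _ hRij
      generalize hj : ent (off i + e) = j at *
      refine .of_wp_le rfl ?_
      have ht := h1.tail_le
      by_cases hv : s₄.arr aVis j = 0
      · have hp := h1.push h2 hjN hv (by rwa [h3 h le_rfl, ← hi])
        rw [h3 h le_rfl, ← hi] at hp
        simp [he₄, f1, f2, f3, hj, hv]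
        refine ⟨by omega, by omega, by omega, by omega, by omega, hp, by omega, fun m hm => ?_,
          fun e' he' => ?_⟩
        · rw [Function.update_of_ne (by omega)]; exact h3 m hm
        · rw [Function.update_apply]
          split
          next => norm_num
          next h => exact h4 e' (lt_of_le_of_ne (by omega) fun e => h (by rw [e, hj]))
      · simp [he₄, f1, f2, f3, hj, hv]
        refine ⟨by omega, h1, h2, h3, fun e' he' => ?_⟩
        rcases Nat.lt_succ_iff_lt_or_eq.mp (show e' < e + 1 by omega) with h | rfl
        · exact h4 e' h
        · rwa [hj]
    · simp only [State.setReg_arr, State.setReg_reg]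
      refine ⟨h1.tail_pos, h1.queue_lt, h1.queue_inj, h1.queue_zero, h1.par_zero, h1.par_queue,
        h1.vis_iff, fun m hm j hj => ?_⟩
      rcases Nat.lt_succ_iff_lt_or_eq.mp hm with h | rfl
      · exact h1.closed m h j hj
      · rw [h3 m le_rfl] at hj
        obtain ⟨e, he, rfl⟩ := (hRent i hiN j).mp hj
        exact h4 e he
    · rw [Finset.sum_range_succ, hc]
      simp only [State.setReg_arr]
      rw [h3 h le_rfl, ← hi]
      have : ∑ m ∈ Finset.range h,
          ((off (s₄.arr aQueue m + 1) - off (s₄.arr aQueue m)) * 40 + 30) =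
          ∑ m ∈ Finset.range h, ((off (s₂.arr aQueue m + 1) - off (s₂.arr aQueue m)) * 40 + 30) :=
        Finset.sum_congr rfl fun m hm => by rw [h3 m (by simp at hm; omega)]
      rw [this]
  · intro c s₂ A₂ ⟨hs, hc⟩
    have htail : s₂.reg rTail = N := hs.lt_tail hR hconn hs.tail_le
    rw [htail] at hs
    refine ⟨?_, hs.searchOrder⟩
    have hinj : Set.InjOn (s₂.arr aQueue) (Finset.range N : Set ℕ) := by simpa using hs.queue_inj
    have himg : (Finset.range N).image (s₂.arr aQueue) = Finset.range N :=
      Finset.eq_of_subset_of_card_le (fun x hx => by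
        obtain ⟨m, hm, rfl⟩ := Finset.mem_image.mp hx
        exact Finset.mem_range.mpr (hs.queue_lt m (Finset.mem_range.mp hm)))
        (by rw [Finset.card_image_of_injOn hinj])
    have := Finset.sum_image (f := fun i => (off (i + 1) - off i) * 40 + 30) hinj
    rw [himg] at this
    rw [hc, ← this, Finset.sum_add_distrib, ← Finset.sum_mul]
    simp only [Finset.sum_const, Finset.card_range, smul_eq_mul]
    omega

end RAM

/-! ### The loop over all nodes -/

theorem IsTable.congr {Adj : ℕ → ℕ → Prop} {n : ℕ} {S F : Finset ℕ} {k : ℕ} {b A B : ℕ → ℕ}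
    (h : IsTable Adj n S k b F A) (hAB : ∀ c < 3 ^ k, B c = A c) : IsTable Adj n S k b F B where
  le c hc := hAB c hc ▸ h.le c hc
  sound c hc := hAB c hc ▸ h.sound c hc
  complete := hAB _ (encode_lt fun _ _ => vertexState_lt ..) ▸ h.complete

namespace RAM
open RAM.Expr (reg)

/-- Process a node: update the table of its parent. -/
def nodeProg : Prog :=
  (rI ≔ aQueue⟦reg rN - 1 - reg rH⟧ ;; rP ≔ aPar⟦reg rI⟧ ;;
    rKi ≔ 4⟦reg rI + 1⟧ - 4⟦reg rI⟧ ;; rKp ≔ 4⟦reg rP + 1⟧ - 4⟦reg rP⟧ ;;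
    rBi ≔ 4⟦reg rI⟧ ;; rBp ≔ 4⟦reg rP⟧ ;; rLi ≔ aPow⟦reg rKi⟧ ;; rLp ≔ aPow⟦reg rKp⟧) ;;
  clearProg ;; scatterProg ;; extendProg ;; joinProg

theorem runs_nodeProg {W : ℕ} {d : Layout} {i p t : ℕ} {s : State} {A B : ℕ → ℕ}
    (hd : d.Valid W) (h : d.Context s) (hi : i ≤ d.N) (hp : p ≤ d.N) (ht : s.reg rH = t)
    (hqi : s.arr aQueue (d.N - 1 - t) = i) (hpi : s.arr aPar i = p)
    (hA : ∀ c < 3 ^ d.size i, s.arr aTab (i * 3 ^ d.K + c) = A c)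
    (hB : ∀ c < 3 ^ d.size p, s.arr aTab (p * 3 ^ d.K + c) = B c)
    (hAn : ∀ c < 3 ^ d.size i, A c ≤ d.n + 1) (hBn : ∀ c < 3 ^ d.size p, B c ≤ d.n + 1) :
    Runs W nodeProg s (1300 * ((d.K + 1) ^ 2 * 3 ^ d.K)) fun s' =>
      ∀ y, s'.arr aTab y = if p * 3 ^ d.K ≤ y ∧ y < p * 3 ^ d.K + 3 ^ d.size p then
        joinTable (d.size p) (d.n + 1) B (messageTable d.Adj (d.size i) (d.size p) (d.bag i)
          (d.bag p) (d.pos i) (d.pos p) (d.n + 1) A) (y - p * 3 ^ d.K)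
        else s.arr aTab y := by
  have hkp := hd.size_le p hp
  have hki := hd.size_le i hi
  have hW := hd.add_lt
  have h3p : 3 ^ d.size p ≤ 3 ^ d.K := Nat.pow_le_pow_right (by norm_num) hkp
  have hM : 3 ^ d.K ≤ (d.K + 1) ^ 2 * 3 ^ d.K := Nat.le_mul_of_pos_left _ (by positivity)
  have h1K : 1 ≤ 3 ^ d.K := Nat.one_le_pow _ _ (by norm_num)
  have hJ : (d.size p + 1) ^ 2 * 3 ^ d.size p ≤ (d.K + 1) ^ 2 * 3 ^ d.K :=
    Nat.mul_le_mul (Nat.pow_le_pow_left (by omega) _) h3p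
  set M := (d.K + 1) ^ 2 * 3 ^ d.K
  refine .seq (d.NodeContext i p) 60 (1300 * M - 60) (by omega) (.of_wp_le rfl ?_)
    fun s₁ A₁ h₁ => ?_
  · have o1 := hd.off_lt (i + 1)
    have o2 := hd.off_lt (p + 1)
    have o3 := hd.off_lt i
    have o4 := hd.off_lt p
    have p1 := h.pow _ hki
    have p2 := h.pow _ hkp
    have w1 := hd.three_pow_lt hki
    have w2 := hd.three_pow_lt hkp
    simp only [Layout.size] at p1 p2 w1 w2
    simp [ht, h.N, hqi, hpi, h.off, p1, p2]
    refine ⟨by omega, by omega, by omega, by omega, by omega, by omega, w1, w2, ?_⟩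
    constructor
    · constructor <;> simp only [State.setReg_arr, State.setReg_reg]
      · simpa using h.n
      · simpa using h.N
      · simpa using h.Np
      · simpa using h.S
      · simpa using h.inf
      · exact h.off
      · exact h.ent
      · exact h.pow
      · exact h.pos
      · exact h.adj
    all_goals simp [Layout.size]
  have e₁ : s₁.arr aTab = s.arr aTab := A₁.arr _ rfl
  refine .seq _ (3 ^ d.size p * 12 + 6) (1300 * M - 78 * M) (by omega) (runs_clearProg hd h₁ hp)
    fun s₂ A₂ h₂ => ?_
  have c₂ := h₁.agree A₂ rfl rfl
  have e₂ : s₂.arr aTab = s.arr aTab := (A₂.arr _ rfl).trans e₁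
  refine .seq _ (100 * M) (1100 * M) (by omega)
    (runs_scatterProg hd c₂ hi hp (by rw [e₂]; exact hA) hAn h₂) fun s₃ A₃ h₃ => ?_
  have c₃ := c₂.agree A₃ rfl rfl
  refine .seq _ (100 * M) (1000 * M) (by omega) (runs_extendProg hd c₃ hi hp h₃)
    fun s₄ A₄ h₄ => ?_
  have c₄ := c₃.agree A₄ rfl rfl
  have e₄ : s₄.arr aTab = s.arr aTab := by rw [A₄.arr _ rfl, A₃.arr _ rfl, e₂]
  refine (runs_joinProg (k := d.size p) (K := d.K) (p := p) (inf := d.n + 1) (A := B)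
    ⟨c₄.kp, c₄.lp, c₄.parent, c₄.inf, c₄.S, c₄.pow⟩ hkp
    (lt_of_le_of_lt (Nat.pow_le_pow_right (by norm_num) hkp) hd.nine_pow_lt) (by omega)
    (by rw [e₄]; exact hB) (fun c hc => by have := hBn c hc; omega) h₄).mono (by omega)
    fun s' _ h' y => by rw [h' y, e₄]

/-- Process all nodes, from the leaves to the root. -/
def nodesProg : Prog := .forTo rH rN nodeProg ;; rn ≔ aTab⟦reg rN * reg rS⟧

/-- The invariant only speaks of tables of nodes with rank at most `N - t`. Tables of processed
nodes are never needed again, since each passes everything to its parent. -/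
theorem runs_nodesProg {W : ℕ} {d : Layout} {s : State} {par rank top queue : ℕ → ℕ}
    {S : Finset ℕ} (hd : d.Valid W) (h : d.Context s)
    (hr : RootedDecomposition d.Adj d.n d.N d.size d.bag par rank top)
    (hlt : ∀ u v, d.Adj u v → v < d.n)
    (hq : s.arr aQueue = queue) (hpar : s.arr aPar = par)
    (hnode : ∀ t < d.N, queue (d.N - 1 - t) < d.N ∧ rank (queue (d.N - 1 - t)) = d.N - t)
    (hS : Dominates d.Adj d.n S) (hmin : ∀ D, Dominates d.Adj d.n D → S.card ≤ D.card)
    (hSn : S.card ≤ d.n)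
    (htab : ∀ i ≤ d.N, ∀ c < 3 ^ d.size i,
      s.arr aTab (i * 3 ^ d.K + c) = initTable (d.size i) (d.n + 1) c) :
    Runs W nodesProg s (d.N * (1310 * ((d.K + 1) ^ 2 * 3 ^ d.K)) + 20)
      fun s' => s'.reg 0 = S.card := by
  have hW := hd.add_lt
  have h3 (i : ℕ) (hi : i ≤ d.N) : 3 ^ d.size i ≤ 3 ^ d.K :=
    Nat.pow_le_pow_right (by norm_num) (hd.size_le i hi)
  have hM : 1 ≤ (d.K + 1) ^ 2 * 3 ^ d.K := Nat.one_le_iff_ne_zero.mpr (by positivity)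
  obtain ⟨node, hnode_def⟩ : ∃ node : ℕ → ℕ, ∀ t, node t = queue (d.N - 1 - t) :=
    ⟨_, fun _ => rfl⟩
  simp only [← hnode_def] at hnode
  refine .seq (fun s' => s'.reg rN = d.N ∧ s'.reg rS = 3 ^ d.K ∧
    s'.arr aTab (d.N * 3 ^ d.K) = S.card)
    (d.N * (1310 * ((d.K + 1) ^ 2 * 3 ^ d.K)) + 6) 10 (by omega)
    (.forTo (m := d.N) (fun t s' => ∀ j ≤ d.N, rank j ≤ d.N - t →
        IsTable d.Adj d.n S (d.size j) (d.bag j) (forgotten d.n d.size d.bag par top node t j)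
          fun c => s'.arr aTab (j * 3 ^ d.K + c)) (1300 * ((d.K + 1) ^ 2 * 3 ^ d.K)) h.N (by omega)
      rfl rfl ?_ ?_ (Nat.add_le_add_right (Nat.mul_le_mul_left _ (by omega)) _) ?_)
    fun s₁ A₁ ⟨h1, h2, h3⟩ => .of_wp_le rfl ?_
  · intro j hj _
    rw [hr.forgotten_zero]
    exact (isTable_initTable (hr.bag_inj j hj)).congr (htab j hj)
  · intro t ht s₁ hA₁ ht₁ hI
    have c₁ := h.agree hA₁ rfl
    obtain ⟨hi, hri⟩ := hnode t ht
    have hip := hr.par_le _ hi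
    have hrp := hr.rank_par _ hi
    have Ti := hI _ hi.le hri.le
    have Tp := hI _ hip (by omega)
    refine (runs_nodeProg hd c₁ hi.le hip ht₁ (by rw [hA₁.arr _ rfl, hq, hnode_def])
      (by rw [hA₁.arr _ rfl, hpar]) (fun _ _ => rfl) (fun _ _ => rfl) Ti.le Tp.le).mono le_rfl
      fun s₂ A₂ h₂ j hj hrj => ?_
    simp only [State.setReg_arr]
    have hji : j ≠ node t := by rintro rfl; omega
    by_cases hjp : j = par (node t)
    · subst hjp
      refine (hr.isTable_step hnode ht hlt hS hmin hSn hd.isPosition (T := fun i c =>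
        s₁.arr aTab (i * 3 ^ d.K + c)) Ti Tp).congr fun c hc => ?_
      rw [h₂, if_pos ⟨by omega, by omega⟩, Nat.add_sub_cancel_left]
    · rw [RootedDecomposition.forgotten_succ_of_ne hjp hji]
      refine (hI j hj (by omega)).congr fun c hc => ?_
      rw [h₂, if_neg]
      rintro ⟨h4, h5⟩
      have hc' := hc.trans_le (h3 j hj)
      have hx := (Nat.sub_lt_iff_lt_add h4).mpr (h5.trans_eq (add_comm ..))
      -- Tables occupy blocks of length `3 ^ K`, so writing to the block of the parent leaves the
      -- others unchanged.
      have := (mul_add_inj (n := 3 ^ d.K) (a := j) (b := c) (c := par (node t))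
        (d := j * 3 ^ d.K + c - par (node t) * 3 ^ d.K) hc' (hx.trans_le (h3 _ hip))).mp
        (by omega)
      exact hjp this.1
  · intro s₁ A₁ hI
    have T := hI d.N le_rfl (by rw [hr.rank_root]; omega)
    rw [hr.forgotten_root hnode, hr.size_root] at T
    exact ⟨by rw [A₁.reg _ rfl, h.N], by rw [A₁.reg _ rfl, h.S], T.eq_card hmin hSn⟩
  · simp [h1, h2, h3]
    omega

end RAM

/-! ### Stored families of lists -/

section

variable {N n : ℕ} {L : Fin N → List (Fin n)}

theorem offsets_succ {i : ℕ} (hi : i < N) :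
    offsets L (i + 1) = offsets L i + (L ⟨i, hi⟩).length := by
  rw [offsets, offsets, if_pos (by omega), if_pos hi.le, List.take_add_one]
  simp [hi]

/-- This default value makes `offsets (N + 1) - offsets N` truncate to 0, so the virtual root `N`
gets an empty bag without a special case in the programs. -/
theorem offsets_of_lt {i : ℕ} (hi : N < i) : offsets L i = 0 := if_neg (by omega)

theorem offsets_succ_sub {i : ℕ} (hi : i < N) :
    offsets L (i + 1) - offsets L i = (L ⟨i, hi⟩).length := by
  rw [offsets_succ hi, Nat.add_sub_cancel_left]

theorem offsets_eq_sum {i : ℕ} (hi : i ≤ N) :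
    offsets L i = ∑ j ∈ Finset.range i, (offsets L (j + 1) - offsets L j) := by
  induction i with
  | zero => simp [offsets]
  | succ i ih =>
    rw [Finset.sum_range_succ, ← ih (by omega), offsets_succ (by omega), Nat.add_sub_cancel_left]

theorem offsets_le (i : ℕ) :
    offsets L i ≤ ∑ j ∈ Finset.range N, (offsets L (j + 1) - offsets L j) := by
  by_cases hi : i ≤ N
  · rw [offsets_eq_sum hi]
    exact Finset.sum_le_sum_of_subset (by simpa using hi)
  · rw [offsets_of_lt (by omega)]
    exact Nat.zero_le _

theorem getElem_flatten_add {α : Type*} (l : List (List α)) (i q : ℕ) (hi : i < l.length)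
    (hq : q < l[i].length) :
    l.flatten[((l.take i).map List.length).sum + q]? = some l[i][q] := by
  induction l generalizing i with
  | nil => simp at hi
  | cons x l ih =>
    cases i with
    | zero =>
      simp only [List.getElem_cons_zero] at hq
      simp [List.getElem?_append_left hq]
    | succ i =>
      simp only [List.getElem_cons_succ] at hq
      simp only [List.length_cons, Nat.add_lt_add_iff_right] at hi
      simp only [List.flatten_cons, List.take_succ_cons, List.map_cons, List.sum_cons, add_assoc]
      rw [List.getElem?_append_right (by omega), Nat.add_sub_cancel_left, ih i hi hq]
      simp

theorem entries_offsets_add {i q : ℕ} (hi : i < N) (hq : q < (L ⟨i, hi⟩).length) :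
    entries L (offsets L i + q) = ((L ⟨i, hi⟩)[q] : ℕ) := by
  have := getElem_flatten_add (List.ofFn L) i q (by simpa using hi) (by simpa using hq)
  rw [entries, offsets, if_pos hi.le, List.getD_eq_getElem?_getD, List.getElem?_map, this]
  simp

theorem entries_lt (hn : 0 < n) (j : ℕ) : entries L j < n := by
  rw [entries, List.getD_eq_getElem?_getD, List.getElem?_map]
  cases ((List.ofFn L).flatten)[j]? with
  | none => simpa using hn
  | some x => exact x.2

theorem exists_entries_iff {i v : ℕ} (hi : i < N) :
    (∃ q < offsets L (i + 1) - offsets L i, entries L (offsets L i + q) = v) ↔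
      ∃ hv : v < n, ⟨v, hv⟩ ∈ L ⟨i, hi⟩ := by
  rw [offsets_succ_sub hi]
  constructor
  · rintro ⟨q, hq, rfl⟩
    rw [entries_offsets_add hi hq]
    exact ⟨Fin.isLt _, List.getElem_mem _⟩
  · rintro ⟨hv, hmem⟩
    obtain ⟨q, hq, e⟩ := List.mem_iff_getElem.mp hmem
    exact ⟨q, hq, by rw [entries_offsets_add hi hq, e]⟩

theorem entries_injOn {i : ℕ} (hi : i < N) (hL : (L ⟨i, hi⟩).Nodup) :
    Set.InjOn (fun q => entries L (offsets L i + q))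
      (Set.Iio (offsets L (i + 1) - offsets L i)) := by
  rw [offsets_succ_sub hi]
  intro q hq q' hq' h
  simp only [Set.mem_Iio] at hq hq'
  dsimp only at h
  rw [entries_offsets_add hi hq, entries_offsets_add hi hq'] at h
  exact (hL.getElem_inj_iff).mp (Fin.val_injective h)

end

/-! ### Rooting a tree decomposition -/

namespace SearchOrder

variable {R : ℕ → ℕ → Prop} {N : ℕ} {queue par : ℕ → ℕ}

theorem exists_queue (h : SearchOrder R N queue par) {i : ℕ} (hi : i < N) :
    ∃ m < N, queue m = i := by
  have := Finset.surjOn_of_injOn_of_card_le (s := Finset.range N) (t := Finset.range N) queue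
    (fun m hm => by simpa using h.queue_lt m (by simpa using hm)) (by simpa using h.queue_inj)
    le_rfl
  obtain ⟨m, hm, e⟩ := this (show i ∈ (Finset.range N : Set ℕ) by simpa using hi)
  exact ⟨m, by simpa using hm, e⟩

/-- The position of a node in the search order, counted from `1`; the virtual root `N` has
position `0`. -/
theorem exists_rank (h : SearchOrder R N queue par) :
    ∃ rank : ℕ → ℕ, rank N = 0 ∧ ∀ m < N, rank (queue m) = m + 1 := by
  classical
  refine ⟨fun i => if h' : ∃ m < N, queue m = i then h'.choose + 1 else 0, ?_, fun m hm => ?_⟩ <;>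
    dsimp only
  · rw [dif_neg]
    rintro ⟨m, hm, e⟩
    have := h.queue_lt m hm
    omega
  · have h' : ∃ l < N, queue l = queue m := ⟨m, hm, rfl⟩
    rw [dif_pos h', h.queue_inj h'.choose_spec.1 hm h'.choose_spec.2]

end SearchOrder

namespace TreeDecomposition

variable {n N : ℕ} {G : SimpleGraph (Fin n)} {k : ℕ → ℕ} {b : ℕ → ℕ → ℕ} {queue par : ℕ → ℕ}
  {rank : ℕ → ℕ}

/-- The adjacency relation of a graph with vertices `0, …, n - 1`. -/
def _root_.SimpleGraph.natAdj (G : SimpleGraph (Fin n)) (u v : ℕ) : Prop :=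
  ∃ (hu : u < n) (hv : v < n), G.Adj ⟨u, hu⟩ ⟨v, hv⟩

/-- Follow parents back through the queue; each parent was found earlier. -/
theorem exists_walk_root (T : TreeDecomposition G (Fin N))
    (h : SearchOrder T.tree.natAdj N queue par) (hrank : ∀ m < N, rank (queue m) = m + 1)
    (hN : 0 < N) (x : Fin N) :
    ∃ w : T.tree.Walk x ⟨0, hN⟩, ∀ y ∈ w.support, rank y ≤ rank x := by
  obtain ⟨m, hm, e⟩ := h.exists_queue x.2
  induction m using Nat.strong_induction_on generalizing x with
  | _ m ih =>
    by_cases h0 : m = 0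
    · subst h0
      obtain rfl : x = ⟨0, hN⟩ := Fin.ext (by rw [← e, h.queue_zero])
      exact ⟨.nil, by simp⟩
    · obtain ⟨l, hl, -, hp, hx, hadj⟩ := h.par_queue m hm (by omega)
      obtain ⟨w, hw⟩ := ih l hl ⟨queue l, hp⟩ (by omega) rfl
      have hadj' : T.tree.Adj x ⟨queue l, hp⟩ := by
        convert hadj.symm using 1
        exact Fin.ext e.symm
      refine ⟨.cons hadj' w, fun y hy => ?_⟩
      rw [SimpleGraph.Walk.support_cons, List.mem_cons] at hy
      rcases hy with rfl | hy
      · exact le_rfl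
      · have := hw y hy
        rw [hrank l (by omega)] at this
        rw [← e, hrank m hm]
        omega

/-- If two bags contain a vertex, then so does the parent of the one that is found later. -/
theorem mem_bag_par (T : TreeDecomposition G (Fin N))
    (h : SearchOrder T.tree.natAdj N queue par) (hrank : ∀ m < N, rank (queue m) = m + 1)
    {i j : Fin N} (hij : rank j < rank i) {v : Fin n} (hi : v ∈ T.bag i) (hj : v ∈ T.bag j) :
    ∃ hp : par i < N, v ∈ T.bag ⟨par i, hp⟩ := by
  have hN : 0 < N := i.pos
  obtain ⟨m, hm, e⟩ := h.exists_queue i.2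
  obtain ⟨m', hm', e'⟩ := h.exists_queue j.2
  rw [← e, hrank m hm, ← e', hrank m' hm'] at hij
  obtain ⟨l, hl, hpar, hp, hx, hadj⟩ := h.par_queue m hm (by omega)
  rw [e] at hpar
  refine ⟨hpar ▸ hp, ?_⟩
  have hadj' : T.tree.Adj i ⟨par i, hpar ▸ hp⟩ := by
    convert hadj.symm using 1
    · exact Fin.ext e.symm
    · exact Fin.ext hpar
  obtain ⟨w₁, h₁⟩ := T.exists_walk_root h hrank hN ⟨par i, hpar ▸ hp⟩
  obtain ⟨w₂, h₂⟩ := T.exists_walk_root h hrank hN j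
  classical
  -- Both walks to the root stay below the rank of `i`. Put together they lead from the parent of
  -- `i` to `j` without meeting `i`, so prefixing `i` gives a path from `i` to `j` through the
  -- parent, to which `path_mem` applies.
  have hnot : i ∉ (w₁.append w₂.reverse).bypass.support := by
    intro hmem
    have := SimpleGraph.Walk.support_bypass_subset_support _ hmem
    rw [SimpleGraph.Walk.mem_support_append_iff, SimpleGraph.Walk.support_reverse,
      List.mem_reverse] at this
    rcases this with h' | h'
    · have : rank i ≤ rank (par i) := h₁ i h'
      rw [hpar, ← e, hrank m hm, hrank l (by omega)] at this
      omega
    · have := h₂ i h'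
      rw [← e, hrank m hm, ← e', hrank m' hm'] at this
      omega
  refine T.path_mem v i j (.cons hadj' (w₁.append w₂.reverse).bypass)
    ((SimpleGraph.Walk.cons_isPath_iff ..).mpr ⟨SimpleGraph.Walk.bypass_isPath _, hnot⟩) hi hj _ ?_
  rw [SimpleGraph.Walk.support_cons]
  exact List.mem_cons_of_mem _ (SimpleGraph.Walk.start_mem_support _)

/-- The rank is the position in the search order, counted from 1, and `top v` is the node of least
rank whose bag contains `v`. That a bag with `v` whose parent lacks `v` must be the top is
`mem_bag_par`. -/
theorem exists_rootedDecomposition (T : TreeDecomposition G (Fin N))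
    (h : SearchOrder T.tree.natAdj N queue par) (hkN : k N = 0)
    (hb : ∀ i < N, Set.InjOn (b i) (Set.Iio (k i)))
    (hbag : ∀ i (hi : i < N) (v : ℕ),
      (∃ q < k i, b i q = v) ↔ ∃ hv : v < n, ⟨v, hv⟩ ∈ T.bag ⟨i, hi⟩) :
    ∃ rank top, RootedDecomposition G.natAdj n N k b par rank top ∧
      ∀ t < N, queue (N - 1 - t) < N ∧ rank (queue (N - 1 - t)) = N - t := by
  obtain ⟨rank, hroot, hrank⟩ := h.exists_rank
  have htop (v : ℕ) : ∃ i, ∀ hv : v < n, ∃ hi : i < N, ⟨v, hv⟩ ∈ T.bag ⟨i, hi⟩ ∧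
      ∀ j (hj : j < N), ⟨v, hv⟩ ∈ T.bag ⟨j, hj⟩ → rank i ≤ rank j := by
    by_cases hv : v < n
    · classical
      obtain ⟨i, hi, hmin⟩ := Finset.exists_min_image
        (Finset.univ.filter fun i : Fin N => ⟨v, hv⟩ ∈ T.bag i) (fun i => rank i)
        (by obtain ⟨i, hi⟩ := T.vertex_mem ⟨v, hv⟩; exact ⟨i, by simpa using hi⟩)
      exact ⟨i, fun _ => ⟨i.2, by simpa using hi, fun j hj hmem => hmin ⟨j, hj⟩ (by simpa using hmem)⟩⟩
    · exact ⟨0, fun hv' => (hv hv').elim⟩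
  choose top htop using htop
  have hrank_pos {i : ℕ} (hi : i < N) : 0 < rank i ∧ rank i ≤ N := by
    obtain ⟨m, hm, rfl⟩ := h.exists_queue hi
    rw [hrank m hm]; omega
  have hmem {i : ℕ} (hi : i < N) {v : ℕ} :
      v ∈ bagSet (k i) (b i) ↔ ∃ hv : v < n, ⟨v, hv⟩ ∈ T.bag ⟨i, hi⟩ := by
    rw [mem_bagSet, hbag i hi]
  have hinj {i j : ℕ} (hi : i < N) (hj : j < N) (e : rank i = rank j) : i = j := by
    obtain ⟨m, hm, rfl⟩ := h.exists_queue hi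
    obtain ⟨m', hm', rfl⟩ := h.exists_queue hj
    rw [hrank m hm, hrank m' hm', Nat.add_right_cancel_iff] at e
    rw [e]
  have hpar {i : ℕ} (hi : i < N) : par i ≤ N ∧ rank (par i) < rank i := by
    obtain ⟨m, hm, rfl⟩ := h.exists_queue hi
    rcases Nat.eq_zero_or_pos m with rfl | h0
    · have := hrank 0 hm
      rw [h.queue_zero] at this ⊢
      rw [h.par_zero, hroot, this]
      omega
    · obtain ⟨l, hl, e, -⟩ := h.par_queue m hm h0
      have := h.queue_lt l (by omega)
      rw [e, hrank m hm, hrank l (by omega)]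
      omega
  refine ⟨rank, top, ⟨fun u v ⟨hu, hv, ha⟩ => ⟨hv, hu, ha.symm⟩, fun i hi q hq => ?_,
    fun i hi => ?_, hkN, fun i hi => (hpar hi).1, fun i hi => (hpar hi).2, hroot, fun i hi => ?_,
    fun i hi j hj e => ?_, fun v hv => (htop v hv).choose, fun v hv => ?_,
    fun i hi v hv hvp => ?_, fun u v ⟨hu, hv, ha⟩ => ?_⟩, fun t ht => ?_⟩
  · rcases Nat.lt_or_eq_of_le hi with hi | rfl
    · exact ((hbag i hi _).mp ⟨q, hq, rfl⟩).choose
    · omega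
  · rcases Nat.lt_or_eq_of_le hi with hi | rfl
    · exact hb i hi
    · rw [hkN]; intro x hx; simp at hx
  · rcases Nat.lt_or_eq_of_le hi with hi | rfl
    · exact (hrank_pos hi).2
    · omega
  · simp only [Set.mem_Iic] at hi hj
    rcases Nat.lt_or_eq_of_le hi with hi | rfl <;> rcases Nat.lt_or_eq_of_le hj with hj | rfl
    · exact hinj hi hj e
    · have := hrank_pos hi; omega
    · have := hrank_pos hj; omega
    · rfl
  · obtain ⟨hi, h1, -⟩ := htop v hv
    exact (hmem hi).mpr ⟨hv, h1⟩
  · obtain ⟨hvn, hv⟩ := (hmem hi).mp hv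
    obtain ⟨hj, h1, h2⟩ := htop v hvn
    by_contra hne
    have hlt := lt_of_le_of_ne (h2 i hi hv) fun e => hne (hinj hj hi e).symm
    obtain ⟨hp, hvp'⟩ := T.mem_bag_par h hrank (i := ⟨i, hi⟩) (j := ⟨top v, hj⟩) hlt hv h1
    exact hvp ((hmem hp).mpr ⟨hvn, hvp'⟩)
  · obtain ⟨i, h1, h2⟩ := T.edge_mem _ _ ha
    exact ⟨i, i.2, (hmem i.2).mpr ⟨hu, h1⟩, (hmem i.2).mpr ⟨hv, h2⟩⟩
  · rw [hrank _ (by omega)]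
    exact ⟨h.queue_lt _ (by omega), by omega⟩

end TreeDecomposition

/-! ### The number of edges -/

namespace RootedDecomposition

variable {Adj : ℕ → ℕ → Prop} {n N : ℕ} {k : ℕ → ℕ} {b : ℕ → ℕ → ℕ} {par rank top : ℕ → ℕ}

/-- Climb from a bag that contains both ends until one of them disappears: that node is the top of
this end and still contains the other. -/
theorem mem_top_of_adj (h : RootedDecomposition Adj n N k b par rank top) {u v : ℕ}
    (huv : Adj u v) :
    v ∈ bagSet (k (top u)) (b (top u)) ∨ u ∈ bagSet (k (top v)) (b (top v)) := by
  obtain ⟨i, hi, hu, hv⟩ := h.edge u v huv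
  induction hr : rank i using Nat.strong_induction_on generalizing i with
  | _ r ih =>
    by_cases hup : u ∈ bagSet (k (par i)) (b (par i))
    · by_cases hvp : v ∈ bagSet (k (par i)) (b (par i))
      · have hpN : par i < N := lt_of_le_of_ne (h.par_le i hi) fun e =>
          h.not_mem_root u (e ▸ hup)
        exact ih _ (hr ▸ h.rank_par i hi) _ hpN hup hvp rfl
      · rw [← h.eq_top i hi v hv hvp]; exact .inr hu
    · rw [← h.eq_top i hi u hu hup]; exact .inl hv

/-- By `mem_top_of_adj`, each neighbour `v` of `u` is in the top bag of `u` or has `u` in its own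
top bag. Either kind contributes at most `n * K` in total, the second after double counting. -/
theorem sum_card_adj_le (h : RootedDecomposition Adj n N k b par rank top) [DecidableRel Adj]
    {K : ℕ} (hK : ∀ i < N, k i ≤ K) :
    ∑ u ∈ Finset.range n, ((Finset.range n).filter (Adj u)).card ≤ 2 * (n * K) := by
  have hcard (u : ℕ) (hu : u < n) : (bagSet (k (top u)) (b (top u))).card ≤ K :=
    Finset.card_image_le.trans (by simpa using hK _ (h.top_lt u hu))
  have hsum : ∑ u ∈ Finset.range n, (bagSet (k (top u)) (b (top u))).card ≤ n * K := by
    simpa using Finset.sum_le_card_nsmul (Finset.range n) _ K fun u hu =>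
      hcard u (Finset.mem_range.mp hu)
  have hdouble := Finset.sum_card_bipartiteAbove_eq_sum_card_bipartiteBelow
    (s := Finset.range n) (t := Finset.range n)
    (fun u v => u ∈ bagSet (k (top v)) (b (top v)))
  calc ∑ u ∈ Finset.range n, ((Finset.range n).filter (Adj u)).card
      ≤ ∑ u ∈ Finset.range n, ((bagSet (k (top u)) (b (top u))).card +
          (Finset.bipartiteAbove (fun u v => u ∈ bagSet (k (top v)) (b (top v)))
            (Finset.range n) u).card) := by
        refine Finset.sum_le_sum fun u _ => (Finset.card_le_card fun v hv => ?_).trans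
          (Finset.card_union_le _ _)
        rw [Finset.mem_filter] at hv
        rw [Finset.mem_union, Finset.mem_bipartiteAbove]
        exact (h.mem_top_of_adj hv.2).imp id fun h' => ⟨hv.1, h'⟩
    _ ≤ n * K + n * K := by
        rw [Finset.sum_add_distrib, hdouble]
        refine Nat.add_le_add hsum ((Finset.sum_le_sum fun v _ => Finset.card_le_card
          (t := bagSet (k (top v)) (b (top v))) fun u hu => ?_).trans hsum)
        exact (Finset.mem_bipartiteBelow _).mp hu |>.2
    _ = 2 * (n * K) := by ring

end RootedDecomposition

theorem SimpleGraph.IsTree.sum_length_le {N : ℕ} {T : SimpleGraph (Fin N)} (hT : T.IsTree)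
    {L : Fin N → List (Fin N)} (hL : IsAdjLists T L) :
    ∑ i ∈ Finset.range N, (offsets L (i + 1) - offsets L i) ≤ 2 * N := by
  classical
  have hlen (i : Fin N) : offsets L (i + 1) - offsets L i = T.degree i := by
    rw [offsets_succ_sub i.2, ← List.toFinset_card_of_nodup (hL i).1,
      ← SimpleGraph.card_neighborFinset_eq_degree]
    congr 1
    ext j
    simp [(hL i).2]
  have h1 := hT.card_edgeFinset
  rw [Fintype.card_fin] at h1
  rw [Finset.sum_range, Finset.sum_congr rfl fun i _ => hlen i,
    SimpleGraph.sum_degrees_eq_twice_card_edges]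
  omega

/-- Passes from `Fin n` to natural numbers. A set `D` may contain numbers from `n` on, but `natAdj`
gives them no neighbours, so restricting to `Fin n` keeps domination. -/
theorem exists_minimum_dominates {n : ℕ} (G : SimpleGraph (Fin n)) :
    ∃ S : Finset ℕ, Dominates G.natAdj n S ∧ (∀ D, Dominates G.natAdj n D → S.card ≤ D.card) ∧
      S.card ≤ n ∧ IsMinDominatingSetSize G S.card := by
  classical
  obtain ⟨S, hS, hmin⟩ := Finset.exists_min_image
    (Finset.univ.filter fun D : Finset (Fin n) => IsDominatingSet G D) Finset.card
    ⟨Finset.univ, by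
      rw [Finset.mem_filter]
      exact ⟨Finset.mem_univ _, fun v => ⟨v, Finset.mem_univ v, .inl rfl⟩⟩⟩
  simp only [Finset.mem_filter, Finset.mem_univ, true_and] at hS hmin
  refine ⟨S.map Fin.valEmbedding, fun v hv => ?_, fun D hD => ?_, ?_, ?_⟩
  · obtain ⟨d, hd, h | h⟩ := hS ⟨v, hv⟩
    · exact .inl (Finset.mem_map.mpr ⟨d, hd, (congrArg Fin.val h).symm⟩)
    · exact .inr ⟨d, Finset.mem_map_of_mem _ hd, d.2, hv, h⟩
  · rw [Finset.card_map]
    refine (hmin (Finset.univ.filter fun v : Fin n => (v : ℕ) ∈ D) fun v => ?_).trans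
      (Finset.card_le_card_of_injOn Fin.val (fun v hv => by simpa using hv)
        Fin.val_injective.injOn)
    rcases hD v v.2 with hv | ⟨u, hu, hun, _, h⟩
    · exact ⟨v, by simpa using hv, .inl rfl⟩
    · exact ⟨⟨u, hun⟩, by simpa using hu, .inr h⟩
  · rw [Finset.card_map]
    simpa using Finset.card_le_univ S
  · rw [Finset.card_map]
    refine ⟨⟨S, hS, rfl⟩, ?_⟩
    rintro _ ⟨D, hD, rfl⟩
    exact hmin D hD

/-- A crude bound that only serves to make the stored offsets small enough for `O(log n)` bits
beyond the part depending on `a`. -/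
theorem sum_offsets_le_mul {N n : ℕ} {L : Fin N → List (Fin n)} (hL : ∀ i, (L i).Nodup) :
    ∑ i ∈ Finset.range N, (offsets L (i + 1) - offsets L i) ≤ N * n := by
  refine (Finset.sum_le_card_nsmul _ _ n fun i hi => ?_).trans (by simp)
  have hi := Finset.mem_range.mp hi
  rw [offsets_succ_sub hi]
  simpa using (hL ⟨i, hi⟩).length_le_card

theorem IsAdjLists.sub_le_card {n : ℕ} {G : SimpleGraph (Fin n)} {L : Fin n → List (Fin n)}
    (hL : IsAdjLists G L) [DecidableRel G.natAdj] {u : ℕ} (hu : u < n) :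
    offsets L (u + 1) - offsets L u ≤ ((Finset.range n).filter (G.natAdj u)).card := by
  have := Finset.card_le_card_of_injOn (s := Finset.range (offsets L (u + 1) - offsets L u))
    (t := (Finset.range n).filter (G.natAdj u)) (fun q => entries L (offsets L u + q))
    (fun q hq => by
      obtain ⟨hv, h⟩ := (exists_entries_iff hu).mp ⟨q, by simpa using hq, rfl⟩
      simpa [hv] using ⟨hu, hv, ((hL _).2 _).mp h⟩)
    (by simpa using entries_injOn hu (hL _).1)
  simpa using this

/-! ### The complete program -/

namespace RAM
open RAM.Expr (reg)

/-- The size of a smallest dominating set from a tree decomposition. -/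
def dominatingSetProg : Prog :=
  maxProg ;; powProg ;; searchProg ;; adjProg ;; posProg ;; initProg ;; nodesProg

section

variable {n N : ℕ} (G : SimpleGraph (Fin n)) (bags : Fin N → List (Fin n))

/-- The size of a largest bag. -/
def bagBound : ℕ := (Finset.range N).sup fun i => offsets bags (i + 1) - offsets bags i

/-- The data of the algorithm on a given input. -/
noncomputable def inputLayout : Layout where
  n := n
  N := N
  K := bagBound bags
  off := offsets bags
  ent := entries bags
  Adj := G.natAdj
  dec := Classical.decRel _
  pos i v := position (fun q => entries bags (offsets bags i + q)) v
    (offsets bags (i + 1) - offsets bags i)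

theorem inputLayout_valid {W : ℕ} (hnodup : ∀ i, (bags i).Nodup) (h9 : 9 ^ bagBound bags < W)
    (hW : n + N + bagBound bags + 2 < W) (hoff : ∀ i, offsets bags i < W) :
    (inputLayout G bags).Valid W where
  size_le i hi := by
    rcases Nat.lt_or_eq_of_le hi with h | rfl
    · exact Finset.le_sup (f := fun i => offsets bags (i + 1) - offsets bags i)
        (Finset.mem_range.mpr h)
    · simp [Layout.size, inputLayout, offsets_of_lt]
  bag_lt i hi q hq := by
    rcases Nat.lt_or_eq_of_le hi with h | rfl
    · exact ((exists_entries_iff h).mp ⟨q, hq, rfl⟩).choose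
    · simp [Layout.size, inputLayout, offsets_of_lt] at hq
  isPosition i hi := by
    rcases Nat.lt_or_eq_of_le hi with h | rfl
    · exact isPosition_position (entries_injOn h (hnodup _))
    · refine isPosition_position fun x hx => ?_
      simp [Layout.size, inputLayout, offsets_of_lt] at hx
  nine_pow_lt := h9
  add_lt := hW
  off_lt := hoff

end

theorem runs_dominatingSetProg {n N W : ℕ} {G : SimpleGraph (Fin n)}
    {T : TreeDecomposition G (Fin N)} {adj : Fin n → List (Fin n)} {tadj : Fin N → List (Fin N)}
    {bags : Fin N → List (Fin n)} (hadj : IsAdjLists G adj) (htadj : IsAdjLists T.tree tadj)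
    (hbags : IsListing T.bag bags) (h9 : 9 ^ bagBound bags < W)
    (hW : n + N + bagBound bags + 2 < W) (ho : ∀ i, offsets adj i < W)
    (ho' : ∀ i, offsets tadj i < W) (ho'' : ∀ i, offsets bags i < W) :
    Runs W dominatingSetProg (inputState adj tadj bags)
      (10000 * ((n + N) * ((bagBound bags + 1) ^ 2 * 3 ^ bagBound bags)))
      fun s' => IsMinDominatingSetSize G (s'.reg 0) := by
  set K := bagBound bags with hK
  set d := inputLayout G bags with hd_def
  have hd : d.Valid W := inputLayout_valid G bags (fun i => (hbags i).1) h9 hW ho''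
  have h3 : 3 ^ K < W := hd.three_pow_lt le_rfl
  have hN : 0 < N := T.isTree.connected.nonempty.elim fun i => i.pos
  have hNo : offsets bags (N + 1) = 0 := offsets_of_lt (by omega)
  obtain ⟨S, hS, hmin, hSn, hSG⟩ := exists_minimum_dominates G
  have hM : 3 ^ K * (K + 1) ≤ (K + 1) ^ 2 * 3 ^ K := by
    rw [pow_two, mul_comm]; exact Nat.mul_le_mul_right _ (Nat.le_mul_of_pos_left _ (by omega))
  have h3K : 1 ≤ 3 ^ K := Nat.one_le_pow _ _ (by norm_num)
  -- From here on `M` is opaque, and the inequalities that follow are what the cost estimates need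
  -- to know about it.
  generalize hMdef : (K + 1) ^ 2 * 3 ^ K = M at hM
  have hKM : K + 1 ≤ M := le_trans (Nat.le_mul_of_pos_left _ h3K) hM
  have hNM : N ≤ N * M := Nat.le_mul_of_pos_right _ (by omega)
  have hnM : n ≤ n * M := Nat.le_mul_of_pos_right _ (by omega)
  have hMNM : M ≤ N * M := Nat.le_mul_of_pos_left _ hN
  have hNKM : N * (K + 1) ≤ N * M := Nat.mul_le_mul_left _ hKM
  have hnKM : n * (K + 1) ≤ n * M := Nat.mul_le_mul_left _ hKM
  rw [Nat.add_mul n N M]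
  refine .seq (fun s' => s'.reg rK = K) (N * 40 + 6) (10000 * (n * M) + 9950 * (N * M)) (by omega)
    (runs_maxProg (s := inputState adj tadj bags) rfl (by omega) rfl rfl ho'') fun s₁ A₁ h₁ => ?_
  refine .seq _ (K * 20 + 30) (10000 * (n * M) + 9890 * (N * M)) (by omega)
    (runs_powProg (n := n) (N := N) (A₁.reg rn rfl) (A₁.reg rN rfl) h₁ hW h3)
    fun s₂ A₂ ⟨hpow₂, hS₂, hinf₂, hNp₂⟩ => ?_
  -- The facts `B` compare the current state with the input, the facts `C` with the state after
  -- `powProg`, and `D₆` starts after the search; each is used for data written before that point.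
  have B₂ := A₁.seq_left.trans A₂.seq_right
  refine .seq _ (2 * N * 40 + N * 40 + 30) (10000 * (n * M) + 9500 * (N * M)) (by omega)
    (runs_searchProg (off := offsets tadj) (ent := entries tadj) (R := T.tree.natAdj) (B₂.reg rN rfl) hN (by omega) (B₂.arr 2 rfl)
      (B₂.arr 3 rfl) (congrFun (B₂.arr aQueue rfl) 0) (congrFun (B₂.arr aVis rfl)) ho'
      (fun i j h => h.2.1) (fun i hi j => ?_) (fun P h0 hP j hj => ?_)
      (T.isTree.sum_length_le htadj)) fun s₃ A₃ h₃ => ?_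
  · rw [exists_entries_iff hi]
    simp only [(htadj _).2]
    exact ⟨fun ⟨_, hj, h⟩ => ⟨hj, h⟩, fun ⟨hj, h⟩ => ⟨hi, hj, h⟩⟩
  · obtain ⟨w⟩ := T.isTree.connected.preconnected ⟨0, hN⟩ ⟨j, hj⟩
    have key {x y : Fin N} (w : T.tree.Walk x y) : P x → P y := by
      induction w with
      | nil => exact id
      | cons h _ ih => exact fun hx => ih (hP _ _ hx ⟨Fin.isLt _, Fin.isLt _, h⟩)
    exact key w h0
  have B₃ := B₂.seq_left.trans A₃.seq_right
  obtain ⟨rank, top, hr, hnode⟩ := T.exists_rootedDecomposition (k := d.size) (b := d.bag) h₃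
    (by simp [Layout.size, hd_def, inputLayout, hNo]) (fun i hi => entries_injOn hi (hbags _).1)
    fun i hi v => (exists_entries_iff hi).trans (by simp only [(hbags _).2])
  have hsum : ∑ u ∈ Finset.range n, (offsets adj (u + 1) - offsets adj u) ≤ 2 * (n * K) := by
    have : DecidableRel G.natAdj := d.dec
    exact (Finset.sum_le_sum fun u hu => hadj.sub_le_card (Finset.mem_range.mp hu)).trans
      (hr.sum_card_adj_le fun i hi => hd.size_le i hi.le)
  refine .seq _ (2 * (n * K) * 20 + n * 25 + 6) (9000 * (n * M) + 9490 * (N * M)) (by nlinarith)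
    (runs_adjProg (off := offsets adj) (ent := entries adj) (Adj := d.Adj) (B₃.reg rn rfl) (by omega) (B₃.arr 0 rfl) (B₃.arr 1 rfl)
      (congrFun (B₃.arr aAdj rfl)) ho (fun u hu e he =>
        ((exists_entries_iff hu).mp ⟨e, he, rfl⟩).choose) (fun u hu v hv => ?_) hsum)
    fun s₄ A₄ h₄ => ?_
  · rw [exists_entries_iff hu]
    simp only [(hadj _).2]
    exact ⟨fun ⟨_, hj, h⟩ => ⟨hj, h⟩, fun ⟨hj, h⟩ => ⟨hu, hj, h⟩⟩
  have B₄ := B₃.seq_left.trans A₄.seq_right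
  have C₄ := (A₃.seq_left (q := adjProg)).trans A₄.seq_right
  refine .seq _ ((N + 1) * (K * 30 + 25) + 6) (9000 * (n * M) + 9400 * (N * M)) (by nlinarith)
    (runs_posProg (n := n) (N := N) (K := K) (B₄.reg rn rfl) ((C₄.reg rNp rfl).trans hNp₂)
      (B₄.arr 4 rfl) (B₄.arr 5 rfl) (congrFun (B₄.arr aPos rfl)) ho'' hd.bag_lt hd.size_le hW)
    fun s₅ A₅ h₅ => ?_
  have B₅ := B₄.seq_left.trans A₅.seq_right
  have C₅ := C₄.seq_left.trans A₅.seq_right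
  refine .seq _ ((N + 1) * (3 ^ K * (K * 25 + 30) + 30) + 6) (9000 * (n * M) + 9200 * (N * M))
    (by nlinarith)
    (runs_initProg (n := n) (N := N) (K := K) ((C₅.reg rNp rfl).trans hNp₂)
      ((C₅.reg rS rfl).trans hS₂) ((C₅.reg rInf rfl).trans hinf₂) (B₅.arr 4 rfl)
      (by rw [C₅.arr aPow rfl]; exact hpow₂) ho'' hd.size_le hW h3) fun s₆ A₆ h₆ => ?_
  have B₆ := B₅.seq_left.trans A₆.seq_right
  have C₆ := C₅.seq_left.trans A₆.seq_right
  have D₆ := (A₄.seq_left (q := posProg)).trans A₅.seq_right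
  refine (runs_nodesProg (d := d) (queue := s₃.arr aQueue) (par := s₃.arr aPar) hd ?_ hr
    (fun u v h => h.2.1) ?_ ?_ hnode hS hmin hSn h₆).mono ?_ fun s' _ h' => ?_
  · constructor
    · exact B₆.reg rn rfl
    · exact B₆.reg rN rfl
    · exact (C₆.reg rNp rfl).trans hNp₂
    · exact (C₆.reg rS rfl).trans hS₂
    · exact (C₆.reg rInf rfl).trans hinf₂
    · exact B₆.arr 4 rfl
    · exact B₆.arr 5 rfl
    · rw [C₆.arr aPow rfl]; exact hpow₂
    · rw [A₆.arr aPos rfl]; exact h₅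
    · rw [A₆.arr aAdj rfl, A₅.arr aAdj rfl]; exact h₄
  · rw [A₆.arr aQueue rfl, D₆.arr aQueue rfl]
  · rw [A₆.arr aPar rfl, D₆.arr aPar rfl]
  · show N * (1310 * ((K + 1) ^ 2 * 3 ^ K)) + 20 ≤ _
    rw [hMdef]
    nlinarith
  · rw [h']; exact hSG

end RAM

/-! ### Word size and the final bounds -/

theorem bagBound_le {n N : ℕ} {G : SimpleGraph (Fin n)} {T : TreeDecomposition G (Fin N)}
    {bags : Fin N → List (Fin n)} (hbags : IsListing T.bag bags) :
    RAM.bagBound bags ≤ T.width + 1 := by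
  refine Finset.sup_le fun i hi => ?_
  have hi := Finset.mem_range.mp hi
  rw [offsets_succ_sub hi, ← List.toFinset_card_of_nodup (hbags _).1]
  have h : (bags ⟨i, hi⟩).toFinset = T.bag ⟨i, hi⟩ := by
    ext v; simp [(hbags _).2]
  have := Finset.le_sup (f := fun i : Fin N => (T.bag i).card) (Finset.mem_univ ⟨i, hi⟩)
  rw [h, TreeDecomposition.width]
  omega

theorem RAM.inputState_below {n N W : ℕ} {adj : Fin n → List (Fin n)}
    {tadj : Fin N → List (Fin N)} {bags : Fin N → List (Fin n)} (hn0 : 0 < n) (hN0 : 0 < N)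
    (hn : n < W) (hN : N < W) (ho : ∀ i, offsets adj i < W)
    (ho' : ∀ i, offsets tadj i < W) (ho'' : ∀ i, offsets bags i < W) :
    (inputState adj tadj bags).Below W := by
  refine ⟨fun x => ?_, fun a i => ?_⟩
  · rcases x with - | - | x
    exacts [hn, hN, by simp only [inputState]; omega]
  · rcases a with - | - | - | - | - | - | a
    exacts [ho i, (entries_lt hn0 i).trans hn, ho' i, (entries_lt hN0 i).trans hN, ho'' i,
      (entries_lt hn0 i).trans hn, by simp only [inputState]; omega]

/-- A power of two that bounds all numbers that are stored, in terms of the size of the input and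
the size of a largest bag. -/
theorem exists_word_size {n N K a : ℕ} (hn : 0 < n) (hN : N ≤ a * n) (hK : K ≤ n) :
    9 ^ K < 2 ^ (2 * Nat.log 2 n + 4 * K + 2 * a + 6) ∧
    n + N + K + 2 < 2 ^ (2 * Nat.log 2 n + 4 * K + 2 * a + 6) ∧
    n * n < 2 ^ (2 * Nat.log 2 n + 4 * K + 2 * a + 6) ∧
    N * N < 2 ^ (2 * Nat.log 2 n + 4 * K + 2 * a + 6) ∧
    N * n < 2 ^ (2 * Nat.log 2 n + 4 * K + 2 * a + 6) := by
  set m := 2 ^ Nat.log 2 n with hm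
  have h1 : n < 2 * m := by
    have := Nat.lt_pow_succ_log_self (b := 2) (by norm_num) n
    rwa [pow_succ, mul_comm] at this
  have h2 : a < 2 ^ a := Nat.lt_two_pow_self
  set α := 2 ^ a with hα
  have h3 : 9 ^ K ≤ 16 ^ K := Nat.pow_le_pow_left (by norm_num) K
  have h16 : 1 ≤ 16 ^ K := Nat.one_le_pow _ _ (by norm_num)
  have hm1 : 1 ≤ m := Nat.one_le_pow _ _ (by norm_num)
  have hα1 : 1 ≤ α := by omega
  -- With `m ≤ n < 2 * m` and `a < α`, both `n` and `N` are below `2 * m * α`, so the factor `64 *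
  -- (m * α) ^ 2` covers products of two of them and `16 ^ K` covers `9 ^ K`.
  have he : 2 ^ (2 * Nat.log 2 n + 4 * K + 2 * a + 6) = 64 * (m * α) ^ 2 * 16 ^ K := by
    rw [hm, hα, pow_add, pow_add, pow_add, pow_mul 2 4, mul_comm 2 (Nat.log 2 n), mul_comm 2 a,
      pow_mul, pow_mul]
    norm_num
    ring
  rw [he]
  have hmα : 1 ≤ m * α := Nat.mul_pos hm1 hα1
  have hle : 64 * (m * α) ^ 2 ≤ 64 * (m * α) ^ 2 * 16 ^ K := Nat.le_mul_of_pos_right _ h16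
  have hn2 : n < 2 * (m * α) := h1.trans_le (Nat.mul_le_mul_left _ (Nat.le_mul_of_pos_right _ hα1))
  have hN2 : N < 2 * (m * α) := by
    calc N ≤ a * n := hN
      _ < α * (2 * m) := by nlinarith
      _ = 2 * (m * α) := by ring
  have hsq : m * α ≤ (m * α) ^ 2 := Nat.le_self_pow (by norm_num) _
  generalize m * α = x at *
  refine ⟨h3.trans_lt ?_, by omega, ?_, ?_, ?_⟩
  · have : 1 * 16 ^ K < 64 * x ^ 2 * 16 ^ K := Nat.mul_lt_mul_of_pos_right (by omega) h16
    omega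
  all_goals refine lt_of_lt_of_le ?_ hle
  all_goals nlinarith

/-- There is one program that computes the minimum size of a dominating set (as the content of
register `0` when it halts) from a graph with `n` vertices and a tree decomposition of it of
width `t` with at most `a * n` nodes, in `O(3 ^ t * t ^ 2 * n)` operations on numbers of
`O(t + log n)` bits. For `t = 0` the bounds are those for `t = 1`. -/
theorem mainTheorem10 :
    ∃ P : RAM.Prog, ∀ a : ℕ, ∃ C : ℕ,
      ∀ (n N t : ℕ) (G : SimpleGraph (Fin n)) (T : TreeDecomposition G (Fin N))
        (adj : Fin n → List (Fin n)) (tadj : Fin N → List (Fin N))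
        (bags : Fin N → List (Fin n)),
        N ≤ a * n → T.width = t →
        IsAdjLists G adj → IsAdjLists T.tree tadj → IsListing T.bag bags →
        ∃ (c : ℕ) (s : RAM.State),
          RAM.Exec (C * (max t 1 + Nat.log 2 n)) P (inputState adj tadj bags) c s ∧
          c ≤ C * (3 ^ t * max t 1 ^ 2 * n) ∧
          IsMinDominatingSetSize G (s.reg 0) := by

  refine ⟨RAM.dominatingSetProg, fun a =>
    -- The first summand covers the number of operations, for which `270000 * (a + 1)` is needed.
    -- The second covers the bits: stored numbers have `w ≤ (2 * a + 14) * (max t 1 + log n)` bits,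
    -- and expressions multiply this by the size of the program.
    ⟨2000000 * (a + 1) + (2 * a + 14) * RAM.dominatingSetProg.size, ?_⟩⟩
  intro n N t G T adj tadj bags hN ht hadj htadj hbags
  have hN0 : 0 < N := T.isTree.connected.nonempty.elim fun i => i.pos
  -- For `n = 0` the bound `N ≤ a * n` would leave the tree without nodes.
  have hn0 : 0 < n := Nat.pos_of_ne_zero fun h => by subst h; omega
  have hKt : RAM.bagBound bags ≤ t + 1 := ht ▸ bagBound_le hbags
  have hKn : RAM.bagBound bags ≤ n := Finset.sup_le fun i hi => by
    rw [offsets_succ_sub (Finset.mem_range.mp hi)]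
    simpa using (hbags ⟨i, Finset.mem_range.mp hi⟩).1.length_le_card
  obtain ⟨h9, hW, hnn, hNN, hNn⟩ := exists_word_size hn0 hN hKn
  set K := RAM.bagBound bags with hK
  set w := 2 * Nat.log 2 n + 4 * K + 2 * a + 6 with hw
  have ho (i : ℕ) : offsets adj i < 2 ^ w :=
    ((offsets_le i).trans (sum_offsets_le_mul fun i => (hadj i).1)).trans_lt hnn
  have ho' (i : ℕ) : offsets tadj i < 2 ^ w :=
    ((offsets_le i).trans (sum_offsets_le_mul fun i => (htadj i).1)).trans_lt hNN
  have ho'' (i : ℕ) : offsets bags i < 2 ^ w :=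
    ((offsets_le i).trans (sum_offsets_le_mul fun i => (hbags i).1)).trans_lt hNn
  obtain ⟨c, s, he, hc, hs⟩ := RAM.runs_dominatingSetProg hadj htadj hbags h9 hW ho ho' ho''
  have hT1 : 1 ≤ max t 1 := le_max_right ..
  have hTt : t ≤ max t 1 := le_max_left ..
  refine ⟨c, s, (he.exec (by omega) (RAM.inputState_below hn0 hN0 (by omega) (by omega) ho ho' ho'')
    ?_).1, hc.trans ?_, hs⟩
  · rw [← pow_mul]
    refine Nat.pow_le_pow_right (by norm_num) ?_
    have hwle : w ≤ (2 * a + 14) * (max t 1 + Nat.log 2 n) := by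
      have : 2 * a + 14 ≤ (2 * a + 14) * max t 1 := Nat.le_mul_of_pos_right _ hT1
      nlinarith
    calc w * RAM.dominatingSetProg.size
        ≤ (2 * a + 14) * (max t 1 + Nat.log 2 n) * RAM.dominatingSetProg.size :=
          Nat.mul_le_mul_right _ hwle
      _ = (2 * a + 14) * RAM.dominatingSetProg.size * (max t 1 + Nat.log 2 n) := by ring
      _ ≤ _ := Nat.mul_le_mul_right _ (Nat.le_add_left ..)
  -- A bag has at most `t + 1` vertices, and `t + 2 ≤ 3 * max t 1`; this yields the factor 9, and `3
  -- ^ (t + 1)` yields the factor 3.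
  · have h1 : (K + 1) ^ 2 ≤ 9 * max t 1 ^ 2 := by
      have : K + 1 ≤ 3 * max t 1 := by omega
      calc (K + 1) ^ 2 ≤ (3 * max t 1) ^ 2 := Nat.pow_le_pow_left this 2
        _ = _ := by ring
    have h2 : 3 ^ K ≤ 3 * 3 ^ t := by
      rw [← pow_succ']; exact Nat.pow_le_pow_right (by norm_num) hKt
    calc 10000 * ((n + N) * ((K + 1) ^ 2 * 3 ^ K))
        ≤ 10000 * ((n + a * n) * (9 * max t 1 ^ 2 * (3 * 3 ^ t))) := by gcongr
      _ = 270000 * (a + 1) * (3 ^ t * max t 1 ^ 2 * n) := by ring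
      _ ≤ _ := Nat.mul_le_mul_right _ (by omega)
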